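/- For $q=e^{2\pi i\tau}$, $\zeta=e^{2\pi i z}$, $M\in\tfrac12\mathbb N$ (with $\mathbb N=\{1,2,\dots\}$), $\ell\in M+\mathbb Z$ and $\varepsilon\in\{0,1\}$ put $$\theta^+_{\ell,\varepsilon,M}(z;\tau)=\sum_{n\ge 0}(-1)^{n\varepsilon}q^{\frac{(2Mn-\ell)^2}{4M}}\zeta^{2Mn-\ell}\qquad(z\in\mathbb C,\ \operatorname{Im}\tau>0).$$ **Conventions.** The (regularized) radial value of a function $F$ on the upper half-plane at $x\in\mathbb Q$ is the constant $v$ such that $F(x+it)=s\,t^{-1/2}+v+o(1)$ as $t\to0^+$ for some constant $s$; the radial limit exists exactly when $s=0$, and it then equals $v$. For $\gamma=\begin{pmatrix}a&b\\c&d\end{pmatrix}\in\Gamma_1(4)$, $f:\mathbb Q\to\mathbb C$ and $x\in\mathbb Q$ with $cx+d\ne0$ put $$(f|_{1/2}\gamma)(x)=\left(\frac cd\right)(cx+d)^{-1/2}f(\gamma x),$$ where $\left(\frac cd\right)$ is the Jacobi symbol $\left(\frac c{|d|}\right)$, with an additional factor $-1$ if $c<0$ and $d<0$, and $(cx+d)^{1/2}$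 is the boundary value at $w=x$ of the principal branch of $(cw+d)^{1/2}$ on the lower half-plane $\{\operatorname{Im}w<0\}$. **Theorem.** Let $m\in-\tfrac12\mathbb N$, $\ell\in m+\mathbb Z$, $\varepsilon\in\{0,1\}$ and $\lambda,\mu\in\mathbb Q$. There are $r\in\mathbb Q$, a function $f:\mathbb Q\to\mathbb C$ and a congruence subgroup $\Gamma\subseteq\Gamma_1(4)$ such that 1. for every $x\in\mathbb Q$, $f(x)$ is the radial value at $x$ of $\tau\mapsto q^{r}\,\theta^+_{\ell,\varepsilon,-m}(\lambda\tau+\mu;\tau)$; 2. $f$ is a quantum modular form of weight $1/2$ on $\Gamma$ whose cocycles are real-analytic except at one point: for every $\gamma=\begin{pmatrix}a&b\\c&d\end{pmatrix}\in\Gamma$ there is a real-analytic function $r_\gamma$ on $\{x\in\mathbb R: cx+d\neq0\}$ (that is, on $\mathbb R\setminus\{-d/c\}$, or on $\mathbb R$ if $c=0$) with $f(x)-(f|_{1/2}\gamma)(x)=r_\gamma(x)$ for all $x\in\mathbb Q$ with $cx+d\ne0$. -/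

import Mathlib

open Filter Topology

noncomputable section

/-- The partial theta function
`θ⁺_{ℓ,ε,M}(z;τ) = ∑_{n ≥ 0} (-1)^{nε} q^{(2Mn-ℓ)²/(4M)} ζ^{2Mn-ℓ}`,
where `q = e^{2πiτ}` and `ζ = e^{2πiz}` (absolutely convergent for `M > 0`, `Im τ > 0`). -/
def partialTheta (l : ℚ) (ε : ℕ) (M : ℚ) (z τ : ℂ) : ℂ :=
  ∑' n : ℕ, (-1 : ℂ) ^ (n * ε)
    * Complex.exp (2 * Real.pi * Complex.I * τ * (((2 * M * n - l) ^ 2 / (4 * M) : ℚ) : ℂ))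
    * Complex.exp (2 * Real.pi * Complex.I * z * ((2 * M * n - l : ℚ) : ℂ))

/-- `v` is the (regularized) radial boundary value at the rational point `x` of the function `F`
on the upper half-plane: `F (x + it) = s t^{-1/2} + v + o(1)` as `t → 0⁺`, for some constant `s`.
The numbers `s` and `v` are unique. The radial limit of `F` at `x` exists (in `ℂ`)
precisely when `s = 0`, and it is then equal to `v`. -/
def HasRadialValue (F : ℂ → ℂ) (x : ℚ) (v : ℂ) : Prop :=
  ∃ s : ℂ, Tendsto (fun t : ℝ => F ((x : ℂ) + t * Complex.I) - s * ((√t : ℝ) : ℂ)⁻¹)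
    (𝓝[>] 0) (𝓝 v)

/-- An ordinary radial limit is a regularized radial value. -/
theorem HasRadialValue.of_tendsto {F : ℂ → ℂ} {x : ℚ} {v : ℂ}
    (h : Tendsto (fun t : ℝ => F ((x : ℂ) + t * Complex.I)) (𝓝[>] 0) (𝓝 v)) :
    HasRadialValue F x v :=
  ⟨0, by simpa using h⟩

/-- Regularized radial values are unique. -/
theorem HasRadialValue.unique {F : ℂ → ℂ} {x : ℚ} {v w : ℂ}
    (hv : HasRadialValue F x v) (hw : HasRadialValue F x w) : v = w := by
  obtain ⟨s, hs⟩ := hv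
  obtain ⟨s', hs'⟩ := hw
  have hsq : Tendsto (fun t : ℝ => ((√t : ℝ) : ℂ)) (𝓝[>] 0) (𝓝 0) := by
    have : Tendsto (fun t : ℝ => ((√t : ℝ) : ℂ)) (𝓝 0) (𝓝 ((√(0 : ℝ) : ℝ) : ℂ)) :=
      (Complex.continuous_ofReal.comp Real.continuous_sqrt).tendsto 0
    simp only [Real.sqrt_zero, Complex.ofReal_zero] at this
    exact this.mono_left nhdsWithin_le_nhds
  have hd := hs.sub hs'
  have h1 := hd.mul hsq
  have h2 : Tendsto (fun _ : ℝ => s' - s) (𝓝[>] 0) (𝓝 ((v - w) * 0)) := by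
    refine h1.congr' ?_
    filter_upwards [self_mem_nhdsWithin] with t ht
    have ht' : ((√t : ℝ) : ℂ) ≠ 0 := by
      exact_mod_cast (Real.sqrt_pos.mpr ht).ne'
    field_simp
    ring
  have h3 : s' = s := by
    have := tendsto_nhds_unique h2 tendsto_const_nhds
    rw [mul_zero] at this
    exact (sub_eq_zero.mp this.symm)
  subst h3
  exact tendsto_nhds_unique hs hs'

/-- The quadratic residue symbol `(c/d)` for odd `d` (possibly negative), with Shimura's sign
convention: `(c/d) = (c/|d|)`, except that `(c/d) = -(c/|d|)` if both `c` and `d` are negative. -/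
def thetaSymbol (c d : ℤ) : ℤ :=
  if c < 0 ∧ d < 0 then -jacobiSym c d.natAbs else jacobiSym c d.natAbs

/-- The boundary value at the real point `x` of the principal branch of `(cz+d)^{1/2}` on the lower
half-plane. For `cx + d > 0` it is the positive root; for `cx + d < 0` it is `-i √|cx+d|` if
`c > 0` and `i √|cx+d|` if `c < 0`. -/
def boundarySqrt (c d : ℤ) (x : ℝ) : ℂ :=
  if 0 ≤ c * x + d then ((√(c * x + d) : ℝ) : ℂ)
  else if 0 < c then -Complex.I * ((√(-(c * x + d)) : ℝ) : ℂ)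
  else Complex.I * ((√(-(c * x + d)) : ℝ) : ℂ)

/-- `boundarySqrt` is the limit, from within the lower half-plane, of the principal branch. -/
theorem tendsto_boundarySqrt (c d : ℤ) (x : ℝ) (hc : c ≠ 0) (hx : (c : ℝ) * x + d ≠ 0) :
    Tendsto (fun s : ℝ => ((c : ℂ) * ((x : ℂ) - s * Complex.I) + d) ^ (1 / 2 : ℂ))
      (𝓝[>] 0) (𝓝 (boundarySqrt c d x)) := by
  have hsq : ∀ y : ℝ, 0 < y → ((y : ℂ)) ^ (1 / 2 : ℂ) = ((√y : ℝ) : ℂ) := fun y hy => by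
    rw [Real.sqrt_eq_rpow, Complex.ofReal_cpow hy.le]; norm_num
  have hw0 : Tendsto (fun s : ℝ => (c : ℂ) * ((x : ℂ) - s * Complex.I) + d) (𝓝[>] 0)
      (𝓝 (((c * x + d : ℝ)) : ℂ)) := by
    have hcont : Continuous (fun s : ℝ => (c : ℂ) * ((x : ℂ) - s * Complex.I) + d) := by fun_prop
    have := (hcont.tendsto 0).mono_left (nhdsWithin_le_nhds (s := Set.Ioi (0 : ℝ)))
    simpa using this
  have him : ∀ s : ℝ, ((c : ℂ) * ((x : ℂ) - s * Complex.I) + d).im = -(c * s) := fun s => by simp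
  unfold boundarySqrt
  split_ifs with h1 h2
  · have h1' : 0 < (c : ℝ) * x + d := lt_of_le_of_ne h1 hx.symm
    rw [← hsq _ h1']
    exact (continuousAt_cpow_const (Or.inl (by simpa using h1'))).tendsto.comp hw0
  all_goals
    have h1' : 0 < -((c : ℝ) * x + d) := by linarith [not_le.mp h1]
    have key : Tendsto (fun s : ℝ => (-((c : ℂ) * ((x : ℂ) - s * Complex.I) + d)) ^ (1 / 2 : ℂ))
        (𝓝[>] 0) (𝓝 ((√(-(c * x + d)) : ℝ) : ℂ)) := by
      rw [← hsq _ h1']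
      refine (continuousAt_cpow_const (Or.inl (by simpa using h1'))).tendsto.comp ?_
      simpa using hw0.neg
  · refine (key.const_mul (-Complex.I)).congr' ?_
    filter_upwards [self_mem_nhdsWithin] with s hs
    have hc' : (0 : ℝ) < c := by exact_mod_cast h2
    have hs' : 0 < s := hs
    have hneg : ((c : ℂ) * ((x : ℂ) - s * Complex.I) + d).im < 0 := by
      rw [him]; nlinarith [mul_pos hc' hs']
    set w := (c : ℂ) * ((x : ℂ) - s * Complex.I) + d with hw
    have hwne : w ≠ 0 := fun h => by simp [h] at hneg
    rw [Complex.cpow_def_of_ne_zero hwne, Complex.cpow_def_of_ne_zero (neg_ne_zero.mpr hwne),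
      Complex.log, Complex.log, norm_neg, Complex.arg_neg_eq_arg_add_pi_of_im_neg hneg,
      ← Complex.exp_neg_pi_div_two_mul_I, ← Complex.exp_add]
    congr 1
    push_cast
    ring
  · refine (key.const_mul Complex.I).congr' ?_
    filter_upwards [self_mem_nhdsWithin] with s hs
    have hc' : (c : ℝ) < 0 := by exact_mod_cast lt_of_le_of_ne (not_lt.mp h2) hc
    have hs' : 0 < s := hs
    have hpos : 0 < ((c : ℂ) * ((x : ℂ) - s * Complex.I) + d).im := by
      rw [him]; nlinarith [mul_pos (neg_pos.mpr hc') hs']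
    set w := (c : ℂ) * ((x : ℂ) - s * Complex.I) + d with hw
    have hwne : w ≠ 0 := fun h => by simp [h] at hpos
    have hI : ∀ u : ℂ, Complex.I * Complex.exp u = Complex.exp (Real.pi / 2 * Complex.I + u) :=
      fun u => by rw [Complex.exp_add, Complex.exp_pi_div_two_mul_I]
    rw [Complex.cpow_def_of_ne_zero hwne, Complex.cpow_def_of_ne_zero (neg_ne_zero.mpr hwne),
      Complex.log, Complex.log, norm_neg, Complex.arg_neg_eq_arg_sub_pi_of_im_pos hpos,
      hI]
    congr 1
    push_cast
    ring

/-- The Möbius action on rational numbers (to be used where `cx + d ≠ 0`). -/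
def moebiusRat (γ : Matrix.SpecialLinearGroup (Fin 2) ℤ) (x : ℚ) : ℚ :=
  (γ 0 0 * x + γ 0 1) / (γ 1 0 * x + γ 1 1)

/-- The Petersson slash operator of weight `1/2` for `γ = (a b; c d)` in `Γ₁(4)`, at a rational
point `x` with `cx + d ≠ 0`: `(f|γ)(x) = (c/d) (cx+d)^{-1/2} f(γx)`. Here `(c/d)` is the theta
multiplier, whose other factor `ε_d` is `1` because `d ≡ 1 (mod 4)`. -/
def slashHalf (f : ℚ → ℂ) (γ : Matrix.SpecialLinearGroup (Fin 2) ℤ) (x : ℚ) : ℂ :=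
  (thetaSymbol (γ 1 0) (γ 1 1) : ℂ) * (boundarySqrt (γ 1 0) (γ 1 1) (x : ℝ))⁻¹
    * f (moebiusRat γ x)

/-- `f`, defined on the cofinite set `Q` of rationals, is a quantum modular form of weight `1/2` on
the congruence subgroup `Γ` of `Γ₁(4)`, such that for every `γ = (a b; c d)` in `Γ` the cocycle
`f - f|γ` extends to a function that is real-analytic on `{x ∈ ℝ : cx + d ≠ 0}`, that is, on `ℝ`
with the single point `-d/c` removed (on all of `ℝ` if `c = 0`). -/
structure IsQuantumModularFormHalf (Γ : Subgroup (Matrix.SpecialLinearGroup (Fin 2) ℤ))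
    (Q : Set ℚ) (f : ℚ → ℂ) : Prop where
  isCongruenceSubgroup : CongruenceSubgroup.IsCongruenceSubgroup Γ
  le_gamma1 : Γ ≤ CongruenceSubgroup.Gamma1 4
  cofinite : Qᶜ.Finite
  cocycle : ∀ γ ∈ Γ, ∃ R : ℝ → ℂ,
    AnalyticOnNhd ℝ R {x : ℝ | (γ 1 0 : ℝ) * x + (γ 1 1 : ℝ) ≠ 0} ∧
    ∀ x ∈ Q, (γ 1 0 : ℚ) * x + (γ 1 1 : ℚ) ≠ 0 → moebiusRat γ x ∈ Q →
      f x - slashHalf f γ x = R x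

end

/-! Put `M = -m` and `r = Mλ²`. Multiplication by `q^r` completes the square, and up to finitely
many terms (an entire function of `τ`) the series becomes `∑_{n ≥ 0} ψ(n) e^{πi n² τ/N}` with `ψ`
periodic modulo an even `N`. Split `ψ` into its even and odd parts.

The even part is half of a two-sided theta series plus `ψ(0)/2`. By Poisson summation the two-sided
series is `s t^{-1/2} + o(1)` at every rational (`tendsto_fullTheta_radial`), so only `ψ(0)/2`
enters the radial value.

The odd part is an Eichler integral. Since `∫_0^∞ n y^{-1/2} e^{-πn²y} dy = 1`, one has `halfTheta c
τ = ∫_0^∞ oddTheta c (τ+iy) y^{-1/2} dy`, where `oddTheta c = ∑ n c(n) e^{πi n²τ}` has weight `3/2`.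
For odd `c` this series decays at every rational, so the radial limit at `x` is `eichler c x x`, the
integral of `oddTheta c w · (-i(w-x))^{-1/2}` from `x` to `i∞`. Under `w ↦ -1/(P²w)` this
differential goes, up to a constant, to the one for the discrete Fourier transform of `c` and the
point `-1/(P²x)`. Hence the value at `x` plus a multiple of the transformed value at `-1/(P²x)` is
the integral from `0` to `i∞` (`eichler_inversion`). That integral is analytic in `x ≠ 0`, because
the singularity of the kernel stays off the path (`analyticOnNhd_eichler_zero`).

For `γ` in `Γ(8N)` with `c > 0`, the action on `x/N` is a translation by `d/(Nc)`, the inversion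
with `P = Nc`, and a translation by `a/(Nc)`; the case `c < 0` uses `-γ`. By `dft_twist` the Fourier
transform of `ψ` twisted by `-d/(Nc)` is a Gauss sum times `ψ` twisted by `a/(Nc)`, so a single
function is related to itself. The Gauss sum, evaluated by Landsberg–Schaar reciprocity and
Euclidean descent (`quadSum_reciprocity`, `quadSum_odd`), supplies the theta multiplier. The entire
summands have analytic cocycles for trivial reasons. -/

noncomputable section

open Complex

/-! ### Theta series with periodic coefficients and Poisson summation -/

/-- The discrete Fourier transform of `c` modulo `P`. -/
def dft (P : ℕ) (c : ℤ → ℂ) (n : ℤ) : ℂ :=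
  ∑ j : Fin P, c (j : ℕ) * cexp (2 * Real.pi * I * n * ((j : ℕ) / P))

/-- The theta series with coefficients `c`. -/
def fullTheta (c : ℤ → ℂ) (τ : ℂ) : ℂ := ∑' n : ℤ, c n * cexp (Real.pi * I * n ^ 2 * τ)

/-- The one-sided theta series with coefficients `c`. -/
def halfTheta (c : ℤ → ℂ) (τ : ℂ) : ℂ := ∑' n : ℕ, c n * cexp (Real.pi * I * n ^ 2 * τ)

/-- The one-sided weight `3/2` theta series with coefficients `c`. -/
def oddTheta (c : ℤ → ℂ) (τ : ℂ) : ℂ :=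
  ∑' n : ℕ, (n : ℂ) * (c n * cexp (Real.pi * I * n ^ 2 * τ))

theorem exists_bound_of_periodic {c : ℤ → ℂ} {P : ℕ} (hP : 0 < P)
    (hc : Function.Periodic c (P : ℤ)) : ∃ C : ℝ, 0 ≤ C ∧ ∀ n, ‖c n‖ ≤ C := by
  refine ⟨∑ j ∈ Finset.range P, ‖c j‖, by positivity, fun n => ?_⟩
  have hP' : (P : ℤ) ≠ 0 := by positivity
  have h1 : c n = c ((n % P).toNat : ℤ) := by
    rw [Int.toNat_of_nonneg (Int.emod_nonneg _ hP')]
    conv_lhs => rw [← Int.emod_add_mul_ediv n P]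
    have := hc.int_mul (n / P) (n % P)
    simpa [mul_comm] using this
  rw [h1]
  refine Finset.single_le_sum (f := fun j : ℕ => ‖c j‖) (fun _ _ => norm_nonneg _) ?_
  have := Int.emod_lt_of_pos n (show (0 : ℤ) < P by positivity)
  have := Int.emod_nonneg n hP'
  simp only [Finset.mem_range]
  omega

theorem norm_cexp_sq (x : ℝ) (τ : ℂ) :
    ‖cexp (Real.pi * I * (x : ℂ) ^ 2 * τ)‖ = Real.exp (-Real.pi * x ^ 2 * τ.im) := by
  rw [Complex.norm_exp]
  congr 1
  have : (Real.pi * I * (x : ℂ) ^ 2 * τ) = ((Real.pi * x ^ 2 : ℝ) : ℂ) * (I * τ) := by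
    push_cast; ring
  rw [this, Complex.re_ofReal_mul]
  simp

theorem norm_cexp_int_sq (n : ℤ) (τ : ℂ) :
    ‖cexp (Real.pi * I * (n : ℂ) ^ 2 * τ)‖ = Real.exp (-Real.pi * (n : ℝ) ^ 2 * τ.im) := by
  simpa using norm_cexp_sq n τ

theorem norm_cexp_nat_sq (n : ℕ) (τ : ℂ) :
    ‖cexp (Real.pi * I * (n : ℂ) ^ 2 * τ)‖ = Real.exp (-Real.pi * (n : ℝ) ^ 2 * τ.im) := by
  simpa using norm_cexp_sq n τ

theorem summable_pow_mul_exp_int (k : ℕ) {y : ℝ} (hy : 0 < y) :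
    Summable fun n : ℤ => |(n : ℝ)| ^ k * Real.exp (-Real.pi * (n : ℝ) ^ 2 * y) := by
  have := summable_pow_mul_jacobiTheta₂_term_bound 0 hy k
  refine this.congr fun n => ?_
  simp only [mul_zero, zero_mul, sub_zero, Int.cast_abs]
  ring_nf

theorem summable_pow_mul_exp_nat (k : ℕ) {y : ℝ} (hy : 0 < y) :
    Summable fun n : ℕ => (n : ℝ) ^ k * Real.exp (-Real.pi * (n : ℝ) ^ 2 * y) := by
  have := (summable_pow_mul_exp_int k hy).comp_injective (Nat.cast_injective (R := ℤ))
  refine this.congr fun n => ?_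
  simp

section Summability

variable {c : ℤ → ℂ} {C : ℝ} {τ : ℂ}

theorem summable_pow_mul_theta_term_int (hc : ∀ n, ‖c n‖ ≤ C) (hτ : 0 < τ.im) (k : ℕ) :
    Summable fun n : ℤ => (n : ℂ) ^ k * (c n * cexp (Real.pi * I * n ^ 2 * τ)) := by
  refine Summable.of_norm_bounded ((summable_pow_mul_exp_int k hτ).mul_left C) fun n => ?_
  rw [norm_mul, norm_mul, norm_pow, norm_cexp_int_sq, Complex.norm_intCast]
  have := mul_le_mul_of_nonneg_right (hc n)
    (show 0 ≤ |(n : ℝ)| ^ k * Real.exp (-Real.pi * (n : ℝ) ^ 2 * τ.im) by positivity)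
  linarith

theorem summable_pow_mul_theta_term_nat (hc : ∀ n, ‖c n‖ ≤ C) (hτ : 0 < τ.im) (k : ℕ) :
    Summable fun n : ℕ => (n : ℂ) ^ k * (c n * cexp (Real.pi * I * n ^ 2 * τ)) := by
  have := (summable_pow_mul_theta_term_int hc hτ k).comp_injective (Nat.cast_injective (R := ℤ))
  refine this.congr fun n => ?_
  simp

theorem summable_fullTheta (hc : ∀ n, ‖c n‖ ≤ C) (hτ : 0 < τ.im) :
    Summable fun n : ℤ => c n * cexp (Real.pi * I * n ^ 2 * τ) := by
  simpa using summable_pow_mul_theta_term_int hc hτ 0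

theorem summable_halfTheta (hc : ∀ n, ‖c n‖ ≤ C) (hτ : 0 < τ.im) :
    Summable fun n : ℕ => c n * cexp (Real.pi * I * n ^ 2 * τ) := by
  simpa using summable_pow_mul_theta_term_nat hc hτ 0

theorem two_mul_tsum_nat_of_even {f : ℤ → ℂ} (hf : Summable f) (he : ∀ n, f (-n) = f n) :
    2 * ∑' n : ℕ, f n = ∑' n : ℤ, f n + f 0 := by
  have := hf.hasSum.nat_add_neg.tsum_eq
  rw [← this, ← tsum_mul_left]
  exact tsum_congr fun n => by rw [he]; ring

theorem two_mul_halfTheta (hc : ∀ n, ‖c n‖ ≤ C) (he : ∀ n, c (-n) = c n) (hτ : 0 < τ.im) :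
    2 * halfTheta c τ = fullTheta c τ + c 0 := by
  have := two_mul_tsum_nat_of_even (summable_fullTheta hc hτ) (fun n => by simp [he])
  simpa [halfTheta, fullTheta] using this

theorem two_mul_oddTheta (hc : ∀ n, ‖c n‖ ≤ C) (he : ∀ n, c (-n) = -c n) (hτ : 0 < τ.im) :
    2 * oddTheta c τ = ∑' n : ℤ, (n : ℂ) * (c n * cexp (Real.pi * I * n ^ 2 * τ)) := by
  have hs := summable_pow_mul_theta_term_int hc hτ 1
  simp only [pow_one] at hs
  have := two_mul_tsum_nat_of_even hs (fun n => by simp [he])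
  simpa [oddTheta] using this

end Summability

theorem tsum_int_residues (P : ℕ) [NeZero P] {f : ℤ → ℂ} (hf : Summable f) :
    ∑' n : ℤ, f n = ∑ j : Fin P, ∑' k : ℤ, f (k * P + (j : ℕ)) := by
  rw [← (Int.divModEquiv P).symm.tsum_eq f]
  have hs : Summable fun x : ℤ × Fin P => f ((Int.divModEquiv P).symm x) :=
    (Int.divModEquiv P).symm.summable_iff.mpr hf
  rw [← (Equiv.prodComm (Fin P) ℤ).tsum_eq]
  have hs' := (Equiv.prodComm (Fin P) ℤ).summable_iff.mpr hs
  refine (hs'.tsum_prod).trans ?_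
  rw [tsum_fintype]
  simp [Int.divModEquiv]

theorem dft_periodic (P : ℕ) [NeZero P] (c : ℤ → ℂ) : Function.Periodic (dft P c) (P : ℤ) := by
  intro n
  have hP : (P : ℂ) ≠ 0 := by exact_mod_cast NeZero.ne P
  refine Finset.sum_congr rfl fun j _ => ?_
  congr 1
  refine Complex.exp_eq_exp_iff_exists_int.mpr ⟨(j : ℕ), ?_⟩
  push_cast
  field_simp

theorem hasSum_dft_theta (P : ℕ) [NeZero P] (c : ℤ → ℂ) {v : ℂ} (hv : 0 < v.im) :
    fullTheta (dft P c) v = ∑ j : Fin P, c (j : ℕ) * jacobiTheta₂ (((j : ℕ) : ℂ) / P) v := by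
  have h : HasSum (fun n : ℤ => ∑ j : Fin P, c (j : ℕ) *
      jacobiTheta₂_term n (((j : ℕ) : ℂ) / P) v)
      (∑ j : Fin P, c (j : ℕ) * jacobiTheta₂ (((j : ℕ) : ℂ) / P) v) :=
    hasSum_sum fun j _ => (hasSum_jacobiTheta₂_term _ hv).mul_left _
  rw [← h.tsum_eq]
  refine tsum_congr fun n => ?_
  rw [dft, Finset.sum_mul]
  refine Finset.sum_congr rfl fun j _ => ?_
  rw [jacobiTheta₂_term, Complex.exp_add, mul_assoc]

theorem hasSum_dft_theta' (P : ℕ) [NeZero P] (c : ℤ → ℂ) {v : ℂ} (hv : 0 < v.im) :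
    2 * Real.pi * I * ∑' n : ℤ, (n : ℂ) * (dft P c n * cexp (Real.pi * I * n ^ 2 * v)) =
      ∑ j : Fin P, c (j : ℕ) * jacobiTheta₂' (((j : ℕ) : ℂ) / P) v := by
  have h : HasSum (fun n : ℤ => ∑ j : Fin P, c (j : ℕ) *
      jacobiTheta₂'_term n (((j : ℕ) : ℂ) / P) v)
      (∑ j : Fin P, c (j : ℕ) * jacobiTheta₂' (((j : ℕ) : ℂ) / P) v) :=
    hasSum_sum fun j _ => (hasSum_jacobiTheta₂'_term _ hv).mul_left _
  rw [← h.tsum_eq, ← tsum_mul_left]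
  refine tsum_congr fun n => ?_
  rw [dft, Finset.sum_mul, Finset.mul_sum, Finset.mul_sum]
  refine Finset.sum_congr rfl fun j _ => ?_
  rw [jacobiTheta₂'_term, jacobiTheta₂_term, Complex.exp_add]
  ring

theorem im_neg_inv_sq_mul {P : ℕ} (hP : 0 < P) {v : ℂ} (hv : 0 < v.im) :
    0 < (-1 / ((P : ℂ) ^ 2 * v)).im := by
  have h1 : (-1 / ((P : ℂ) ^ 2 * v)) = (((P : ℝ) ^ 2)⁻¹ : ℝ) * (-v⁻¹) := by
    push_cast; rw [neg_div, one_div, mul_inv]; ring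
  have hv0 : v ≠ 0 := fun h => by simp [h] at hv
  rw [h1, Complex.im_ofReal_mul, Complex.neg_im, Complex.inv_im]
  have := Complex.normSq_pos.mpr hv0
  have hP' : (0 : ℝ) < P := by exact_mod_cast hP
  have : 0 < v.im / Complex.normSq v := by positivity
  rw [neg_div, neg_neg]
  positivity

theorem im_neg_inv {v : ℂ} (hv : 0 < v.im) : 0 < (-1 / v).im := by
  simpa using im_neg_inv_sq_mul one_pos hv

/-- The Gaussian prefactor in Jacobi's functional equation at `z = j/P` completes the square, so
that the dual sum runs over the residue class of `j` modulo `P`. -/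
theorem jacobiTheta₂_residue (P : ℕ) [NeZero P] (j : ℕ) {v : ℂ} (hv : 0 < v.im) :
    jacobiTheta₂ ((j : ℂ) / P) v = 1 / (-I * v) ^ (1 / 2 : ℂ) *
      ∑' k : ℤ, cexp (Real.pi * I * ((k * P + j : ℤ) : ℂ) ^ 2 * (-1 / ((P : ℂ) ^ 2 * v))) := by
  have hv0 : v ≠ 0 := fun h => by simp [h] at hv
  have hP : (P : ℂ) ≠ 0 := by exact_mod_cast NeZero.ne P
  rw [jacobiTheta₂_functional_equation, mul_assoc]
  congr 1
  rw [jacobiTheta₂, ← tsum_mul_left, ← (Equiv.neg ℤ).tsum_eq]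
  refine tsum_congr fun k => ?_
  rw [jacobiTheta₂_term, ← Complex.exp_add]
  congr 1
  simp only [Equiv.neg_apply]
  push_cast
  field_simp
  ring

theorem jacobiTheta₂'_residue (P : ℕ) [NeZero P] (j : ℕ) {v : ℂ} (hv : 0 < v.im) :
    jacobiTheta₂' ((j : ℂ) / P) v = -(2 * Real.pi * I) / ((-I * v) ^ (1 / 2 : ℂ) * v * P) *
      ∑' k : ℤ, ((k * P + j : ℤ) : ℂ) *
        cexp (Real.pi * I * ((k * P + j : ℤ) : ℂ) ^ 2 * (-1 / ((P : ℂ) ^ 2 * v))) := by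
  have hv0 : v ≠ 0 := fun h => by simp [h] at hv
  have hP : (P : ℂ) ≠ 0 := by exact_mod_cast NeZero.ne P
  have him := im_neg_inv hv
  rw [jacobiTheta₂'_functional_equation]
  have h1 := ((hasSum_jacobiTheta₂'_term ((j : ℂ) / P / v) him).sub
    ((hasSum_jacobiTheta₂_term ((j : ℂ) / P / v) him).mul_left (2 * Real.pi * I * ((j : ℂ) / P))))
  rw [← h1.tsum_eq, ← tsum_mul_left, ← tsum_mul_left, ← (Equiv.neg ℤ).tsum_eq]
  refine tsum_congr fun k => ?_
  simp only [Equiv.neg_apply, jacobiTheta₂'_term, jacobiTheta₂_term]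
  have h2 : cexp (Real.pi * I * ((k * P + j : ℤ) : ℂ) ^ 2 * (-1 / ((P : ℂ) ^ 2 * v))) =
    cexp (-Real.pi * I * ((j : ℂ) / P) ^ 2 / v) *
      cexp (2 * Real.pi * I * ((-k : ℤ) : ℂ) * ((j : ℂ) / P / v)
        + Real.pi * I * ((-k : ℤ) : ℂ) ^ 2 * (-1 / v)) := by
    rw [← Complex.exp_add]
    congr 1
    push_cast
    field_simp
    ring
  rw [h2]
  have h3 : (-I * v) ^ (1 / 2 : ℂ) ≠ 0 := by
    rw [Ne, Complex.cpow_eq_zero_iff]; simp [hv0]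
  push_cast
  field_simp
  ring

/-- Poisson summation class by class: the term of `dft P c` with coefficient `c j` is a Jacobi theta
series at `z = j/P`, whose dual is the part of `fullTheta c` supported on the class of `j`. -/
theorem fullTheta_dft (P : ℕ) [NeZero P] {c : ℤ → ℂ} (hc : Function.Periodic c (P : ℤ)) {v : ℂ}
    (hv : 0 < v.im) :
    fullTheta (dft P c) v = 1 / (-I * v) ^ (1 / 2 : ℂ) * fullTheta c (-1 / ((P : ℂ) ^ 2 * v)) := by
  have hP : 0 < P := Nat.pos_of_ne_zero (NeZero.ne P)
  obtain ⟨C, -, hC⟩ := exists_bound_of_periodic hP hc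
  rw [hasSum_dft_theta P c hv, fullTheta,
    tsum_int_residues P (summable_fullTheta hC (im_neg_inv_sq_mul hP hv)), Finset.mul_sum]
  refine Finset.sum_congr rfl fun j _ => ?_
  rw [jacobiTheta₂_residue P j hv, mul_left_comm]
  congr 1
  rw [← tsum_mul_left]
  refine tsum_congr fun k => ?_
  have := hc.int_mul k (j : ℕ)
  rw [add_comm, Int.cast_id] at this
  rw [this]

/-- The same argument for the `z`-derivative of the Jacobi theta function; differentiation produces
the factor `n` and raises the weight to `3/2`. -/
theorem oddTheta_dft_two_sided (P : ℕ) [NeZero P] {c : ℤ → ℂ} (hc : Function.Periodic c (P : ℤ))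
    {v : ℂ} (hv : 0 < v.im) :
    ∑' n : ℤ, (n : ℂ) * (dft P c n * cexp (Real.pi * I * n ^ 2 * v)) =
      -1 / ((-I * v) ^ (1 / 2 : ℂ) * v * P) * ∑' n : ℤ, (n : ℂ) *
        (c n * cexp (Real.pi * I * n ^ 2 * (-1 / ((P : ℂ) ^ 2 * v)))) := by
  have hP : 0 < P := Nat.pos_of_ne_zero (NeZero.ne P)
  obtain ⟨C, -, hC⟩ := exists_bound_of_periodic hP hc
  have hpi : (2 * Real.pi * I : ℂ) ≠ 0 := Complex.two_pi_I_ne_zero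
  apply mul_left_cancel₀ hpi
  have hs := summable_pow_mul_theta_term_int hC (im_neg_inv_sq_mul hP hv) 1
  simp only [pow_one] at hs
  rw [hasSum_dft_theta' P c hv, tsum_int_residues P hs, Finset.mul_sum, Finset.mul_sum]
  refine Finset.sum_congr rfl fun j _ => ?_
  rw [jacobiTheta₂'_residue P j hv, ← tsum_mul_left, ← tsum_mul_left, ← tsum_mul_left,
    ← tsum_mul_left]
  refine tsum_congr fun k => ?_
  have := hc.int_mul k (j : ℕ)
  rw [add_comm, Int.cast_id] at this
  rw [this]
  ring

theorem dft_odd (P : ℕ) [NeZero P] {c : ℤ → ℂ} (hc : Function.Periodic c (P : ℤ))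
    (ho : ∀ n, c (-n) = -c n) (n : ℤ) : dft P c (-n) = -dft P c n := by
  have hP : (P : ℂ) ≠ 0 := by exact_mod_cast NeZero.ne P
  rw [dft, dft, ← Finset.sum_neg_distrib, ← Equiv.sum_comp (Equiv.neg (Fin P))]
  refine Finset.sum_congr rfl fun j _ => ?_
  simp only [Equiv.neg_apply]
  -- The representative of `-j` in `Fin P` is `P - j`, except that it is `0` for `j = 0`.
  obtain ⟨k, hk⟩ : ∃ k : ℤ, (((-j : Fin P) : ℕ) : ℤ) = -(j : ℕ) + k * P := by
    have hj := j.isLt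
    rw [Fin.val_neg']
    refine ⟨if (j : ℕ) = 0 then 0 else 1, ?_⟩
    split_ifs with h
    · simp [h]
    · rw [Nat.mod_eq_of_lt (by omega)]
      omega
  have h1 : c (((-j : Fin P) : ℕ) : ℤ) = -c (j : ℕ) := by
    rw [hk, ← ho]; exact hc.int_mul k _
  have h2 : (((-j : Fin P) : ℕ) : ℂ) = -(j : ℕ) + k * P := by exact_mod_cast hk
  rw [h1, neg_mul]
  congr 2
  rw [h2]
  refine Complex.exp_eq_exp_iff_exists_int.mpr ⟨-n * k, ?_⟩
  push_cast
  field_simp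
  ring

theorem oddTheta_dft (P : ℕ) [NeZero P] {c : ℤ → ℂ} (hc : Function.Periodic c (P : ℤ))
    (ho : ∀ n, c (-n) = -c n) {v : ℂ} (hv : 0 < v.im) :
    oddTheta (dft P c) v =
      -1 / ((-I * v) ^ (1 / 2 : ℂ) * v * P) * oddTheta c (-1 / ((P : ℂ) ^ 2 * v)) := by
  have hP : 0 < P := Nat.pos_of_ne_zero (NeZero.ne P)
  obtain ⟨C, -, hC⟩ := exists_bound_of_periodic hP hc
  obtain ⟨C', -, hC'⟩ := exists_bound_of_periodic hP (dft_periodic P c)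
  apply mul_left_cancel₀ (two_ne_zero (α := ℂ))
  rw [two_mul_oddTheta hC' (dft_odd P hc ho) hv, mul_left_comm,
    two_mul_oddTheta hC ho (im_neg_inv_sq_mul hP hv), oddTheta_dft_two_sided P hc hv]

end

/-! ### Inversion of theta series and their growth at the cusps -/

noncomputable section

open Complex

theorem neg_I_mul_ne_zero {w : ℂ} (hw : 0 < w.im) : -I * w ≠ 0 := by
  have : w ≠ 0 := fun h => by simp [h] at hw
  simp [this]

theorem re_neg_I_mul (w : ℂ) : (-I * w).re = w.im := by simp

theorem neg_I_mul_mem_slitPlane {w : ℂ} (hw : 0 < w.im) : -I * w ∈ slitPlane :=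
  Or.inl (by rw [re_neg_I_mul]; exact hw)

theorem sqrt_neg_I_mul_ne_zero {w : ℂ} (hw : 0 < w.im) : (-I * w) ^ (1 / 2 : ℂ) ≠ 0 := by
  rw [Ne, Complex.cpow_eq_zero_iff]; exact fun h => neg_I_mul_ne_zero hw h.1

theorem ofReal_cpow_half {x : ℝ} (hx : 0 ≤ x) : (x : ℂ) ^ (1 / 2 : ℂ) = (√x : ℝ) := by
  rw [Real.sqrt_eq_rpow, Complex.ofReal_cpow hx]; norm_num

theorem ofReal_mul_cpow_half {r : ℝ} (hr : 0 < r) (z : ℂ) :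
    ((r : ℂ) * z) ^ (1 / 2 : ℂ) = (√r : ℝ) * z ^ (1 / 2 : ℂ) := by
  rcases eq_or_ne z 0 with rfl | hz
  · simp
  have hr' : (r : ℂ) ≠ 0 := by exact_mod_cast hr.ne'
  rw [← ofReal_cpow_half hr.le, Complex.cpow_def_of_ne_zero (mul_ne_zero hr' hz),
    Complex.cpow_def_of_ne_zero hr', Complex.cpow_def_of_ne_zero hz, ← Complex.exp_add,
    Complex.log_ofReal_mul hr hz, Complex.ofReal_log hr.le, add_mul]

theorem cpow_half_inversion (P : ℕ) [NeZero P] {w : ℂ} (hw : 0 < w.im) :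
    (-I * (-1 / ((P : ℂ) ^ 2 * w))) ^ (1 / 2 : ℂ) = 1 / (P * (-I * w) ^ (1 / 2 : ℂ)) := by
  have hw0 : w ≠ 0 := fun h => by simp [h] at hw
  have hP0 : (0 : ℝ) < P := by exact_mod_cast Nat.pos_of_ne_zero (NeZero.ne P)
  have hP : (P : ℂ) ≠ 0 := by exact_mod_cast NeZero.ne P
  have h1 : (-I * (-1 / ((P : ℂ) ^ 2 * w))) = ((((P : ℝ) ^ 2)⁻¹ : ℝ) : ℂ) * (-I * w)⁻¹ := by
    push_cast
    field_simp
    simp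
  have harg : (-I * w).arg ≠ Real.pi := by
    intro h
    have := Complex.arg_eq_pi_iff.mp h
    rw [re_neg_I_mul] at this
    linarith [this.1]
  rw [h1, ofReal_mul_cpow_half (by positivity), Complex.inv_cpow _ _ harg, Real.sqrt_inv,
    Real.sqrt_sq hP0.le]
  push_cast
  rw [← mul_inv, inv_eq_one_div]

theorem inversion_inversion (P : ℕ) [NeZero P] {w : ℂ} (hw : 0 < w.im) :
    -1 / ((P : ℂ) ^ 2 * (-1 / ((P : ℂ) ^ 2 * w))) = w := by
  have hw0 : w ≠ 0 := fun h => by simp [h] at hw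
  have hP : (P : ℂ) ≠ 0 := by exact_mod_cast NeZero.ne P
  field_simp

/-- Since `w ↦ -1/(P²w)` is an involution, `fullTheta_dft` can be read backwards. In this form
behaviour near `0` is read off from behaviour near `i∞`. -/
theorem fullTheta_inversion (P : ℕ) [NeZero P] {c : ℤ → ℂ} (hc : Function.Periodic c (P : ℤ))
    {w : ℂ} (hw : 0 < w.im) :
    (-I * w) ^ (1 / 2 : ℂ) * fullTheta c w =
      1 / P * fullTheta (dft P c) (-1 / ((P : ℂ) ^ 2 * w)) := by
  have hP0 : 0 < P := Nat.pos_of_ne_zero (NeZero.ne P)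
  have hP : (P : ℂ) ≠ 0 := by exact_mod_cast NeZero.ne P
  have := sqrt_neg_I_mul_ne_zero hw
  rw [fullTheta_dft P hc (im_neg_inv_sq_mul hP0 hw), inversion_inversion P hw,
    cpow_half_inversion P hw]
  field_simp

theorem oddTheta_inversion (P : ℕ) [NeZero P] {c : ℤ → ℂ} (hc : Function.Periodic c (P : ℤ))
    (ho : ∀ n, c (-n) = -c n) {w : ℂ} (hw : 0 < w.im) :
    (P : ℂ) ^ 2 * w * (-I * w) ^ (1 / 2 : ℂ) * oddTheta c w =
      oddTheta (dft P c) (-1 / ((P : ℂ) ^ 2 * w)) := by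
  have hw0 : w ≠ 0 := fun h => by simp [h] at hw
  have hP0 : 0 < P := Nat.pos_of_ne_zero (NeZero.ne P)
  have hP : (P : ℂ) ≠ 0 := by exact_mod_cast NeZero.ne P
  have := sqrt_neg_I_mul_ne_zero hw
  rw [oddTheta_dft P hc ho (im_neg_inv_sq_mul hP0 hw), inversion_inversion P hw,
    cpow_half_inversion P hw]
  field_simp

/-- One factor `e^{-πy}` is split off uniformly in `n ≠ 0`; the rest is a convergent majorant at the
fixed height `δ`. -/
theorem exp_neg_sq_le {n : ℝ} (hn : 1 ≤ n ^ 2) {y δ : ℝ} (hy : δ ≤ y) :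
    Real.exp (-Real.pi * n ^ 2 * y) ≤
      Real.exp (-Real.pi * y) * (Real.exp (Real.pi * δ) * Real.exp (-Real.pi * n ^ 2 * δ)) := by
  rw [← Real.exp_add, ← Real.exp_add, Real.exp_le_exp]
  have h := mul_nonneg (mul_nonneg Real.pi_pos.le (sub_nonneg.mpr hn)) (sub_nonneg.mpr hy)
  nlinarith

theorem exists_fullTheta_sub_le {c : ℤ → ℂ} {C : ℝ} (hc : ∀ n, ‖c n‖ ≤ C) :
    ∃ K : ℝ, ∀ v : ℂ, 1 ≤ v.im → ‖fullTheta c v - c 0‖ ≤ K * Real.exp (-Real.pi * v.im) := by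
  have hs := summable_pow_mul_exp_int 0 one_pos
  refine ⟨∑' n : ℤ, C * (Real.exp (Real.pi * 1) *
    (|(n : ℝ)| ^ 0 * Real.exp (-Real.pi * (n : ℝ) ^ 2 * 1))), fun v hv => ?_⟩
  have hv0 : 0 < v.im := by linarith
  have h1 := (summable_fullTheta hc hv0).hasSum
  have h2 := hasSum_ite_sub_hasSum h1 0
  simp only [Int.cast_zero, ne_eq, OfNat.ofNat_ne_zero, not_false_eq_true, zero_pow, mul_zero,
    zero_mul, Complex.exp_zero, mul_one] at h2
  rw [fullTheta, ← h2.tsum_eq, ← tsum_mul_right]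
  have hs2 := ((hs.mul_left (Real.exp (Real.pi * 1))).mul_left C).mul_right
    (Real.exp (-Real.pi * v.im))
  refine tsum_of_norm_bounded hs2.hasSum fun n => ?_
  have hC : 0 ≤ C := (norm_nonneg _).trans (hc 0)
  split_ifs with h
  · rw [norm_zero]; positivity
  · rw [norm_mul, norm_cexp_int_sq]
    have hn : (1 : ℝ) ≤ (n : ℝ) ^ 2 := by
      have : 1 ≤ n ^ 2 := by have := Int.one_le_abs h; rw [← sq_abs]; nlinarith
      exact_mod_cast this
    refine (mul_le_mul (hc n) (exp_neg_sq_le hn hv) (Real.exp_pos _).le hC).trans (le_of_eq ?_)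
    simp only [pow_zero, one_mul]
    ring

theorem tendsto_fullTheta_of_im_atTop {c : ℤ → ℂ} {C : ℝ} (hc : ∀ n, ‖c n‖ ≤ C) {α : Type*}
    {l : Filter α} {v : α → ℂ} (hv : Tendsto (fun t => (v t).im) l atTop) :
    Tendsto (fun t => fullTheta c (v t)) l (𝓝 (c 0)) := by
  obtain ⟨K, hK⟩ := exists_fullTheta_sub_le hc
  rw [tendsto_iff_norm_sub_tendsto_zero]
  have h0 : Tendsto (fun t => K * Real.exp (-Real.pi * (v t).im)) l (𝓝 (K * 0)) := by
    refine Tendsto.const_mul K (Real.tendsto_exp_atBot.comp ?_)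
    simp only [neg_mul]
    exact tendsto_neg_atTop_atBot.comp (hv.const_mul_atTop Real.pi_pos)
  rw [mul_zero] at h0
  refine squeeze_zero' (Eventually.of_forall fun _ => norm_nonneg _) ?_ h0
  filter_upwards [hv.eventually_ge_atTop 1] with t ht using hK _ ht

theorem im_inversion (P : ℕ) (w : ℂ) :
    (-1 / ((P : ℂ) ^ 2 * w)).im = ((P : ℝ) ^ 2)⁻¹ * (w.im / Complex.normSq w) := by
  have h1 : (-1 / ((P : ℂ) ^ 2 * w)) = (((P : ℝ) ^ 2)⁻¹ : ℝ) * (-w⁻¹) := by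
    push_cast; rw [neg_div, one_div, mul_inv]; ring
  rw [h1, Complex.im_ofReal_mul, Complex.neg_im, Complex.inv_im, neg_div, neg_neg]

/-- The growth of a theta series at the cusp `0`. -/
theorem tendsto_sqrt_mul_fullTheta (P : ℕ) [NeZero P] {c : ℤ → ℂ}
    (hc : Function.Periodic c (P : ℤ)) {α : Type*} {l : Filter α} {w : α → ℂ}
    (hw : ∀ᶠ t in l, 0 < (w t).im)
    (hv : Tendsto (fun t => (w t).im / Complex.normSq (w t)) l atTop) :
    Tendsto (fun t => (-I * w t) ^ (1 / 2 : ℂ) * fullTheta c (w t)) l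
      (𝓝 (1 / P * dft P c 0)) := by
  have hP0 : 0 < P := Nat.pos_of_ne_zero (NeZero.ne P)
  have hP : (0 : ℝ) < P := by exact_mod_cast hP0
  obtain ⟨C, -, hC⟩ := exists_bound_of_periodic hP0 (dft_periodic P c)
  have h1 : Tendsto (fun t => (-1 / ((P : ℂ) ^ 2 * w t)).im) l atTop := by
    simp only [im_inversion]
    exact hv.const_mul_atTop (by positivity)
  refine ((tendsto_fullTheta_of_im_atTop hC h1).const_mul (1 / (P : ℂ))).congr' ?_
  filter_upwards [hw] with t ht using (fullTheta_inversion P hc ht).symm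

/-! ### Quadratic exponential sums and Landsberg–Schaar reciprocity -/

/-- The exponential sum `∑_{j mod b} e^{πi a j²/b}`. -/
def quadSum (a : ℤ) (b : ℕ) : ℂ := ∑ j : Fin b, cexp (Real.pi * I * ((j : ℕ) : ℂ) ^ 2 * (a / b))

theorem exp_pi_I_eq_of_sub_even {x y : ℂ} (k : ℤ) (h : x = y + 2 * k) :
    cexp (Real.pi * I * x) = cexp (Real.pi * I * y) :=
  Complex.exp_eq_exp_iff_exists_int.mpr ⟨k, by rw [h]; ring⟩

/-- Replacing `n` by `n + b` changes `n² a/b` by `2na + ab`, which is even exactly because `ab` is.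
-/
theorem periodic_quad {a : ℤ} {b : ℕ} (hb : 0 < b) (hab : Even (a * b)) :
    Function.Periodic (fun n : ℤ => cexp (Real.pi * I * (n : ℂ) ^ 2 * (a / b))) (b : ℤ) := by
  intro n
  obtain ⟨k, hk⟩ := hab
  have hb' : (b : ℂ) ≠ 0 := by exact_mod_cast hb.ne'
  have hk' : (a : ℂ) * b = k + k := by exact_mod_cast hk
  simp only [mul_assoc (Real.pi * I : ℂ)]
  apply exp_pi_I_eq_of_sub_even (n * a + k)
  push_cast
  field_simp
  linear_combination (b : ℂ) * hk'

theorem dft_quad_zero (a : ℤ) (b : ℕ) :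
    dft b (fun n : ℤ => cexp (Real.pi * I * (n : ℂ) ^ 2 * (a / b))) 0 = quadSum a b := by
  simp [dft, quadSum]

theorem fullTheta_add (c : ℤ → ℂ) (x w : ℂ) :
    fullTheta c (x + w) = fullTheta (fun n => c n * cexp (Real.pi * I * (n : ℂ) ^ 2 * x)) w := by
  refine tsum_congr fun n => ?_
  rw [mul_add, Complex.exp_add]
  ring

theorem dft_one_one : dft 1 (fun _ => (1 : ℂ)) = fun _ => 1 := by
  ext n; simp [dft]

theorem quadSum_neg (a : ℤ) (b : ℕ) : quadSum (-a) b = (starRingEnd ℂ) (quadSum a b) := by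
  rw [quadSum, quadSum, map_sum]
  refine Finset.sum_congr rfl fun j _ => ?_
  rw [← Complex.exp_conj]
  congr 1
  simp
  ring

theorem quadSum_add_mul (a k : ℤ) {b : ℕ} (hb : 0 < b) :
    quadSum (a + 2 * b * k) b = quadSum a b := by
  refine Finset.sum_congr rfl fun j _ => ?_
  have hb' : (b : ℂ) ≠ 0 := by exact_mod_cast hb.ne'
  simp only [mul_assoc (Real.pi * I : ℂ)]
  apply exp_pi_I_eq_of_sub_even (j ^ 2 * k)
  push_cast
  field_simp

/-- The reciprocity law of Landsberg and Schaar. -/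
theorem quadSum_reciprocity {a b : ℕ} (ha : 0 < a) (hb : 0 < b) (hab : Even (a * b)) :
    quadSum a b = cexp (Real.pi * I / 4) * (√(b / a : ℝ) : ℝ) * (starRingEnd ℂ) (quadSum b a) := by
  have : NeZero a := ⟨ha.ne'⟩
  have : NeZero b := ⟨hb.ne'⟩
  have ha' : (a : ℂ) ≠ 0 := by exact_mod_cast ha.ne'
  have hb' : (b : ℂ) ≠ 0 := by exact_mod_cast hb.ne'
  have haR : (0 : ℝ) < a := by exact_mod_cast ha
  have hbR : (0 : ℝ) < b := by exact_mod_cast hb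
  -- the two points of the upper half-plane
  set w : ℝ → ℂ := fun t => t * I with hw
  set τ : ℝ → ℂ := fun t => a / b + t * I with hτ
  -- Chosen so that `-1/τ t = -b/a + w t * z t`. As `z t → (b/a)²`, the image of the vertical line
  -- at `a/b` approaches `-b/a` with `Im/|·|²` of the displacement tending to infinity, which is all
  -- that the growth estimate needs.
  set z : ℝ → ℂ := fun t => (b : ℂ) ^ 2 / (a * (a + b * (t * I))) with hz
  set w' : ℝ → ℂ := fun t => w t * z t with hw'
  have hne : ∀ t : ℝ, (a : ℂ) + b * (t * I) ≠ 0 := fun t h => by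
    have := congrArg Complex.re h
    simp at this
    exact ha.ne' this
  have hτne : ∀ t : ℝ, τ t ≠ 0 := fun t h => by
    apply hne t
    have : (b : ℂ) * τ t = 0 := by rw [h, mul_zero]
    rw [← this, hτ]
    field_simp
  have hτ' : ∀ t, -1 / τ t = ((-b : ℤ) : ℂ) / a + w' t := fun t => by
    have h1 := hne t
    have h2 := hτne t
    have h3 : τ t = (a + b * (t * I)) / b := by rw [hτ]; field_simp
    rw [h3]
    simp only [hw', hw, hz]
    push_cast
    generalize hu : (a : ℂ) + b * (t * I) = u at h1 ⊢
    have hu' : (b : ℂ) * (t * I) = u - a := by rw [← hu]; ring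
    field_simp
    linear_combination -hu'
  have hτim : ∀ t : ℝ, (τ t).im = t := fun t => by
    have : τ t = ((a / b : ℝ) : ℂ) + t * I := by simp [hτ]
    rw [this]; simp
  have hIw : ∀ t, -I * w t = t := fun t => by
    simp only [hw]; linear_combination (-(t : ℂ)) * Complex.I_mul_I
  have hw'im : ∀ t : ℝ, (w' t).im = (-1 / τ t).im := fun t => by
    rw [hτ']
    have : (((-b : ℤ) : ℂ) / a) = ((-b / a : ℝ) : ℂ) := by push_cast; ring
    rw [this]; simp
  have hw'pos : ∀ t : ℝ, 0 < t → 0 < (w' t).im := fun t ht => by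
    rw [hw'im]; exact im_neg_inv (by rw [hτim]; exact ht)
  have hmem : ∀ᶠ t : ℝ in 𝓝[>] 0, 0 < t := self_mem_nhdsWithin
  -- continuity at `0`
  have hzlim : Tendsto z (𝓝[>] 0) (𝓝 ((b / a : ℂ) ^ 2)) := by
    have hc : ContinuousAt z 0 := by
      simp only [hz]
      refine ContinuousAt.div (by fun_prop) (by fun_prop) ?_
      exact mul_ne_zero ha' (hne 0)
    have h0 : z 0 = (b / a : ℂ) ^ 2 := by simp [hz]; field_simp
    rw [← h0]
    exact hc.tendsto.mono_left nhdsWithin_le_nhds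
  have hτlim : Tendsto τ (𝓝[>] 0) (𝓝 (a / b)) := by
    have hc : Continuous τ := by simp only [hτ]; fun_prop
    have h0 : τ 0 = a / b := by simp [hτ]
    rw [← h0]
    exact (hc.tendsto 0).mono_left nhdsWithin_le_nhds
  have hw0 : Tendsto w (𝓝[>] 0) (𝓝 0) := by
    have hc : Continuous w := by simp only [hw]; fun_prop
    have h0 : w 0 = 0 := by simp [hw]
    rw [← h0]
    exact (hc.tendsto 0).mono_left nhdsWithin_le_nhds
  -- asymptotics at the first point
  have A : Tendsto (fun t : ℝ => (√t : ℝ) * fullTheta (fun _ => 1) (τ t)) (𝓝[>] 0)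
      (𝓝 (1 / b * quadSum a b)) := by
    have hper := periodic_quad (a := (a : ℤ)) hb (by exact_mod_cast hab)
    have := tendsto_sqrt_mul_fullTheta b hper (l := 𝓝[>] (0 : ℝ)) (w := w)
      (by filter_upwards [hmem] with t ht; simpa [hw] using ht) (by
        refine tendsto_inv_nhdsGT_zero.congr' ?_
        filter_upwards [hmem] with t ht
        simp [hw, Complex.normSq_apply])
    rw [dft_quad_zero] at this
    refine this.congr' ?_
    filter_upwards [hmem] with t ht
    rw [hIw, ofReal_cpow_half ht.le]
    congr 1
    have : τ t = ((a : ℤ) : ℂ) / b + w t := by simp [hτ, hw]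
    rw [this, fullTheta_add]
    simp
  -- asymptotics at the second point
  have B : Tendsto (fun t : ℝ => (-I * w' t) ^ (1 / 2 : ℂ) * fullTheta (fun _ => 1) (-1 / τ t))
      (𝓝[>] 0) (𝓝 (1 / a * (starRingEnd ℂ) (quadSum b a))) := by
    have hper := periodic_quad (a := (-b : ℤ)) ha (by
      rw [neg_mul, even_neg]; exact_mod_cast (mul_comm a b ▸ hab))
    have := tendsto_sqrt_mul_fullTheta a hper (l := 𝓝[>] (0 : ℝ)) (w := w')
      (by filter_upwards [hmem] with t ht using hw'pos t ht) (by
        have h1 : Tendsto (fun t : ℝ => t⁻¹ * ((z t).re / Complex.normSq (z t))) (𝓝[>] 0)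
            atTop := by
          have hq : ((b / a : ℂ) ^ 2) = (((b / a : ℝ) ^ 2 : ℝ) : ℂ) := by push_cast; ring
          refine tendsto_inv_nhdsGT_zero.atTop_mul_pos
            (C := ((b / a : ℂ) ^ 2).re / Complex.normSq ((b / a : ℂ) ^ 2)) ?_ ?_
          · rw [hq, Complex.ofReal_re, Complex.normSq_ofReal]; positivity
          · refine Tendsto.div ((Complex.continuous_re.tendsto _).comp hzlim)
              ((Complex.continuous_normSq.tendsto _).comp hzlim) ?_
            rw [hq, Complex.normSq_ofReal]; positivity
        refine h1.congr' ?_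
        filter_upwards [hmem] with t ht
        have h2 : (w' t).im = t * (z t).re := by simp [hw', hw]
        have h3 : Complex.normSq (w' t) = t ^ 2 * Complex.normSq (z t) := by
          simp [hw', hw, sq]
        rw [h2, h3]
        field_simp)
    rw [dft_quad_zero, quadSum_neg] at this
    refine this.congr' ?_
    filter_upwards [hmem] with t ht
    rw [hτ', fullTheta_add]
    simp
  -- comparison
  have hsl : -I * ((a : ℂ) / b) ∈ slitPlane := Or.inr (by
    have : -I * ((a : ℂ) / b) = ((a / b : ℝ) : ℂ) * (-I) := by push_cast; ring
    rw [this, Complex.im_ofReal_mul]; simp; exact ⟨ha.ne', hb.ne'⟩)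
  have C : Tendsto (fun t : ℝ => (√t : ℝ) * fullTheta (fun _ => 1) (τ t)) (𝓝[>] 0)
      (𝓝 (((-I * ((a : ℂ) / b)) ^ (1 / 2 : ℂ))⁻¹ *
        ((((b / a : ℂ) ^ 2) ^ (1 / 2 : ℂ))⁻¹ * (1 / a * (starRingEnd ℂ) (quadSum b a))))) := by
    have h1 : Tendsto (fun t => ((-I * τ t) ^ (1 / 2 : ℂ))⁻¹) (𝓝[>] 0)
        (𝓝 ((-I * ((a : ℂ) / b)) ^ (1 / 2 : ℂ))⁻¹) := by
      refine Tendsto.inv₀ ?_ ?_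
      · exact (continuousAt_cpow_const hsl).tendsto.comp (hτlim.const_mul _)
      · rw [Ne, Complex.cpow_eq_zero_iff]; exact fun h => slitPlane_ne_zero hsl h.1
    have hq : ((b / a : ℂ) ^ 2) = (((b / a : ℝ) ^ 2 : ℝ) : ℂ) := by push_cast; ring
    have hsl2 : ((b / a : ℂ) ^ 2) ∈ slitPlane := by
      rw [hq]; exact Complex.ofReal_mem_slitPlane.mpr (by positivity)
    have h2 : Tendsto (fun t => ((z t) ^ (1 / 2 : ℂ))⁻¹) (𝓝[>] 0)
        (𝓝 (((b / a : ℂ) ^ 2) ^ (1 / 2 : ℂ))⁻¹) := by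
      refine Tendsto.inv₀ ?_ ?_
      · exact (continuousAt_cpow_const hsl2).tendsto.comp hzlim
      · rw [Ne, Complex.cpow_eq_zero_iff]; exact fun h => slitPlane_ne_zero hsl2 h.1
    refine (h1.mul (h2.mul B)).congr' ?_
    filter_upwards [hmem] with t ht
    have hτpos : 0 < (τ t).im := by rw [hτim]; exact ht
    -- The classical law `θ(-1/τ) = (-iτ)^{1/2} θ(τ)`, where the coefficients are their own
    -- transform.
    have h3 := fullTheta_inversion 1 (c := fun _ => 1) (fun _ => rfl) hτpos
    rw [dft_one_one] at h3
    simp only [Nat.cast_one, one_pow, one_mul, div_one] at h3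
    rw [← h3]
    have h4 : -I * w' t = (t : ℂ) * z t := by rw [← hIw t, hw']; ring
    rw [h4, ofReal_mul_cpow_half ht]
    have h5 := sqrt_neg_I_mul_ne_zero hτpos
    have h6 : (z t) ^ (1 / 2 : ℂ) ≠ 0 := by
      rw [Ne, Complex.cpow_eq_zero_iff]
      exact fun h => (div_ne_zero (pow_ne_zero 2 hb') (mul_ne_zero ha' (hne t))) h.1
    have h7 : ((√t : ℝ) : ℂ) ≠ 0 := by exact_mod_cast (Real.sqrt_pos.mpr ht).ne'
    generalize (-I * τ t) ^ (1 / 2 : ℂ) = s at h5 ⊢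
    field_simp
  -- Two evaluations of the leading coefficient of `θ` at `a/b`: directly, and through the cusp
  -- `-b/a`. What remains is to simplify the square roots.
  have D := tendsto_nhds_unique A C
  have hq : ((b / a : ℂ) ^ 2) = (((b / a : ℝ) ^ 2 : ℝ) : ℂ) := by push_cast; ring
  rw [hq, ofReal_cpow_half (by positivity), Real.sqrt_sq (by positivity)] at D
  have hI : -I * ((a : ℂ) / b) = ((a / b : ℝ) : ℂ) * (-I) := by push_cast; ring
  have hI2 : (-I) ^ (1 / 2 : ℂ) = cexp (-(Real.pi * I / 4)) := by
    rw [Complex.cpow_def_of_ne_zero (by simp), Complex.log_neg_I]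
    congr 1; ring
  rw [hI, ofReal_mul_cpow_half (by positivity), hI2, mul_inv, ← Complex.exp_neg, neg_neg,
    ← Complex.ofReal_inv, ← Real.sqrt_inv, inv_div] at D
  push_cast at D
  field_simp at D
  rw [D]
  ring

end

/-! ### Evaluation of quadratic Gauss sums by Jacobi symbols -/

noncomputable section

open Complex
open scoped NumberTheorySymbols

/-- `4a ≡ 1` modulo `4a - 1`, and `4` is a square. As `4a - 1 ≡ -1` modulo `4a`, multiplying a
denominator by it changes the sign of its residue without changing the symbol. -/
theorem jacobiSym_four_mul_sub_one {a : ℕ} (ha : 0 < a) : J(a | 4 * a - 1) = 1 := by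
  have hodd : Odd (4 * a - 1) := ⟨2 * a - 1, by omega⟩
  have h1 : J(4 * a | 4 * a - 1) = J(1 | 4 * a - 1) := by
    apply jacobiSym.mod_left'
    have : (4 * (a : ℤ)) = 1 + ((4 * a - 1 : ℕ) : ℤ) := by
      push_cast [show 1 ≤ 4 * a by omega]; ring
    rw [this, Int.add_emod_right]
  rw [jacobiSym.mul_left, jacobiSym.at_four hodd, one_mul, jacobiSym.one_left] at h1
  exact h1

theorem jacobiSym_congr_right {a b b' : ℕ} (hb : Odd b) (h : b ≡ b' [MOD 4 * a]) :
    J(a | b) = J(a | b') := by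
  have hb' : Odd b' := by
    have h2 : b % 2 = b' % 2 := Nat.ModEq.of_dvd (⟨2 * a, by ring⟩) h
    rw [Nat.odd_iff] at hb ⊢
    omega
  rw [jacobiSym.mod_right' a hb, jacobiSym.mod_right' a hb', h]

/-- For positive `a` the symbol depends on the denominator modulo `4a` only up to sign: when the
signs of `d` and `d'` differ, one absolute value is multiplied by `4a - 1`. -/
theorem jacobiSym_natAbs_congr {a : ℕ} (ha : 0 < a) {d d' : ℤ} (hd : Odd d)
    (h : d ≡ d' [ZMOD 4 * a]) : J(a | d.natAbs) = J(a | d'.natAbs) := by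
  have key : ∀ b b' : ℕ, Odd b → (4 * a : ℤ) ∣ b + b' → J(a | b) = J(a | b') := by
    intro b b' hb hbb
    have hodd : Odd (4 * a - 1) := ⟨2 * a - 1, by omega⟩
    have : NeZero b := ⟨by rintro rfl; simp at hb⟩
    have : NeZero (4 * a - 1) := ⟨by omega⟩
    have h1 : J(a | b * (4 * a - 1)) = J(a | b) := by
      rw [jacobiSym.mul_right, jacobiSym_four_mul_sub_one ha, mul_one]
    rw [← h1]
    apply jacobiSym_congr_right (hb.mul hodd)
    rw [← Int.natCast_modEq_iff]
    push_cast [show 1 ≤ 4 * a by omega]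
    rw [Int.modEq_iff_dvd]
    obtain ⟨k, hk⟩ := hbb
    exact ⟨k - b, by linear_combination hk⟩
  rw [Int.modEq_iff_dvd] at h
  have hodd : Odd d.natAbs := Int.natAbs_odd.mpr hd
  rcases Int.natAbs_eq d with h1 | h1 <;> rcases Int.natAbs_eq d' with h2 | h2
  · apply jacobiSym_congr_right hodd
    rw [← Int.natCast_modEq_iff, Int.modEq_iff_dvd, ← h1, ← h2]
    exact_mod_cast h
  · apply key _ _ hodd
    rw [← dvd_neg]
    have e : -((d.natAbs : ℤ) + d'.natAbs) = d' - d := by omega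
    rwa [e]
  · apply key _ _ hodd
    have e : (d.natAbs : ℤ) + d'.natAbs = d' - d := by omega
    rwa [e]
  · apply jacobiSym_congr_right hodd
    rw [← Int.natCast_modEq_iff, Int.modEq_iff_dvd]
    rw [← dvd_neg]
    have e : -((d'.natAbs : ℤ) - d.natAbs) = d' - d := by omega
    rw [e]
    exact_mod_cast h

theorem jacobiSym_two_mul_even {a b : ℕ} (hb : Odd b) :
    J(2 * (2 * a : ℕ) | b) = J(a | b) := by
  have : (2 * ((2 * a : ℕ) : ℤ)) = 4 * a := by push_cast; ring
  rw [this, jacobiSym.mul_left, jacobiSym.at_four hb, one_mul]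

/-- The sign of the Gauss sum modulo an odd number. -/
def gaussSign (b : ℕ) : ℂ := if b % 4 = 1 then 1 else I

/-- The sign of the Gauss sum modulo an even number. -/
def gaussPhase (d : ℤ) : ℂ :=
  if d % 4 = 1 then cexp (Real.pi * I / 4) else cexp (-(Real.pi * I / 4))

theorem exp_quarter_mul_self : cexp (Real.pi * I / 4) * cexp (Real.pi * I / 4) = I := by
  rw [← Complex.exp_add]
  conv_rhs => rw [← Complex.exp_pi_div_two_mul_I]
  congr 1; ring

theorem conj_exp_quarter :
    (starRingEnd ℂ) (cexp (Real.pi * I / 4)) = cexp (-(Real.pi * I / 4)) := by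
  rw [← Complex.exp_conj]
  congr 1
  simp only [map_div₀, map_mul, Complex.conj_ofReal, Complex.conj_I, map_ofNat]
  ring

theorem conj_exp_neg_quarter :
    (starRingEnd ℂ) (cexp (-(Real.pi * I / 4))) = cexp (Real.pi * I / 4) := by
  rw [← conj_exp_quarter, Complex.conj_conj]

theorem conj_gaussPhase (d : ℤ) (hd : Odd d) :
    (starRingEnd ℂ) (gaussPhase d) = gaussPhase (-d) := by
  rw [Int.odd_iff] at hd
  unfold gaussPhase
  by_cases h : d % 4 = 1
  · rw [if_pos h, if_neg (by omega), conj_exp_quarter]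
  · rw [if_neg h, if_pos (by omega), conj_exp_neg_quarter]

/-- Reciprocity conjugates a Gauss sum and multiplies it by `e^{πi/4}`; this and the next identity
convert the phase for an odd modulus into the phase for an even modulus and back. -/
theorem exp_quarter_mul_conj_gaussSign (b : ℕ) :
    cexp (Real.pi * I / 4) * (starRingEnd ℂ) (gaussSign b) = gaussPhase b := by
  unfold gaussSign gaussPhase
  by_cases h : b % 4 = 1
  · rw [if_pos h, if_pos (by omega)]; simp
  · rw [if_neg h, if_neg (by omega), Complex.conj_I]
    have h1 : cexp (Real.pi * I / 4) * cexp (-(Real.pi * I / 4)) = 1 := by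
      rw [← Complex.exp_add]; simp
    have h2 := exp_quarter_mul_self
    have hne := Complex.exp_ne_zero (Real.pi * I / 4)
    apply mul_left_cancel₀ hne
    rw [h1]
    linear_combination (-I) * h2 - Complex.I_mul_I

theorem exp_quarter_mul_conj_gaussPhase (b : ℕ) :
    cexp (Real.pi * I / 4) * (starRingEnd ℂ) (gaussPhase b) = gaussSign b := by
  have h1 : cexp (Real.pi * I / 4) * cexp (-(Real.pi * I / 4)) = 1 := by
    rw [← Complex.exp_add]; simp
  unfold gaussSign gaussPhase
  by_cases h : b % 4 = 1
  · rw [if_pos h, if_pos (by omega), conj_exp_quarter, h1]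
  · rw [if_neg h, if_neg (by omega), conj_exp_neg_quarter, exp_quarter_mul_self]

theorem conj_gaussSign {b : ℕ} (hb : Odd b) :
    (starRingEnd ℂ) (gaussSign b) = (J(-1 | b) : ℂ) * gaussSign b := by
  rw [jacobiSym.at_neg_one hb]
  rw [Nat.odd_iff] at hb
  unfold gaussSign
  by_cases h : b % 4 = 1
  · rw [if_pos h, ZMod.χ₄_nat_one_mod_four h]; simp
  · rw [if_neg h, ZMod.χ₄_nat_three_mod_four (by omega)]; simp

/-- The statement of the evaluation of `quadSum` modulo the odd number `b`. -/
theorem quadSum_even_of_odd {d : ℤ} {c : ℕ} (hc : 0 < c) (hce : Even c) (hd : Odd d)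
    (h : quadSum c d.natAbs = (J(2 * c | d.natAbs) : ℂ) * gaussSign d.natAbs *
      (√(d.natAbs : ℝ) : ℝ)) :
    quadSum d c = (J(2 * c | d.natAbs) : ℂ) * (√(c : ℝ) : ℝ) * gaussPhase d := by
  have key : quadSum (d.natAbs : ℕ) c =
      (J(2 * c | d.natAbs) : ℂ) * (√(c : ℝ) : ℝ) * gaussPhase (d.natAbs : ℕ) := by
    have hpos : 0 < d.natAbs := Int.natAbs_pos.mpr (by rintro rfl; simp at hd)
    have hposR : (0 : ℝ) < d.natAbs := by exact_mod_cast hpos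
    rw [quadSum_reciprocity hpos hc (hce.mul_left _), h, map_mul, map_mul, Complex.conj_ofReal,
      map_intCast, ← exp_quarter_mul_conj_gaussSign, Real.sqrt_div (by positivity)]
    have : ((√(d.natAbs : ℝ) : ℝ) : ℂ) ≠ 0 := by exact_mod_cast (Real.sqrt_pos.mpr hposR).ne'
    push_cast
    field_simp
  rcases Int.natAbs_eq d with h1 | h1
  · rw [← h1] at key; exact key
  · rw [h1, quadSum_neg, Int.natAbs_neg, Int.natAbs_natCast, key, map_mul, map_mul,
      Complex.conj_ofReal, map_intCast,
      conj_gaussPhase _ (by exact_mod_cast Int.natAbs_odd.mpr hd)]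

/-- A Euclidean descent. The numerator is reduced modulo `2b` to absolute value below `b`;
reciprocity exchanges it with `b`; then `b` is reduced modulo twice the new modulus to some `d` with
`|d| < b`, and the induction hypothesis at `|d|` enters through `quadSum_even_of_odd`. Negative
numerators are handled by complex conjugation. -/
theorem quadSum_odd (b : ℕ) (hb : Odd b) (a : ℤ) (ha : Even a) (hab : a.gcd b = 1) :
    quadSum a b = (J(2 * a | b) : ℂ) * gaussSign b * (√(b : ℝ) : ℝ) := by
  induction b using Nat.strong_induction_on generalizing a with
  | _ b ih =>
  have hb0 : 0 < b := hb.pos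
  rcases Nat.lt_or_ge 1 b with hb1 | hb1
  swap
  · obtain rfl : b = 1 := by omega
    simp [quadSum, gaussSign]
  -- the case of a small positive numerator
  have small : ∀ a : ℕ, 0 < a → a < b → Even a → Nat.gcd a b = 1 →
      quadSum a b = (J(2 * a | b) : ℂ) * gaussSign b * (√(b : ℝ) : ℝ) := by
    intro a ha0 hab' hae hg
    obtain ⟨a₀, rfl⟩ := hae
    rw [← two_mul] at *
    have ha₀ : 0 < a₀ := by omega
    -- The modulus `4a₀` serves twice: it is the period of `quadSum · (2 * a₀)`, and the symbol of
    -- `a₀` depends on the denominator only modulo `4a₀` (up to sign).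
    set d : ℤ := Int.bmod b (2 * (2 * a₀)) with hd
    have hdvd : ((2 * (2 * a₀) : ℕ) : ℤ) ∣ b - d := by
      rw [hd]; exact Int.dvd_self_sub_bmod
    obtain ⟨k, hk⟩ := hdvd
    have hlt : d < (2 * (2 * a₀) : ℕ) / 2 := by
      have := Int.bmod_lt (x := b) (m := 2 * (2 * a₀)) (by omega)
      omega
    have hge : -((2 * (2 * a₀) : ℕ) / 2 : ℤ) ≤ d := by
      have := Int.le_bmod (x := b) (m := 2 * (2 * a₀)) (by omega)
      omega
    have hbd : (b : ℤ) = d + 2 * (2 * a₀ : ℕ) * k := by push_cast at hk ⊢; linarith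
    have hdodd : Odd d := by
      have hb' : Odd (b : ℤ) := by exact_mod_cast hb
      rw [Int.odd_iff] at hb' ⊢
      have : (2 * (2 * a₀ : ℕ) * k : ℤ) = 2 * (2 * a₀ * k) := by push_cast; ring
      omega
    have hdne : d.natAbs < b := by
      push_cast at hlt hge
      omega
    have hmod : (b : ℤ) ≡ d [ZMOD 4 * a₀] := by
      rw [Int.modEq_iff_dvd]
      exact ⟨-k, by push_cast at hk; linear_combination -hk⟩
    have hJ : J(a₀ | b) = J(a₀ | d.natAbs) := by
      have := jacobiSym_natAbs_congr ha₀ (by exact_mod_cast hb : Odd (b : ℤ)) hmod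
      simpa using this
    have hgd : Int.gcd ((2 * a₀ : ℕ) : ℤ) d.natAbs = 1 := by
      have h1 : Int.gcd ((2 * a₀ : ℕ) : ℤ) (b : ℤ) = 1 := by exact_mod_cast hg
      rw [← Int.isCoprime_iff_gcd_eq_one] at h1 ⊢
      rw [Int.natCast_natAbs]
      have h2 : IsCoprime ((2 * a₀ : ℕ) : ℤ) d := by
        have h3 : d = b + ((2 * a₀ : ℕ) : ℤ) * (-(2 * k)) := by rw [hbd]; ring
        rw [h3]
        exact IsCoprime.add_mul_left_right h1 _
      exact (IsCoprime.abs_right_iff _ _).mpr h2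
    have hI := ih d.natAbs hdne (Int.natAbs_odd.mpr hdodd) ((2 * a₀ : ℕ) : ℤ)
      (by push_cast; exact even_two_mul _) hgd
    have hQ := quadSum_even_of_odd (c := 2 * a₀) (by omega) (even_two_mul _) hdodd hI
    have hphase : gaussPhase d = gaussPhase b := by
      have : d % 4 = (b : ℤ) % 4 := (hmod.of_mul_right a₀).symm
      unfold gaussPhase; rw [this]
    have hbR : (0 : ℝ) < b := by exact_mod_cast hb0
    have haR : (0 : ℝ) < (2 * a₀ : ℕ) := by exact_mod_cast (by omega : 0 < 2 * a₀)
    have hs : quadSum (b : ℤ) (2 * a₀) = quadSum d (2 * a₀) := by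
      rw [hbd]; exact quadSum_add_mul d k (by omega)
    rw [quadSum_reciprocity (by omega) hb0 ((even_two_mul a₀).mul_right b), hs, hQ, hphase,
      jacobiSym_two_mul_even hb, hJ, jacobiSym_two_mul_even (Int.natAbs_odd.mpr hdodd), map_mul,
      map_mul, Complex.conj_ofReal, map_intCast, ← exp_quarter_mul_conj_gaussPhase,
      Real.sqrt_div hbR.le]
    have : ((√((2 * a₀ : ℕ) : ℝ) : ℝ) : ℂ) ≠ 0 := by exact_mod_cast (Real.sqrt_pos.mpr haR).ne'
    rw [Complex.ofReal_div]
    field_simp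
  -- reduction of the numerator
  set a' : ℤ := Int.bmod a (2 * b) with ha'
  have hdvd : ((2 * b : ℕ) : ℤ) ∣ a - a' := by rw [ha']; exact Int.dvd_self_sub_bmod
  obtain ⟨k, hk⟩ := hdvd
  have haa : a = a' + 2 * b * k := by push_cast at hk; linarith
  have hlt : a' < (2 * b : ℕ) / 2 := by
    have := Int.bmod_lt (x := a) (m := 2 * b) (by omega)
    omega
  have hge : -((2 * b : ℕ) / 2 : ℤ) ≤ a' := by
    have := Int.le_bmod (x := a) (m := 2 * b) (by omega)
    omega
  have hae : Even a' := by
    have : a' = a - 2 * (b * k) := by rw [haa]; ring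
    rw [this]; exact ha.sub (even_two_mul _)
  have hbodd : (b : ℤ) % 2 = 1 := by exact_mod_cast Nat.odd_iff.mp hb
  have hg : IsCoprime a' b := by
    rw [← Int.isCoprime_iff_gcd_eq_one] at hab
    have h3 : a' = a + (b : ℤ) * (-(2 * k)) := by rw [haa]; ring
    rw [h3]
    exact IsCoprime.add_mul_left_left hab _
  have hJ : J(2 * a | b) = J(2 * a' | b) := by
    apply jacobiSym.mod_left'
    rw [haa]
    have : 2 * (a' + 2 * b * k) = 2 * a' + b * (4 * k) := by ring
    rw [this, Int.add_mul_emod_self_left]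
  rw [hJ, haa, quadSum_add_mul a' k hb0]
  -- The symmetric residue allows `a' = -b`, which parity excludes.
  have habs : a'.natAbs < b := by
    rw [Int.even_iff] at hae
    push_cast at hlt hge
    omega
  have hne : a' ≠ 0 := by
    rintro h
    rw [h, isCoprime_zero_left, Int.isUnit_iff] at hg
    omega
  have hs := small a'.natAbs (by omega) habs (Int.natAbs_even.mpr hae) (by
    rw [Int.isCoprime_iff_gcd_eq_one] at hg
    simpa [Int.gcd] using hg)
  rcases Int.natAbs_eq a' with h1 | h1
  · rw [← h1] at hs; exact hs
  · have hJneg : J(2 * -(a'.natAbs : ℤ) | b) = J(-1 | b) * J(2 * (a'.natAbs : ℤ) | b) := by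
      rw [← jacobiSym.mul_left]; congr 1; ring
    rw [h1, quadSum_neg, hs, map_mul, map_mul, Complex.conj_ofReal, map_intCast,
      conj_gaussSign hb, hJneg]
    push_cast
    ring

/-- The evaluation of quadratic Gauss sums to an even modulus. -/
theorem quadSum_even {d : ℤ} {c : ℕ} (hc : 0 < c) (hce : Even c) (hd : Odd d)
    (hdc : IsCoprime d c) :
    quadSum d c = (J(2 * c | d.natAbs) : ℂ) * (√(c : ℝ) : ℝ) * gaussPhase d := by
  refine quadSum_even_of_odd hc hce hd ?_
  refine quadSum_odd _ (Int.natAbs_odd.mpr hd) c (by exact_mod_cast hce) ?_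
  rw [← Int.isCoprime_iff_gcd_eq_one, Int.natCast_natAbs]
  exact (IsCoprime.abs_right_iff _ _).mpr hdc.symm

end

/-! ### Weight `3/2` theta series: decay at cusps and the Eichler integral -/

noncomputable section

open Complex MeasureTheory Set

/-- The factor `n` removes the constant term, so every remaining term has a factor `e^{-πy}`. -/
theorem exists_oddTheta_le {c : ℤ → ℂ} {C : ℝ} (hc : ∀ n, ‖c n‖ ≤ C) {δ : ℝ} (hδ : 0 < δ) :
    ∃ K : ℝ, 0 ≤ K ∧ ∀ v : ℂ, δ ≤ v.im → ‖oddTheta c v‖ ≤ K * Real.exp (-Real.pi * v.im) := by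
  have hC : 0 ≤ C := (norm_nonneg _).trans (hc 0)
  have hs := ((summable_pow_mul_exp_nat 1 hδ).mul_left (Real.exp (Real.pi * δ))).mul_left C
  refine ⟨∑' n : ℕ, C * (Real.exp (Real.pi * δ) *
    ((n : ℝ) ^ 1 * Real.exp (-Real.pi * (n : ℝ) ^ 2 * δ))),
    tsum_nonneg fun n => by positivity, fun v hv => ?_⟩
  rw [← tsum_mul_right]
  refine tsum_of_norm_bounded (hs.mul_right _).hasSum fun n => ?_
  rw [norm_mul, norm_mul, norm_cexp_nat_sq, Complex.norm_natCast]
  rcases Nat.eq_zero_or_pos n with rfl | hn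
  · simp
  have hn' : (1 : ℝ) ≤ n ^ 2 := by exact_mod_cast Nat.one_le_pow _ _ hn
  have h1 := mul_le_mul (hc n) (exp_neg_sq_le hn' hv) (Real.exp_pos _).le hC
  refine (mul_le_mul_of_nonneg_left h1 (Nat.cast_nonneg n)).trans (le_of_eq ?_)
  rw [pow_one]
  ring

theorem differentiableAt_oddTheta {c : ℤ → ℂ} {C : ℝ} (hc : ∀ n, ‖c n‖ ≤ C) {w : ℂ}
    (hw : 0 < w.im) : DifferentiableAt ℂ (oddTheta c) w := by
  have hC : 0 ≤ C := (norm_nonneg _).trans (hc 0)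
  have hδ : 0 < w.im / 2 := by linarith
  have ho : IsOpen {v : ℂ | w.im / 2 < v.im} := isOpen_lt continuous_const Complex.continuous_im
  have h := differentiableOn_tsum_of_summable_norm (U := {v : ℂ | w.im / 2 < v.im})
    (F := fun (n : ℕ) (v : ℂ) => (n : ℂ) * (c n * cexp (Real.pi * I * n ^ 2 * v)))
    ((summable_pow_mul_exp_nat 1 hδ).mul_left C) (fun n => by fun_prop) ho (fun n v hv => by
      rw [norm_mul, norm_mul, norm_cexp_nat_sq, Complex.norm_natCast]
      have h1 : Real.exp (-Real.pi * (n : ℝ) ^ 2 * v.im) ≤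
          Real.exp (-Real.pi * (n : ℝ) ^ 2 * (w.im / 2)) := by
        rw [Real.exp_le_exp]
        have h2 := mul_nonneg (mul_nonneg Real.pi_pos.le (sq_nonneg (n : ℝ)))
          (sub_nonneg.mpr (le_of_lt hv))
        nlinarith
      refine (mul_le_mul_of_nonneg_left (mul_le_mul (hc n) h1 (Real.exp_pos _).le hC)
        (Nat.cast_nonneg n)).trans (le_of_eq (by ring)))
  exact h.differentiableAt (ho.mem_nhds (by simp only [mem_ofPred_eq]; linarith))

theorem norm_cpow_half (z : ℂ) : ‖z ^ (1 / 2 : ℂ)‖ = √‖z‖ := by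
  have := Complex.norm_cpow_real z (1 / 2)
  rw [Real.sqrt_eq_rpow, ← this]
  norm_num

theorem norm_cpow_neg_half (z : ℂ) : ‖z ^ (-(1 / 2) : ℂ)‖ = ‖z‖ ^ (-(1 / 2) : ℝ) := by
  have := Complex.norm_cpow_real z (-(1 / 2))
  rw [← this]
  norm_num

/-- A periodic odd weight `3/2` theta series decays at the cusp `0`, within a cone. -/
theorem exists_oddTheta_cone_le (P : ℕ) [NeZero P] {c : ℤ → ℂ}
    (hc : Function.Periodic c (P : ℤ)) (ho : ∀ n, c (-n) = -c n) :
    ∃ K : ℝ, 0 ≤ K ∧ ∀ s : ℂ, 0 < s.im → |s.re| ≤ s.im →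
      ‖oddTheta c s‖ ≤ K * Real.exp (-Real.pi * s.im) := by
  have hP0 : 0 < P := Nat.pos_of_ne_zero (NeZero.ne P)
  have hP1 : (1 : ℝ) ≤ P := by exact_mod_cast hP0
  obtain ⟨C, -, hC⟩ := exists_bound_of_periodic hP0 hc
  obtain ⟨C', -, hC'⟩ := exists_bound_of_periodic hP0 (dft_periodic P c)
  -- In the cone `|s|² ≤ 2 (Im s)²`, hence `Im(-1/(P²s)) ≥ k / Im s`.
  set k : ℝ := 1 / (2 * (P : ℝ) ^ 2) with hk
  have hk0 : 0 < k := by positivity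
  obtain ⟨K₁, hK₁0, hK₁⟩ := exists_oddTheta_le hC one_pos
  obtain ⟨K₂, hK₂0, hK₂⟩ := exists_oddTheta_le hC' hk0
  set K₃ : ℝ := K₂ * (2 / (Real.pi * k) ^ 2) * Real.exp Real.pi with hK₃
  have hK₃0 : 0 ≤ K₃ := by positivity
  refine ⟨K₁ + K₃, by positivity, fun s hs hcone => ?_⟩
  rcases le_or_gt 1 s.im with h1 | h1
  · refine (hK₁ s h1).trans ?_
    gcongr
    linarith
  have hy := hs
  set y := s.im with hydef
  set v := -1 / ((P : ℂ) ^ 2 * s) with hv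
  have hnsq : Complex.normSq s ≤ 2 * y ^ 2 := by
    rw [Complex.normSq_apply]
    have : s.re * s.re ≤ y ^ 2 := by nlinarith [abs_le.mp hcone, sq_abs s.re, abs_nonneg s.re]
    nlinarith
  have hs0 : s ≠ 0 := fun h => by simp [h] at hydef; linarith
  have hnpos := Complex.normSq_pos.mpr hs0
  have hvim : k / y ≤ v.im := by
    rw [hv, im_inversion, hk]
    have h2 : 1 / (2 * y) ≤ y / Complex.normSq s := by
      rw [div_le_div_iff₀ (by positivity) hnpos]; nlinarith
    calc 1 / (2 * (P : ℝ) ^ 2) / y = ((P : ℝ) ^ 2)⁻¹ * (1 / (2 * y)) := by field_simp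
      _ ≤ _ := by gcongr
  have hkv : k ≤ v.im := by
    refine le_trans ?_ hvim
    rw [le_div_iff₀ hy]; nlinarith
  have h3 := hK₂ v hkv
  rw [hv, ← oddTheta_inversion P hc ho hs, ← hv, norm_mul, norm_mul, norm_mul, norm_cpow_half,
    norm_pow, Complex.norm_natCast, norm_mul, norm_neg, Complex.norm_I, one_mul] at h3
  have hns : y ≤ ‖s‖ := (le_abs_self _).trans (Complex.abs_im_le_norm s)
  have h4 : y ≤ √‖s‖ := by
    apply Real.le_sqrt_of_sq_le
    nlinarith
  have h5 : y ^ 2 * ‖oddTheta c s‖ ≤ K₂ * Real.exp (-Real.pi * v.im) := by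
    refine le_trans ?_ h3
    gcongr
    calc y ^ 2 = 1 * y * y := by ring
      _ ≤ (P : ℝ) ^ 2 * ‖s‖ * √‖s‖ := by
        gcongr
        exact one_le_pow₀ hP1
  -- Exponential decay at the inverted point beats the factor `y²` that the weight `3/2` inversion
  -- costs, leaving a bound independent of `y ≤ 1`. The factor `e^π` then turns a constant into a
  -- multiple of `e^{-πy}`.
  have h6 : Real.exp (-Real.pi * v.im) ≤ 2 / (Real.pi * k) ^ 2 * y ^ 2 := by
    have h7 : Real.exp (-Real.pi * v.im) ≤ Real.exp (-(Real.pi * k / y)) := by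
      rw [Real.exp_le_exp]
      have := mul_le_mul_of_nonneg_left hvim Real.pi_pos.le
      rw [mul_div_assoc]; linarith
    have h8 := Real.quadratic_le_exp_of_nonneg (x := Real.pi * k / y) (by positivity)
    have h9 : (Real.pi * k / y) ^ 2 / 2 ≤ Real.exp (Real.pi * k / y) := by
      have : 0 ≤ Real.pi * k / y := by positivity
      linarith
    refine h7.trans ?_
    rw [Real.exp_neg]
    refine (inv_anti₀ (by positivity) h9).trans (le_of_eq ?_)
    field_simp
  have h10 : ‖oddTheta c s‖ ≤ K₂ * (2 / (Real.pi * k) ^ 2) := by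
    have : y ^ 2 * ‖oddTheta c s‖ ≤ y ^ 2 * (K₂ * (2 / (Real.pi * k) ^ 2)) := by
      refine h5.trans ?_
      calc _ ≤ K₂ * (2 / (Real.pi * k) ^ 2 * y ^ 2) := by gcongr
        _ = _ := by ring
    exact le_of_mul_le_mul_left this (by positivity)
  calc ‖oddTheta c s‖ ≤ K₂ * (2 / (Real.pi * k) ^ 2) * 1 := by rw [mul_one]; exact h10
    _ ≤ K₂ * (2 / (Real.pi * k) ^ 2) * (Real.exp Real.pi * Real.exp (-Real.pi * y)) := by
      gcongr
      rw [← Real.exp_add]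
      apply Real.one_le_exp
      nlinarith [Real.pi_pos]
    _ = K₃ * Real.exp (-Real.pi * y) := by rw [hK₃]; ring
    _ ≤ _ := by gcongr; linarith

/-- The integrand of the Eichler integral of a weight `3/2` theta series. -/
def eichlerIntegrand (c : ℤ → ℂ) (x : ℝ) (w : ℂ) : ℂ :=
  oddTheta c w * (-I * (w - x)) ^ (-(1 / 2) : ℂ)

/-- The Eichler integral of a weight `3/2` theta series, from `w` to `i∞`. -/
def eichler (c : ℤ → ℂ) (x : ℝ) (w : ℂ) : ℂ :=
  ∫ y in Ioi (0 : ℝ), eichlerIntegrand c x (w + y * I)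

section Eichler

variable {c : ℤ → ℂ} {C : ℝ}

theorem neg_I_mul_sub_mem_slitPlane {w : ℂ} (hw : 0 < w.im) (x : ℝ) :
    -I * (w - x) ∈ slitPlane := neg_I_mul_mem_slitPlane (by simpa using hw)

theorem differentiableAt_eichlerIntegrand (hc : ∀ n, ‖c n‖ ≤ C) (x : ℝ) {w : ℂ}
    (hw : 0 < w.im) : DifferentiableAt ℂ (eichlerIntegrand c x) w := by
  refine (differentiableAt_oddTheta hc hw).mul ?_
  exact DifferentiableAt.cpow_const (by fun_prop) (neg_I_mul_sub_mem_slitPlane hw x)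

theorem norm_kernel_le {w : ℂ} {x y : ℝ} (hy : 0 < y) (hw : y ≤ w.im) :
    ‖(-I * (w - x)) ^ (-(1 / 2) : ℂ)‖ ≤ y ^ (-(1 / 2) : ℝ) := by
  rw [norm_cpow_neg_half]
  refine Real.rpow_le_rpow_of_nonpos hy ?_ (by norm_num)
  refine hw.trans ?_
  have := Complex.abs_re_le_norm (-I * (w - x))
  refine le_trans ?_ this
  rw [re_neg_I_mul]
  simpa using le_abs_self _

theorem exists_eichlerIntegrand_le (hc : ∀ n, ‖c n‖ ≤ C) (x : ℝ) {δ : ℝ} (hδ : 0 < δ) :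
    ∃ K : ℝ, 0 ≤ K ∧ ∀ v : ℂ, δ ≤ v.im →
      ‖eichlerIntegrand c x v‖ ≤ K * Real.exp (-Real.pi * v.im) := by
  obtain ⟨K, hK0, hK⟩ := exists_oddTheta_le hc hδ
  refine ⟨K * δ ^ (-(1 / 2) : ℝ), by positivity, fun v hv => ?_⟩
  rw [eichlerIntegrand, norm_mul]
  calc _ ≤ K * Real.exp (-Real.pi * v.im) * δ ^ (-(1 / 2) : ℝ) :=
        mul_le_mul (hK v hv) (norm_kernel_le hδ hv) (norm_nonneg _) (by positivity)
    _ = _ := by ring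

theorem continuousOn_eichlerIntegrand_line (hc : ∀ n, ‖c n‖ ≤ C) (x : ℝ) {w : ℂ}
    (hw : 0 ≤ w.im) : ContinuousOn (fun y : ℝ => eichlerIntegrand c x (w + y * I)) (Ioi 0) := by
  intro y hy
  have h1 : 0 < (w + y * I).im := by
    have : 0 < y := hy
    simp; linarith
  exact ((differentiableAt_eichlerIntegrand hc x h1).continuousAt.comp
    (f := fun y : ℝ => w + y * I) (by fun_prop)).continuousWithinAt

theorem integrableOn_eichlerIntegrand (hc : ∀ n, ‖c n‖ ≤ C) (x : ℝ) {w : ℂ} (hw : 0 < w.im) :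
    IntegrableOn (fun y : ℝ => eichlerIntegrand c x (w + y * I)) (Ioi 0) := by
  obtain ⟨K, hK0, hK⟩ := exists_eichlerIntegrand_le hc x hw
  refine Integrable.mono' ((exp_neg_integrableOn_Ioi 0 Real.pi_pos).const_mul K)
    ((continuousOn_eichlerIntegrand_line hc x hw.le).aestronglyMeasurable measurableSet_Ioi) ?_
  refine (ae_restrict_iff' measurableSet_Ioi).mpr (Eventually.of_forall fun y (hy : 0 < y) => ?_)
  refine (hK _ (by simp; linarith)).trans ?_
  gcongr K * Real.exp ?_
  simp
  nlinarith [Real.pi_pos]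

/-- The `w`-derivative of the integrand is the `y`-derivative of `-i h(w+iy)`, where `h` is
`eichlerIntegrand c x`, so after differentiation under the integral only the boundary term at `y =
0` is left. Cauchy estimates supply the dominating function. -/
theorem hasDerivAt_eichler (hc : ∀ n, ‖c n‖ ≤ C) (x : ℝ) {w : ℂ} (hw : 0 < w.im) :
    HasDerivAt (eichler c x) (I * eichlerIntegrand c x w) w := by
  -- Points of the ball of radius `r` about `w` have height at least `3r`, so Cauchy circles of
  -- radius `r` about them and their upward translates stay at height at least `r`.
  set r : ℝ := w.im / 4 with hr
  have hr0 : 0 < r := by positivity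
  obtain ⟨K, hK0, hK⟩ := exists_eichlerIntegrand_le hc x hr0
  set h := eichlerIntegrand c x with hh
  have hUo : IsOpen {v : ℂ | 0 < v.im} := isOpen_lt continuous_const Complex.continuous_im
  have hd : DifferentiableOn ℂ h {v : ℂ | 0 < v.im} := fun v hv =>
    (differentiableAt_eichlerIntegrand hc x hv).differentiableWithinAt
  have hball : ∀ z v : ℂ, dist v z ≤ r → z.im - r ≤ v.im := fun z v hv => by
    have := (Complex.abs_im_le_norm (v - z)).trans (dist_eq_norm v z ▸ hv)
    rw [Complex.sub_im] at this
    linarith [(abs_le.mp this).1]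
  have hderiv : ∀ z : ℂ, 2 * r ≤ z.im → ‖deriv h z‖ ≤
      K * Real.exp (-Real.pi * (z.im - r)) / r := fun z hz => by
    refine norm_deriv_le_of_forall_mem_sphere_norm_le hr0 ?_ fun v hv => ?_
    · apply DifferentiableOn.diffContOnCl
      rw [closure_ball _ hr0.ne']
      refine hd.mono fun v hv => ?_
      have := hball z v hv
      simp only [mem_ofPred_eq]
      linarith
    · have := hball z v (le_of_eq hv)
      refine (hK v (by linarith)).trans ?_
      gcongr K * Real.exp ?_
      nlinarith [Real.pi_pos]
  have hcontd : ContinuousOn (fun y : ℝ => deriv h (w + y * I)) (Ioi 0) := by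
    intro y hy
    have h1 : 0 < (w + y * I).im := by
      have : 0 < y := hy
      simp; linarith
    exact (((hd.deriv hUo).differentiableAt (hUo.mem_nhds h1)).continuousAt.comp
      (f := fun y : ℝ => w + y * I) (by fun_prop)).continuousWithinAt
  have main := hasDerivAt_integral_of_dominated_loc_of_deriv_le (𝕜 := ℂ)
    (μ := volume.restrict (Ioi (0 : ℝ))) (F := fun v y => h (v + y * I))
    (F' := fun v y => deriv h (v + y * I)) (x₀ := w) (s := Metric.ball w r)
    (bound := fun y => K / r * Real.exp (-Real.pi * y))
    (Metric.ball_mem_nhds w hr0)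
    (by
      filter_upwards [hUo.mem_nhds hw] with v hv
      exact (continuousOn_eichlerIntegrand_line hc x (le_of_lt hv)).aestronglyMeasurable
        measurableSet_Ioi)
    (integrableOn_eichlerIntegrand hc x hw)
    (hcontd.aestronglyMeasurable measurableSet_Ioi)
    (by
      refine (ae_restrict_iff' measurableSet_Ioi).mpr
        (Eventually.of_forall fun y (hy : 0 < y) v hv => ?_)
      have hv' := hball w v (le_of_lt hv)
      have him : (v + y * I).im = v.im + y := by simp
      refine (hderiv _ (by rw [him]; linarith)).trans ?_
      rw [him, div_mul_eq_mul_div]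
      gcongr K * Real.exp ?_ / r
      nlinarith [Real.pi_pos])
    ((exp_neg_integrableOn_Ioi 0 Real.pi_pos).const_mul _)
    (by
      refine (ae_restrict_iff' measurableSet_Ioi).mpr
        (Eventually.of_forall fun y (hy : 0 < y) v hv => ?_)
      have hv' := hball w v (le_of_lt hv)
      have him : 0 < (v + y * I).im := by simp; linarith
      exact (differentiableAt_eichlerIntegrand hc x him).hasDerivAt.comp_add_const _ _)
  have hval : ∫ y in Ioi (0 : ℝ), deriv h (w + y * I) = I * h w := by
    have := integral_Ioi_of_hasDerivAt_of_tendsto (a := 0) (m := 0)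
      (f := fun y : ℝ => -I * h (w + y * I)) (f' := fun y : ℝ => deriv h (w + y * I))
      (by
        have h1 : ContinuousAt h (w + (0 : ℝ) * I) :=
          (differentiableAt_eichlerIntegrand hc x (by simpa using hw)).continuousAt
        exact ((h1.comp (f := fun y : ℝ => w + y * I) (by fun_prop)).const_mul
          (-I)).continuousWithinAt)
      (fun y hy => by
        have him : 0 < (w + y * I).im := by
          have : 0 < y := hy
          simp; linarith
        have h1 := (differentiableAt_eichlerIntegrand hc x him).hasDerivAt
        have h2 : HasDerivAt (fun y : ℝ => w + y * I) I y := by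
          simpa using ((Complex.ofRealCLM.hasDerivAt (x := y)).mul_const I).const_add w
        have h3 := (h1.comp y h2).const_mul (-I)
        refine h3.congr_deriv ?_
        linear_combination (-deriv h (w + y * I)) * Complex.I_mul_I)
      main.1
      (by
        rw [tendsto_zero_iff_norm_tendsto_zero]
        have h0 : Tendsto (fun y : ℝ => K * Real.exp (-Real.pi * y)) atTop (𝓝 (K * 0)) := by
          exact Tendsto.const_mul K (Real.tendsto_exp_atBot.comp
            (tendsto_id.const_mul_atTop_of_neg (neg_lt_zero.mpr Real.pi_pos)))
        rw [mul_zero] at h0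
        refine squeeze_zero' (Eventually.of_forall fun _ => norm_nonneg _) ?_ h0
        filter_upwards [eventually_gt_atTop 0] with y hy
        rw [norm_mul, norm_neg, Complex.norm_I, one_mul]
        refine (hK _ (by simp; linarith)).trans ?_
        gcongr K * Real.exp ?_
        simp
        nlinarith [Real.pi_pos])
    rw [this]
    simp
  rw [← hval]
  exact main.2

end Eichler

theorem integrableOn_rpow_mul_exp_neg_pi :
    IntegrableOn (fun y : ℝ => y ^ (-(1 / 2) : ℝ) * Real.exp (-Real.pi * y)) (Ioi 0) := by
  have := integrableOn_rpow_mul_exp_neg_mul_rpow (p := 1) (s := -(1 / 2)) (b := Real.pi)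
    (by norm_num) one_pos Real.pi_pos
  simpa only [Real.rpow_one] using this

end

/-! ### Boundary values of Eichler integrals and radial limits -/

noncomputable section

open Complex MeasureTheory Set

/-- Decay of a weight `3/2` theta series at the cusp `x`, within a cone. -/
def DecaysAt (c : ℤ → ℂ) (x : ℝ) : Prop :=
  ∃ K : ℝ, 0 ≤ K ∧ ∀ s : ℂ, 0 < s.im → |s.re| ≤ s.im →
    ‖oddTheta c (x + s)‖ ≤ K * Real.exp (-Real.pi * s.im)

/-- The coefficients of the expansion of a theta series at `x`. -/
def twist (c : ℤ → ℂ) (x : ℂ) (n : ℤ) : ℂ := c n * cexp (Real.pi * I * (n : ℂ) ^ 2 * x)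

theorem oddTheta_add (c : ℤ → ℂ) (x w : ℂ) : oddTheta c (x + w) = oddTheta (twist c x) w := by
  refine tsum_congr fun n => ?_
  rw [mul_add, Complex.exp_add, twist]
  push_cast
  ring

theorem halfTheta_add (c : ℤ → ℂ) (x w : ℂ) : halfTheta c (x + w) = halfTheta (twist c x) w := by
  refine tsum_congr fun n => ?_
  rw [mul_add, Complex.exp_add, twist]
  push_cast
  ring

theorem twist_periodic {c : ℤ → ℂ} {P : ℕ} (hc : Function.Periodic c (P : ℤ)) (x : ℚ) :
    Function.Periodic (twist c x) ((2 * P * x.den : ℕ) : ℤ) := by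
  intro n
  have h1 : c (n + (2 * P * x.den : ℕ)) = c n := by
    have := hc.int_mul (2 * x.den) n
    rw [← this]
    congr 2
    push_cast
    ring
  rw [twist, twist, h1]
  congr 1
  simp only [mul_assoc (Real.pi * I : ℂ)]
  apply exp_pi_I_eq_of_sub_even (2 * n * P * x.num + 2 * P ^ 2 * x.den * x.num)
  have hd : (x.den : ℂ) ≠ 0 := by exact_mod_cast x.den_nz
  have hx : (x : ℂ) = x.num / x.den := by exact_mod_cast (Rat.num_div_den x).symm
  rw [hx]
  push_cast
  field_simp
  ring

theorem twist_odd {c : ℤ → ℂ} (ho : ∀ n, c (-n) = -c n) (x : ℂ) (n : ℤ) :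
    twist c x (-n) = -twist c x n := by
  rw [twist, twist, ho]
  push_cast
  rw [neg_sq]
  ring

/-- Expanding about a rational `x` multiplies the coefficients by `e^{πi n² x}`. They stay odd and
periodic, so the estimate at the cusp `0` applies to the twisted series. -/
theorem decaysAt_rat {c : ℤ → ℂ} {P : ℕ} (hP : 0 < P) (hc : Function.Periodic c (P : ℤ))
    (ho : ∀ n, c (-n) = -c n) (x : ℚ) : DecaysAt c x := by
  have : NeZero (2 * P * x.den) := ⟨by have := x.den_pos; positivity⟩
  obtain ⟨K, hK0, hK⟩ := exists_oddTheta_cone_le _ (twist_periodic hc x) (twist_odd ho x)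
  refine ⟨K, hK0, fun s h1 h2 => ?_⟩
  have := hK s h1 h2
  rwa [← oddTheta_add] at this

section Limits

variable {c : ℤ → ℂ} {C : ℝ} {x : ℝ}

theorem continuousAt_eichlerIntegrand_line (hc : ∀ n, ‖c n‖ ≤ C) (x : ℝ) {z : ℂ}
    (hz : 0 < z.im) {w : ℝ → ℂ} {l : Filter ℝ} {w₀ : ℂ} (hw : Tendsto w l (𝓝 w₀)) {y : ℝ}
    (hy : w₀ + y * I = z) : Tendsto (fun t => eichlerIntegrand c x (w t + y * I)) l
      (𝓝 (eichlerIntegrand c x z)) :=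
  (differentiableAt_eichlerIntegrand hc x hz).continuousAt.tendsto.comp
    (hy ▸ hw.add_const (y * I : ℂ))

/-- A cone at `x` is stable under adding `iy`, so the whole path of integration stays in it. Decay
of the series and the singularity `y^{-1/2}` of the kernel give an integrable majorant independent
of the point. -/
theorem tendsto_eichler_cusp (hc : ∀ n, ‖c n‖ ≤ C) (hx : DecaysAt c x) {w : ℝ → ℂ}
    (hw : ∀ᶠ t in 𝓝[>] 0, 0 < (w t).im ∧ |(w t).re - x| ≤ (w t).im)
    (hlim : Tendsto w (𝓝[>] 0) (𝓝 x)) :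
    Tendsto (fun t => eichler c x (w t)) (𝓝[>] 0) (𝓝 (eichler c x x)) := by
  obtain ⟨K, hK0, hK⟩ := hx
  refine tendsto_integral_filter_of_dominated_convergence
    (fun y => K * (y ^ (-(1 / 2) : ℝ) * Real.exp (-Real.pi * y))) ?_ ?_
    (integrableOn_rpow_mul_exp_neg_pi.const_mul K) ?_
  · filter_upwards [hw] with t ht
    exact (continuousOn_eichlerIntegrand_line hc x ht.1.le).aestronglyMeasurable measurableSet_Ioi
  · filter_upwards [hw] with t ht
    refine (ae_restrict_iff' measurableSet_Ioi).mpr (Eventually.of_forall fun y (hy : 0 < y) => ?_)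
    rw [eichlerIntegrand, norm_mul]
    have h1 := hK (w t - x + y * I) (by simp; linarith) (by
      simp only [add_re, sub_re, ofReal_re, mul_re, I_re, mul_zero, ofReal_im, I_im, mul_one,
        sub_self, add_zero, add_im, sub_im, sub_zero, mul_im]
      linarith)
    have h2 : (x : ℂ) + (w t - x + y * I) = w t + y * I := by ring
    rw [h2] at h1
    have h3 : ‖oddTheta c (w t + y * I)‖ ≤ K * Real.exp (-Real.pi * y) := by
      refine h1.trans ?_
      gcongr K * Real.exp ?_
      simp
      nlinarith [Real.pi_pos]
    refine (mul_le_mul h3 (norm_kernel_le hy (by simp; linarith)) (norm_nonneg _)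
      (by positivity)).trans (le_of_eq (by ring))
  · refine (ae_restrict_iff' measurableSet_Ioi).mpr (Eventually.of_forall fun y (hy : 0 < y) => ?_)
    exact continuousAt_eichlerIntegrand_line hc x (by simpa using hy) hlim rfl

/-- The imaginary axis has distance `|x|` from `x`, so the kernel is bounded on it and only decay of
the theta series at `0` matters there. -/
theorem norm_kernel_le_of_im {w : ℂ} {x : ℝ} (hx : x ≠ 0) (hw : w.re = 0) :
    ‖(-I * (w - x)) ^ (-(1 / 2) : ℂ)‖ ≤ |x| ^ (-(1 / 2) : ℝ) := by
  rw [norm_cpow_neg_half]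
  refine Real.rpow_le_rpow_of_nonpos (abs_pos.mpr hx) ?_ (by norm_num)
  have := Complex.abs_im_le_norm (-I * (w - x))
  refine le_trans (le_of_eq ?_) this
  simp [hw]

theorem tendsto_eichler_zero (hc : ∀ n, ‖c n‖ ≤ C) (h0 : DecaysAt c 0) (hx : x ≠ 0) :
    Tendsto (fun t : ℝ => eichler c x (t * I)) (𝓝[>] 0) (𝓝 (eichler c x 0)) := by
  obtain ⟨K, hK0, hK⟩ := h0
  have hlim : Tendsto (fun t : ℝ => (t : ℂ) * I) (𝓝[>] 0) (𝓝 0) := by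
    have hcont : Continuous fun t : ℝ => (t : ℂ) * I := by fun_prop
    have := (hcont.tendsto 0).mono_left (nhdsWithin_le_nhds (s := Ioi (0 : ℝ)))
    simpa using this
  refine tendsto_integral_filter_of_dominated_convergence
    (fun y => K * |x| ^ (-(1 / 2) : ℝ) * Real.exp (-Real.pi * y)) ?_ ?_
    ((exp_neg_integrableOn_Ioi 0 Real.pi_pos).const_mul _) ?_
  · filter_upwards [self_mem_nhdsWithin] with t (ht : 0 < t)
    exact (continuousOn_eichlerIntegrand_line hc x (by simpa using ht.le)).aestronglyMeasurable
      measurableSet_Ioi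
  · filter_upwards [self_mem_nhdsWithin] with t (ht : 0 < t)
    refine (ae_restrict_iff' measurableSet_Ioi).mpr (Eventually.of_forall fun y (hy : 0 < y) => ?_)
    rw [eichlerIntegrand, norm_mul]
    have h1 := hK (t * I + y * I) (by simp; linarith) (by simp; linarith)
    rw [Complex.ofReal_zero, zero_add] at h1
    have h3 : ‖oddTheta c (t * I + y * I)‖ ≤ K * Real.exp (-Real.pi * y) := by
      refine h1.trans ?_
      gcongr K * Real.exp ?_
      simp
      nlinarith [Real.pi_pos]
    refine (mul_le_mul h3 (norm_kernel_le_of_im hx (by simp)) (norm_nonneg _)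
      (by positivity)).trans (le_of_eq (by ring))
  · refine (ae_restrict_iff' measurableSet_Ioi).mpr (Eventually.of_forall fun y (hy : 0 < y) => ?_)
    exact continuousAt_eichlerIntegrand_line hc x (by simpa using hy) hlim rfl

theorem tendsto_eichler_infty (hc : ∀ n, ‖c n‖ ≤ C) (x : ℝ) {w : ℝ → ℂ} {l : Filter ℝ}
    (hw : Tendsto (fun t => (w t).im) l atTop) :
    Tendsto (fun t => eichler c x (w t)) l (𝓝 0) := by
  obtain ⟨K, hK0, hK⟩ := exists_eichlerIntegrand_le hc x one_pos
  set J := ∫ y in Ioi (0 : ℝ), K * Real.exp (-Real.pi * y) with hJ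
  have h0 : Tendsto (fun t => Real.exp (-Real.pi * (w t).im) * J) l (𝓝 (0 * J)) :=
    Tendsto.mul_const J (Real.tendsto_exp_atBot.comp
      (hw.const_mul_atTop_of_neg (neg_lt_zero.mpr Real.pi_pos)))
  rw [zero_mul] at h0
  rw [tendsto_zero_iff_norm_tendsto_zero]
  refine squeeze_zero' (Eventually.of_forall fun _ => norm_nonneg _) ?_ h0
  filter_upwards [hw.eventually_ge_atTop 1] with t ht
  rw [hJ, ← integral_const_mul]
  refine norm_integral_le_of_norm_le
    (((exp_neg_integrableOn_Ioi 0 Real.pi_pos).const_mul K).const_mul _)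
    ((ae_restrict_iff' measurableSet_Ioi).mpr (Eventually.of_forall fun y (hy : 0 < y) => ?_))
  refine (hK _ (by simp; linarith)).trans (le_of_eq ?_)
  rw [mul_left_comm, ← Real.exp_add]
  congr 2
  simp
  ring

/-- As `Γ(1/2) = √π`, the factor `n` of the weight `3/2` series normalises the integral to exactly
`1`. -/
theorem integral_nat_mul_exp (n : ℕ) (hn : 0 < n) :
    ∫ y in Ioi (0 : ℝ), (n : ℝ) * (y ^ (-(1 / 2) : ℝ) * Real.exp (-(Real.pi * n ^ 2 * y))) = 1 := by
  have hn' : (0 : ℝ) < n := by exact_mod_cast hn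
  have h := Real.integral_rpow_mul_exp_neg_mul_Ioi (a := 1 / 2) (r := Real.pi * n ^ 2)
    (by norm_num) (by have := Real.pi_pos; positivity)
  rw [show (1 / 2 - 1 : ℝ) = -(1 / 2) by norm_num] at h
  rw [integral_const_mul, h, Real.Gamma_one_half_eq, ← Real.sqrt_eq_rpow, Real.sqrt_div one_pos.le,
    Real.sqrt_one, Real.sqrt_mul Real.pi_pos.le, Real.sqrt_sq hn'.le]
  have := Real.sqrt_pos.mpr Real.pi_pos
  field_simp

theorem ofReal_cpow_neg_half {y : ℝ} (hy : 0 ≤ y) :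
    (y : ℂ) ^ (-(1 / 2) : ℂ) = ((y ^ (-(1 / 2) : ℝ) : ℝ) : ℂ) := by
  rw [Complex.ofReal_cpow hy]; norm_num

/-- The one-sided theta series of weight `1/2` as an Eichler integral. -/
theorem halfTheta_eq_integral (hc : ∀ n, ‖c n‖ ≤ C) (hc0 : c 0 = 0) {τ : ℂ} (hτ : 0 < τ.im) :
    halfTheta c τ =
      ∫ y in Ioi (0 : ℝ), oddTheta c (τ + y * I) * ((y ^ (-(1 / 2) : ℝ) : ℝ) : ℂ) := by
  set g : ℕ → ℝ → ℝ := fun n y =>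
    (n : ℝ) * (y ^ (-(1 / 2) : ℝ) * Real.exp (-(Real.pi * n ^ 2 * y))) with hg
  set F : ℕ → ℝ → ℂ := fun n y => (c n * cexp (Real.pi * I * n ^ 2 * τ)) * (g n y : ℂ) with hF
  have hgint : ∀ n, IntegrableOn (g n) (Ioi 0) := fun n => by
    rcases Nat.eq_zero_or_pos n with rfl | hn
    · simp [hg]
    · refine Integrable.const_mul ?_ _
      have := integrableOn_rpow_mul_exp_neg_mul_rpow (p := 1) (s := -(1 / 2))
        (b := Real.pi * n ^ 2) (by norm_num) one_pos (by have := Real.pi_pos; positivity)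
      simp only [Real.rpow_one, neg_mul] at this
      exact this
  have hgpos : ∀ n, ∀ y ∈ Ioi (0 : ℝ), 0 ≤ g n y := fun n y (hy : 0 < y) => by
    simp only [hg]; positivity
  have hgval : ∀ n : ℕ, 0 < n → ∫ y in Ioi (0 : ℝ), g n y = 1 := fun n hn =>
    integral_nat_mul_exp n hn
  have hnorm : ∀ n, ∫ y in Ioi (0 : ℝ), ‖F n y‖ = ‖c n * cexp (Real.pi * I * n ^ 2 * τ)‖ := by
    intro n
    have h1 : ∫ y in Ioi (0 : ℝ), ‖F n y‖ =
        ∫ y in Ioi (0 : ℝ), ‖c n * cexp (Real.pi * I * n ^ 2 * τ)‖ * g n y := by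
      refine setIntegral_congr_fun measurableSet_Ioi fun y hy => ?_
      simp only [hF, norm_mul, Complex.norm_real, Real.norm_of_nonneg (hgpos n y hy)]
    rw [h1, integral_const_mul]
    -- The integral vanishes at `n = 0`, so this term is correct only because `c 0 = 0`.
    rcases Nat.eq_zero_or_pos n with rfl | hn
    · simp [hc0]
    · rw [hgval n hn, mul_one]
  have key := hasSum_integral_of_summable_integral_norm (μ := volume.restrict (Ioi (0 : ℝ)))
    (F := F) (fun n => ((hgint n).ofReal).const_mul _)
    (by simp only [hnorm]; exact (summable_halfTheta hc hτ).norm)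
  have hval : ∀ n, ∫ y in Ioi (0 : ℝ), F n y = c n * cexp (Real.pi * I * n ^ 2 * τ) := by
    intro n
    simp only [hF]
    rw [integral_const_mul, integral_complex_ofReal]
    rcases Nat.eq_zero_or_pos n with rfl | hn
    · simp [hc0]
    · rw [hgval n hn, Complex.ofReal_one, mul_one]
  simp only [hval] at key
  rw [halfTheta, key.tsum_eq]
  refine setIntegral_congr_fun measurableSet_Ioi fun y (hy : 0 < y) => ?_
  simp only [oddTheta, ← tsum_mul_right]
  refine tsum_congr fun n => ?_
  simp only [hF, hg]
  have : cexp (Real.pi * I * (n : ℂ) ^ 2 * (τ + y * I)) =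
      cexp (Real.pi * I * n ^ 2 * τ) * cexp (-(Real.pi * n ^ 2 * y)) := by
    rw [← Complex.exp_add]
    congr 1
    linear_combination (Real.pi * (n : ℂ) ^ 2 * y) * Complex.I_mul_I
  rw [this]
  push_cast
  ring

/-- The radial limit of a one-sided theta series with odd coefficients. -/
theorem tendsto_halfTheta_radial (hc : ∀ n, ‖c n‖ ≤ C) (hc0 : c 0 = 0) (hx : DecaysAt c x) :
    Tendsto (fun t : ℝ => halfTheta c (x + t * I)) (𝓝[>] 0) (𝓝 (eichler c x x)) := by
  obtain ⟨K, hK0, hK⟩ := hx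
  have hlimeq : eichler c x x =
      ∫ y in Ioi (0 : ℝ), oddTheta c (x + y * I) * ((y ^ (-(1 / 2) : ℝ) : ℝ) : ℂ) := by
    refine setIntegral_congr_fun measurableSet_Ioi fun y (hy : 0 < y) => ?_
    simp only [eichlerIntegrand]
    rw [← ofReal_cpow_neg_half hy.le]
    congr 2
    linear_combination (-(y : ℂ)) * Complex.I_mul_I
  have hmain : Tendsto (fun t : ℝ => ∫ y in Ioi (0 : ℝ),
      oddTheta c (x + t * I + y * I) * ((y ^ (-(1 / 2) : ℝ) : ℝ) : ℂ)) (𝓝[>] 0)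
      (𝓝 (eichler c x x)) := by
    rw [hlimeq]
    refine tendsto_integral_filter_of_dominated_convergence
      (fun y => K * (y ^ (-(1 / 2) : ℝ) * Real.exp (-Real.pi * y))) ?_ ?_
      (integrableOn_rpow_mul_exp_neg_pi.const_mul K) ?_
    · filter_upwards [self_mem_nhdsWithin] with t (ht : 0 < t)
      refine ContinuousOn.aestronglyMeasurable (fun y (hy : 0 < y) => ?_) measurableSet_Ioi
      have h1 : 0 < ((x : ℂ) + t * I + y * I).im := by simp; linarith
      refine ContinuousAt.continuousWithinAt (ContinuousAt.mul ?_ ?_)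
      · exact (differentiableAt_oddTheta hc h1).continuousAt.comp
          (f := fun y : ℝ => (x : ℂ) + t * I + y * I) (by fun_prop)
      · exact Complex.continuous_ofReal.continuousAt.comp
          (Real.continuousAt_rpow_const y _ (Or.inl hy.ne'))
    · filter_upwards [self_mem_nhdsWithin] with t (ht : 0 < t)
      refine (ae_restrict_iff' measurableSet_Ioi).mpr
        (Eventually.of_forall fun y (hy : 0 < y) => ?_)
      have h1 := hK (t * I + y * I) (by simp; linarith) (by simp; linarith)
      rw [← add_assoc] at h1
      rw [norm_mul, Complex.norm_real, Real.norm_of_nonneg (by positivity)]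
      have h3 : ‖oddTheta c (x + t * I + y * I)‖ ≤ K * Real.exp (-Real.pi * y) := by
        refine h1.trans ?_
        gcongr K * Real.exp ?_
        simp
        nlinarith [Real.pi_pos]
      refine (mul_le_mul_of_nonneg_right h3 (by positivity)).trans (le_of_eq (by ring))
    · refine (ae_restrict_iff' measurableSet_Ioi).mpr
        (Eventually.of_forall fun y (hy : 0 < y) => ?_)
      refine Tendsto.mul_const _ ?_
      have h1 : 0 < ((x : ℂ) + y * I).im := by simpa using hy
      have hlim : Tendsto (fun t : ℝ => (x : ℂ) + t * I + y * I) (𝓝[>] 0) (𝓝 (x + y * I)) := by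
        have hcont : Continuous fun t : ℝ => (x : ℂ) + t * I + y * I := by fun_prop
        have := (hcont.tendsto 0).mono_left (nhdsWithin_le_nhds (s := Ioi (0 : ℝ)))
        simpa using this
      exact (differentiableAt_oddTheta hc h1).continuousAt.tendsto.comp hlim
  refine hmain.congr' ?_
  filter_upwards [self_mem_nhdsWithin] with t (ht : 0 < t)
  exact (halfTheta_eq_integral hc hc0 (by simpa using ht)).symm

end Limits

end

/-! ### Inversion of radial limits and analyticity of the period integral -/

noncomputable section

open Complex MeasureTheory Set

theorem mul_cpow_half {x y : ℂ} (hx : x ≠ 0) (hy : y ≠ 0)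
    (h : arg x + arg y ∈ Ioc (-Real.pi) Real.pi) :
    (x * y) ^ (1 / 2 : ℂ) = x ^ (1 / 2 : ℂ) * y ^ (1 / 2 : ℂ) := by
  rw [Complex.cpow_def_of_ne_zero (mul_ne_zero hx hy), Complex.cpow_def_of_ne_zero hx,
    Complex.cpow_def_of_ne_zero hy, Complex.log_mul hx hy h, add_mul, Complex.exp_add]

theorem abs_arg_neg_I_mul_lt {w : ℂ} (hw : 0 < w.im) : |arg (-I * w)| < Real.pi / 2 :=
  Complex.abs_arg_lt_pi_div_two_iff.mpr (Or.inl (by rw [re_neg_I_mul]; exact hw))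

/-- The eighth root of unity in the inversion formula. -/
def inversionPhase (x : ℝ) : ℂ :=
  if 0 < x then cexp (-(Real.pi * I / 4)) else cexp (Real.pi * I / 4)

theorem inversionPhase_ne_zero (x : ℝ) : inversionPhase x ≠ 0 := by
  unfold inversionPhase; split_ifs <;> exact Complex.exp_ne_zero _

theorem neg_I_cpow_half : (-I) ^ (1 / 2 : ℂ) = cexp (-(Real.pi * I / 4)) := by
  rw [Complex.cpow_def_of_ne_zero (by simp), Complex.log_neg_I]
  congr 1; ring

theorem I_cpow_half : I ^ (1 / 2 : ℂ) = cexp (Real.pi * I / 4) := by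
  rw [Complex.cpow_def_of_ne_zero (by simp), Complex.log_I]
  congr 1; ring

/-- Both factors on the left are roots of numbers in the right half-plane, so they multiply without
a branch jump. The product of the radicands is `-i(w-x)` times `-i` or `i`, according to the sign of
`x`, and the positive constant `1/(P²|x|)`. -/
theorem kernel_inversion (P : ℕ) [NeZero P] {x : ℝ} (hx : x ≠ 0) {w : ℂ} (hw : 0 < w.im) :
    (-I * (-1 / ((P : ℂ) ^ 2 * w) - (-1 / ((P : ℝ) ^ 2 * x) : ℝ))) ^ (1 / 2 : ℂ) *
      (-I * w) ^ (1 / 2 : ℂ) =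
    inversionPhase x / (P * (√|x| : ℝ)) * (-I * (w - x)) ^ (1 / 2 : ℂ) := by
  have hw0 : w ≠ 0 := fun h => by simp [h] at hw
  have hP0 : 0 < P := Nat.pos_of_ne_zero (NeZero.ne P)
  have hPR : (0 : ℝ) < P := by exact_mod_cast hP0
  have hP : (P : ℂ) ≠ 0 := by exact_mod_cast NeZero.ne P
  have hxC : (x : ℂ) ≠ 0 := by exact_mod_cast hx
  have hpi := Real.pi_pos
  set v := -1 / ((P : ℂ) ^ 2 * w) - (-1 / ((P : ℝ) ^ 2 * x) : ℝ) with hv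
  have hvim : 0 < v.im := by
    rw [hv, Complex.sub_im, Complex.ofReal_im, sub_zero]
    exact im_neg_inv_sq_mul hP0 hw
  have hwx : 0 < (w - x).im := by simpa using hw
  have h1 := abs_lt.mp (abs_arg_neg_I_mul_lt hvim)
  have h2 := abs_lt.mp (abs_arg_neg_I_mul_lt hw)
  have h3 := abs_lt.mp (abs_arg_neg_I_mul_lt hwx)
  rw [← mul_cpow_half (neg_I_mul_ne_zero hvim) (neg_I_mul_ne_zero hw)
    ⟨by linarith [h1.1, h2.1], by linarith [h1.2, h2.2]⟩]
  have hsqrt : √(1 / ((P : ℝ) ^ 2 * |x|)) = 1 / (P * √|x|) := by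
    rw [Real.sqrt_div one_pos.le, Real.sqrt_one, Real.sqrt_mul (by positivity),
      Real.sqrt_sq hPR.le]
  have hpos : 0 < 1 / ((P : ℝ) ^ 2 * |x|) := by
    have := abs_pos.mpr hx
    positivity
  unfold inversionPhase
  split_ifs with hx0
  · have e : -I * v * (-I * w) = ((1 / ((P : ℝ) ^ 2 * |x|) : ℝ) : ℂ) * (-I * (-I * (w - x))) := by
      rw [abs_of_pos hx0, hv]
      push_cast
      field_simp
      ring
    rw [e, ofReal_mul_cpow_half hpos, mul_cpow_half (by simp) (neg_I_mul_ne_zero hwx)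
      ⟨by rw [Complex.arg_neg_I]; linarith [h3.1], by rw [Complex.arg_neg_I]; linarith [h3.2]⟩,
      neg_I_cpow_half, hsqrt]
    push_cast
    ring
  · have hx1 : x < 0 := lt_of_le_of_ne (not_lt.mp hx0) hx
    have e : -I * v * (-I * w) = ((1 / ((P : ℝ) ^ 2 * |x|) : ℝ) : ℂ) * (I * (-I * (w - x))) := by
      rw [abs_of_neg hx1, hv]
      push_cast
      field_simp
      ring
    rw [e, ofReal_mul_cpow_half hpos, mul_cpow_half (by simp) (neg_I_mul_ne_zero hwx)
      ⟨by rw [Complex.arg_I]; linarith [h3.1], by rw [Complex.arg_I]; linarith [h3.2]⟩,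
      I_cpow_half, hsqrt]
    push_cast
    ring

/-- Weight `3/2` of the series and weight `1/2` of the kernel cancel against `d(-1/(P²w)) =
dw/(P²w²)`, so the two differentials agree up to a constant. -/
theorem eichlerIntegrand_inversion (P : ℕ) [NeZero P] {c : ℤ → ℂ}
    (hc : Function.Periodic c (P : ℤ)) (ho : ∀ n, c (-n) = -c n) {x : ℝ} (hx : x ≠ 0) {w : ℂ}
    (hw : 0 < w.im) :
    eichlerIntegrand c x w + -I * inversionPhase x / (P * (√|x| : ℝ)) *
      (eichlerIntegrand (dft P c) (-1 / ((P : ℝ) ^ 2 * x)) (-1 / ((P : ℂ) ^ 2 * w)) *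
        (1 / ((P : ℂ) ^ 2 * w ^ 2))) = 0 := by
  have hw0 : w ≠ 0 := fun h => by simp [h] at hw
  have hP0 : 0 < P := Nat.pos_of_ne_zero (NeZero.ne P)
  have hP : (P : ℂ) ≠ 0 := by exact_mod_cast NeZero.ne P
  have hsx : ((√|x| : ℝ) : ℂ) ≠ 0 := by
    exact_mod_cast (Real.sqrt_pos.mpr (abs_pos.mpr hx)).ne'
  have hk := kernel_inversion P hx hw
  have hwx : 0 < (w - x).im := by simpa using hw
  rw [eichlerIntegrand, eichlerIntegrand, Complex.cpow_neg, Complex.cpow_neg,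
    ← oddTheta_inversion P hc ho hw]
  have hsq : (-I * w) ^ (1 / 2 : ℂ) * (-I * w) ^ (1 / 2 : ℂ) = -I * w := by
    rw [← Complex.cpow_add _ _ (neg_I_mul_ne_zero hw)]; norm_num
  have h1 := sqrt_neg_I_mul_ne_zero hw
  have h2 := sqrt_neg_I_mul_ne_zero hwx
  have h3 := inversionPhase_ne_zero x
  have hvne : (-I * (-1 / ((P : ℂ) ^ 2 * w) - (-1 / ((P : ℝ) ^ 2 * x) : ℝ))) ^ (1 / 2 : ℂ) ≠ 0 := by
    apply sqrt_neg_I_mul_ne_zero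
    rw [Complex.sub_im, Complex.ofReal_im, sub_zero]
    exact im_neg_inv_sq_mul hP0 hw
  generalize (-I * (-1 / ((P : ℂ) ^ 2 * w) - (-1 / ((P : ℝ) ^ 2 * x) : ℝ))) ^ (1 / 2 : ℂ) = A at *
  generalize (-I * (w - x)) ^ (1 / 2 : ℂ) = B at *
  generalize (-I * w) ^ (1 / 2 : ℂ) = S at *
  generalize inversionPhase x = σ at *
  generalize ((√|x| : ℝ) : ℂ) = u at *
  have hB : B = A * S * (P * u) / σ := by rw [hk]; field_simp
  rw [hB]
  field_simp
  linear_combination (-I * σ * oddTheta c w) * hsq + (σ * w * oddTheta c w) * Complex.I_mul_I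

/-- The inversion formula for radial limits of one-sided theta series. -/
theorem eichler_inversion (P : ℕ) [NeZero P] {c : ℤ → ℂ} (hc : Function.Periodic c (P : ℤ))
    (ho : ∀ n, c (-n) = -c n) {x : ℝ} (hx : x ≠ 0) (hcx : DecaysAt c x)
    (hcx' : DecaysAt (dft P c) (-1 / ((P : ℝ) ^ 2 * x))) (hc0 : DecaysAt c 0) :
    eichler c x x + -I * inversionPhase x / (P * (√|x| : ℝ)) *
      eichler (dft P c) (-1 / ((P : ℝ) ^ 2 * x)) (-1 / ((P : ℝ) ^ 2 * x) : ℝ) =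
    eichler c x 0 := by
  have hP0 : 0 < P := Nat.pos_of_ne_zero (NeZero.ne P)
  have hPR : (0 : ℝ) < P := by exact_mod_cast hP0
  have hP : (P : ℂ) ≠ 0 := by exact_mod_cast NeZero.ne P
  have hxC : (x : ℂ) ≠ 0 := by exact_mod_cast hx
  obtain ⟨C, -, hC⟩ := exists_bound_of_periodic hP0 hc
  obtain ⟨C', -, hC'⟩ := exists_bound_of_periodic hP0 (dft_periodic P c)
  set κ : ℂ := -I * inversionPhase x / (P * (√|x| : ℝ)) with hκ
  set x' : ℝ := -1 / ((P : ℝ) ^ 2 * x) with hx'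
  set v : ℂ → ℂ := fun w => -1 / ((P : ℂ) ^ 2 * w) with hv
  -- `G` has derivative zero on the upper half-plane; the theorem compares its boundary values at
  -- `x` and at `0`.
  set G : ℂ → ℂ := fun w => eichler c x w + κ * eichler (dft P c) x' (v w) with hG
  have hUo : IsOpen {w : ℂ | 0 < w.im} := isOpen_lt continuous_const Complex.continuous_im
  have hderiv : ∀ w : ℂ, 0 < w.im → HasDerivAt G 0 w := by
    intro w hw
    have hw0 : w ≠ 0 := fun h => by simp [h] at hw
    have h1 : HasDerivAt v (1 / ((P : ℂ) ^ 2 * w ^ 2)) w := by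
      have := (hasDerivAt_inv hw0).const_mul (-1 / (P : ℂ) ^ 2)
      refine (this.congr_deriv (by field_simp)).congr_of_eventuallyEq
        (Eventually.of_forall fun z => ?_)
      simp only [hv]
      rw [div_mul_eq_div_div, div_eq_mul_inv _ z]
    have h2 := (hasDerivAt_eichler hC' x' (im_neg_inv_sq_mul hP0 hw)).comp w h1
    have h3 := (hasDerivAt_eichler hC x hw).add (h2.const_mul κ)
    refine h3.congr_deriv ?_
    have := eichlerIntegrand_inversion P hc ho hx hw
    linear_combination I * this
  have hconst : ∀ w z : ℂ, 0 < w.im → 0 < z.im → G w = G z := fun w z hw hz =>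
    hUo.is_const_of_deriv_eq_zero (convex_halfSpace_im_gt 0).isPreconnected
      (fun y hy => (hderiv y hy).differentiableAt.differentiableWithinAt)
      (fun y hy => (hderiv y hy).deriv) hw hz
  have hmem : ∀ᶠ t : ℝ in 𝓝[>] 0, 0 < t := self_mem_nhdsWithin
  have hw1 : Tendsto (fun t : ℝ => (x : ℂ) + t * I) (𝓝[>] 0) (𝓝 x) := by
    have hcont : Continuous fun t : ℝ => (x : ℂ) + t * I := by fun_prop
    have := (hcont.tendsto 0).mono_left (nhdsWithin_le_nhds (s := Ioi (0 : ℝ)))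
    simpa using this
  have hvx : v x = (x' : ℂ) := by simp [hv, hx']
  -- the limit at `x`
  have L1 : Tendsto (fun t : ℝ => G (x + t * I)) (𝓝[>] 0)
      (𝓝 (eichler c x x + κ * eichler (dft P c) x' x')) := by
    refine Tendsto.add ?_ (Tendsto.const_mul κ ?_)
    · refine tendsto_eichler_cusp hC hcx ?_ hw1
      filter_upwards [hmem] with t ht
      simpa using ⟨ht, ht.le⟩
    · refine tendsto_eichler_cusp hC' hcx' ?_ ?_
      · have hle : ∀ᶠ t : ℝ in 𝓝[>] 0, t < |x| :=
          nhdsWithin_le_nhds (gt_mem_nhds (abs_pos.mpr hx))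
        filter_upwards [hmem, hle] with t ht htx
        refine ⟨im_neg_inv_sq_mul hP0 (by simpa using ht), ?_⟩
        have hns : Complex.normSq ((x : ℂ) + t * I) = x ^ 2 + t ^ 2 := by
          simp [Complex.normSq_apply]; ring
        have hpos : 0 < x ^ 2 + t ^ 2 := by positivity
        have him : (v (x + t * I)).im = ((P : ℝ) ^ 2)⁻¹ * (t / (x ^ 2 + t ^ 2)) := by
          simp only [hv]; rw [im_inversion, hns]; simp
        have hre : (v (x + t * I)).re = -(((P : ℝ) ^ 2)⁻¹ * (x / (x ^ 2 + t ^ 2))) := by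
          have h1 : v (x + t * I) = ((((P : ℝ) ^ 2)⁻¹ : ℝ) : ℂ) * (-((x : ℂ) + t * I)⁻¹) := by
            simp only [hv]; push_cast; rw [neg_div, one_div, mul_inv]; ring
          rw [h1, Complex.re_ofReal_mul, Complex.neg_re, Complex.inv_re, hns]
          simp
        have hd : (v (x + t * I)).re - x' =
            ((P : ℝ) ^ 2)⁻¹ * (t / (x ^ 2 + t ^ 2)) * (t / x) := by
          rw [hre, hx']
          field_simp
          ring
        rw [hd, him, abs_mul, abs_of_nonneg (by positivity)]
        refine mul_le_of_le_one_right (by positivity) ?_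
        rw [abs_div, abs_of_pos ht, div_le_one (abs_pos.mpr hx)]
        exact htx.le
      · rw [← hvx]
        have hvc : ContinuousAt v x :=
          ContinuousAt.div (by fun_prop) (by fun_prop) (mul_ne_zero (pow_ne_zero 2 hP) hxC)
        exact hvc.tendsto.comp hw1
  -- the limit at `0`
  have L2 : Tendsto (fun t : ℝ => G (t * I)) (𝓝[>] 0) (𝓝 (eichler c x 0 + κ * 0)) := by
    refine Tendsto.add (tendsto_eichler_zero hC hc0 hx) (Tendsto.const_mul κ ?_)
    -- The inversion sends `0` to `i∞`, where the second integral vanishes.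
    refine tendsto_eichler_infty hC' x' ?_
    have : Tendsto (fun t : ℝ => ((P : ℝ) ^ 2)⁻¹ * t⁻¹) (𝓝[>] 0) atTop :=
      tendsto_inv_nhdsGT_zero.const_mul_atTop (by positivity)
    refine this.congr' ?_
    filter_upwards [hmem] with t ht
    simp only [hv]
    rw [im_inversion]
    congr 1
    simp [Complex.normSq_apply]
  rw [mul_zero, add_zero] at L2
  have L3 : Tendsto (fun t : ℝ => G (x + t * I)) (𝓝[>] 0) (𝓝 (eichler c x 0)) := by
    refine L2.congr' ?_
    filter_upwards [hmem] with t ht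
    exact hconst _ _ (by simpa using ht) (by simpa using ht)
  exact tendsto_nhds_unique L1 L3

/-- The Eichler integral from `0` to `i∞` is real-analytic away from `0`. -/
theorem analyticOnNhd_eichler_zero {c : ℤ → ℂ} {C : ℝ} (hc : ∀ n, ‖c n‖ ≤ C)
    (h0 : DecaysAt c 0) : AnalyticOnNhd ℝ (fun x : ℝ => eichler c x 0) {x | x ≠ 0} := by
  obtain ⟨K, hK0, hK⟩ := h0
  have hθ : ∀ y : ℝ, 0 < y → ‖oddTheta c (y * I)‖ ≤ K * Real.exp (-Real.pi * y) := fun y hy => by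
    have := hK (y * I) (by simpa using hy) (by simpa using hy.le)
    simpa using this
  have hcθ : ContinuousOn (fun y : ℝ => oddTheta c (y * I)) (Ioi 0) := fun y (hy : 0 < y) =>
    ((differentiableAt_oddTheta hc (by simpa using hy)).continuousAt.comp
      (f := fun y : ℝ => (y : ℂ) * I) (by fun_prop)).continuousWithinAt
  -- The real point `x` is replaced by a complex `z`. The base `y + iz` has imaginary part `Re z`,
  -- so it avoids the branch cut when `Re z ≠ 0`, and `G` is holomorphic there.
  set G : ℂ → ℂ := fun z =>
    ∫ y in Ioi (0 : ℝ), oddTheta c (y * I) * (y + I * z) ^ (-(1 / 2) : ℂ) with hG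
  have hUo : IsOpen {z : ℂ | z.re ≠ 0} := isOpen_ne_fun Complex.continuous_re continuous_const
  have hsl : ∀ (y : ℝ) (z : ℂ), z.re ≠ 0 → (y : ℂ) + I * z ∈ slitPlane := fun y z hz =>
    Or.inr (by simpa using hz)
  have hnorm : ∀ (y : ℝ) (z : ℂ), |z.re| ≤ ‖(y : ℂ) + I * z‖ := fun y z => by
    have := Complex.abs_im_le_norm ((y : ℂ) + I * z)
    simpa using this
  have hdiff : DifferentiableOn ℂ G {z : ℂ | z.re ≠ 0} := by
    intro z₀ hz₀
    have hz₀' : 0 < |z₀.re| := abs_pos.mpr hz₀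
    set r : ℝ := |z₀.re| / 2 with hr
    have hr0 : 0 < r := by positivity
    have hball : ∀ z ∈ Metric.ball z₀ r, r ≤ |z.re| := fun z hz => by
      have hz' : ‖z - z₀‖ < r := by rwa [Metric.mem_ball, dist_eq_norm] at hz
      have h1 := (Complex.abs_re_le_norm (z - z₀)).trans hz'.le
      rw [Complex.sub_re] at h1
      have h2 := abs_sub_abs_le_abs_sub z₀.re z.re
      rw [abs_sub_comm] at h2
      linarith
    have hne : ∀ z ∈ Metric.ball z₀ r, z.re ≠ 0 := fun z hz =>
      abs_pos.mp (hr0.trans_le (hball z hz))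
    have hcont : ∀ z : ℂ, z.re ≠ 0 → ∀ s : ℂ,
        ContinuousOn (fun y : ℝ => ((y : ℂ) + I * z) ^ s) (Ioi 0) := fun z hz s y _ =>
      ((continuousAt_cpow_const (hsl y z hz)).comp
        (f := fun y : ℝ => (y : ℂ) + I * z) (by fun_prop)).continuousWithinAt
    have main := hasDerivAt_integral_of_dominated_loc_of_deriv_le (𝕜 := ℂ)
      (μ := volume.restrict (Ioi (0 : ℝ)))
      (F := fun z y => oddTheta c (y * I) * ((y : ℂ) + I * z) ^ (-(1 / 2) : ℂ))
      (F' := fun z y => oddTheta c (y * I) *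
        (-(1 / 2) * ((y : ℂ) + I * z) ^ (-(1 / 2) - 1 : ℂ) * I)) (x₀ := z₀)
      (s := Metric.ball z₀ r)
      (bound := fun y => K * (1 / 2 * r ^ (-(3 / 2) : ℝ)) * Real.exp (-Real.pi * y))
      (Metric.ball_mem_nhds z₀ hr0)
      (by
        filter_upwards [hUo.mem_nhds hz₀] with z hz
        exact (hcθ.mul (hcont z hz _)).aestronglyMeasurable measurableSet_Ioi)
      (by
        refine Integrable.mono'
          ((exp_neg_integrableOn_Ioi 0 Real.pi_pos).const_mul (K * |z₀.re| ^ (-(1 / 2) : ℝ)))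
          ((hcθ.mul (hcont z₀ hz₀ _)).aestronglyMeasurable measurableSet_Ioi)
          ((ae_restrict_iff' measurableSet_Ioi).mpr
            (Eventually.of_forall fun y (hy : 0 < y) => ?_))
        rw [norm_mul, norm_cpow_neg_half]
        refine (mul_le_mul (hθ y hy) (Real.rpow_le_rpow_of_nonpos hz₀' (hnorm y z₀)
          (by norm_num)) (by positivity) (by positivity)).trans (le_of_eq (by ring)))
      ((hcθ.mul ((continuousOn_const.mul (hcont z₀ hz₀ _)).mul
        continuousOn_const)).aestronglyMeasurable measurableSet_Ioi)
      (by
        refine (ae_restrict_iff' measurableSet_Ioi).mpr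
          (Eventually.of_forall fun y (hy : 0 < y) z hz => ?_)
        have e : ‖((y : ℂ) + I * z) ^ (-(1 / 2) - 1 : ℂ)‖ = ‖(y : ℂ) + I * z‖ ^ (-(3 / 2) : ℝ) := by
          rw [← Complex.norm_cpow_real]; norm_num
        rw [norm_mul, norm_mul, norm_mul, e, Complex.norm_I, mul_one]
        have h2 : ‖(-(1 / 2) : ℂ)‖ = 1 / 2 := by norm_num
        rw [h2]
        refine (mul_le_mul (hθ y hy) (mul_le_mul_of_nonneg_left (Real.rpow_le_rpow_of_nonpos hr0
          ((hball z hz).trans (hnorm y z)) (by norm_num)) (by norm_num)) (by positivity)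
          (by positivity)).trans (le_of_eq (by ring)))
      ((exp_neg_integrableOn_Ioi 0 Real.pi_pos).const_mul _)
      (by
        refine Eventually.of_forall fun y z hz => ?_
        have h1 : HasDerivAt (fun z : ℂ => (y : ℂ) + I * z) I z := by
          simpa using ((hasDerivAt_id z).const_mul I).const_add (y : ℂ)
        exact (h1.cpow_const (hsl y z (hne z hz))).const_mul _)
    exact main.2.differentiableAt.differentiableWithinAt
  have han := (hdiff.analyticOnNhd hUo).restrictScalars (𝕜 := ℝ)
  intro x hx
  have h1 : AnalyticAt ℝ (fun x : ℝ => (x : ℂ)) x := Complex.ofRealCLM.analyticAt x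
  have h2 : AnalyticAt ℝ (G ∘ fun x : ℝ => (x : ℂ)) x :=
    AnalyticAt.comp (han x (by simpa using hx)) h1
  refine h2.congr (Eventually.of_forall fun z => ?_)
  simp only [hG, Function.comp, eichler, eichlerIntegrand, zero_add]
  refine integral_congr_ae (Eventually.of_forall fun y => ?_)
  simp only
  congr 2
  linear_combination (y : ℂ) * Complex.I_mul_I

end

/-! ### Fourier transform of quadratically twisted periodic coefficients -/

noncomputable section

open Complex
open scoped NumberTheorySymbols

theorem sum_fin_periodic_add {c : ℕ} {g : ℤ → ℂ} (hg : Function.Periodic g (c : ℤ)) (s : ℤ) :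
    ∑ j : Fin c, g ((j : ℕ) + s) = ∑ j : Fin c, g (j : ℕ) := by
  have step : ∀ s : ℤ, ∑ j : Fin c, g ((j : ℕ) + (s + 1)) = ∑ j : Fin c, g ((j : ℕ) + s) := by
    intro s
    rw [Fin.sum_univ_eq_sum_range (fun j => g ((j : ℤ) + (s + 1))),
      Fin.sum_univ_eq_sum_range (fun j => g ((j : ℤ) + s))]
    have h1 := Finset.sum_range_succ (fun j : ℕ => g ((j : ℤ) + s)) c
    rw [Finset.sum_range_succ'] at h1
    have h2 : g ((c : ℤ) + s) = g s := by rw [add_comm]; exact hg s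
    rw [h2, Nat.cast_zero, zero_add] at h1
    rw [← add_right_cancel h1]
    refine Finset.sum_congr rfl fun j _ => ?_
    congr 1
    push_cast
    ring
  induction s using Int.induction_on with
  | zero => simp
  | succ n ih => rw [step]; exact ih
  | pred n ih =>
    rw [← ih]
    have := step (-(n : ℤ) - 1)
    rw [sub_add_cancel] at this
    exact this.symm

theorem sum_fin_exp (N : ℕ) [NeZero N] (m : ℤ) :
    ∑ h : Fin N, cexp (2 * Real.pi * I * ((h : ℕ) * (m / N))) =
      if (N : ℤ) ∣ m then (N : ℂ) else 0 := by
  have hN : (N : ℂ) ≠ 0 := by exact_mod_cast NeZero.ne N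
  set z := cexp (2 * Real.pi * I * (m / N)) with hz
  have hpow : ∀ h : ℕ, cexp (2 * Real.pi * I * (h * (m / N))) = z ^ h := fun h => by
    rw [hz, ← Complex.exp_nat_mul]; congr 1; ring
  simp only [hpow]
  rw [Fin.sum_univ_eq_sum_range (fun h => z ^ h)]
  have hz1 : z = 1 ↔ (N : ℤ) ∣ m := by
    rw [hz, Complex.exp_eq_one_iff]
    constructor
    · rintro ⟨n, hn⟩
      have h1 : (m : ℂ) / N = n := by
        apply mul_left_cancel₀ Complex.two_pi_I_ne_zero
        rw [hn]; ring
      rw [div_eq_iff hN] at h1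
      exact ⟨n, by rw [mul_comm]; exact_mod_cast h1⟩
    · rintro ⟨n, rfl⟩
      refine ⟨n, ?_⟩
      push_cast
      field_simp
  split_ifs with h
  · rw [hz1.mpr h]; simp
  · have hzN : z ^ N = 1 := by
      rw [← hpow]
      rw [Complex.exp_eq_one_iff]
      exact ⟨m, by field_simp⟩
    rw [geom_sum_eq (fun h' => h (hz1.mp h')), hzN, sub_self, zero_div]

theorem dft_mul_sum (N c : ℕ) (φ : ℤ → ℂ) (k : ℤ) :
    dft (N * c) φ k = ∑ i : Fin c, ∑ h : Fin N, φ ((i : ℕ) + c * (h : ℕ)) *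
      cexp (2 * Real.pi * I * k * (((i : ℕ) + c * (h : ℕ)) / (N * c))) := by
  rw [dft, ← finProdFinEquiv.sum_comp, Fintype.sum_prod_type, Finset.sum_comm]
  refine Finset.sum_congr rfl fun i _ => Finset.sum_congr rfl fun h _ => ?_
  simp [finProdFinEquiv]

section Twist

variable {N c₁ : ℕ} {a b d η : ℤ} {ψ : ℤ → ℂ}

/-- Evenness of `N` gives the period `Nc` itself, which is the level used in the inversion. -/
theorem twist_quad_periodic (hN : 0 < N) (hN2 : Even N) (hψ : Function.Periodic ψ (N : ℤ))
    (d : ℤ) {c : ℕ} (hc : 0 < c) :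
    Function.Periodic (twist ψ (d / (N * c))) ((N * c : ℕ) : ℤ) := by
  obtain ⟨M, hM⟩ := hN2
  intro n
  have h1 : ψ (n + (N * c : ℕ)) = ψ n := by
    have := hψ.int_mul c n
    rw [← this]; congr 1; push_cast; ring
  rw [twist, twist, h1]
  congr 1
  have hN' : (N : ℂ) ≠ 0 := by exact_mod_cast hN.ne'
  have hc' : (c : ℂ) ≠ 0 := by exact_mod_cast hc.ne'
  have hM' : (N : ℂ) = M + M := by exact_mod_cast hM
  simp only [mul_assoc (Real.pi * I : ℂ)]
  apply exp_pi_I_eq_of_sub_even (n * d + M * c * d)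
  push_cast
  field_simp
  linear_combination (N * c ^ 2 * d : ℂ) * hM'

/-- With `c = c₁N`, residues modulo `Nc` are written as `i + ch`, `h` modulo `N`. The term quadratic
in `h` contributes `-d c₁ h²`, which disappears because `c₁` is even; the remaining character sum
over `h` forces `k ≡ di` modulo `N`. -/
theorem dft_twist_eq_sum [NeZero N] (hc₁ : 0 < c₁) (hc₁e : Even c₁)
    (hψ : Function.Periodic ψ (N : ℤ)) (d k : ℤ) :
    dft (N * (c₁ * N)) (twist ψ (((-d : ℤ) : ℂ) / (N * (c₁ * N : ℕ)))) k =
      ∑ i : Fin (c₁ * N), (if (N : ℤ) ∣ k - d * (i : ℕ) then (N : ℂ) else 0) * (ψ (i : ℕ) *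
        cexp (Real.pi * I * ((-d * ((i : ℕ) : ℂ) ^ 2 + 2 * k * ((i : ℕ) : ℂ)) /
          (N * (c₁ * N : ℕ))))) := by
  obtain ⟨M, hM⟩ := hc₁e
  have hN' : (N : ℂ) ≠ 0 := by exact_mod_cast NeZero.ne N
  have hc' : (c₁ : ℂ) ≠ 0 := by exact_mod_cast hc₁.ne'
  have hM' : (c₁ : ℂ) = M + M := by exact_mod_cast hM
  rw [dft_mul_sum]
  refine Finset.sum_congr rfl fun i _ => ?_
  rw [← sum_fin_exp, Finset.sum_mul]
  refine Finset.sum_congr rfl fun h _ => ?_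
  have h1 : ψ ((i : ℕ) + (c₁ * N : ℕ) * (h : ℕ)) = ψ (i : ℕ) := by
    have := hψ.int_mul (c₁ * (h : ℕ)) (i : ℕ)
    rw [← this]; congr 1; push_cast; ring
  rw [twist, h1, mul_left_comm, ← Complex.exp_add, mul_assoc, ← Complex.exp_add]
  congr 1
  have e1 : 2 * Real.pi * I * (((h : ℕ) : ℂ) * (((k - d * (i : ℕ) : ℤ) : ℂ) / N)) +
      Real.pi * I * ((-d * ((i : ℕ) : ℂ) ^ 2 + 2 * k * ((i : ℕ) : ℂ)) / (N * (c₁ * N : ℕ))) =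
    Real.pi * I * (2 * (((h : ℕ) : ℂ) * (((k - d * (i : ℕ) : ℤ) : ℂ) / N)) +
      ((-d * ((i : ℕ) : ℂ) ^ 2 + 2 * k * ((i : ℕ) : ℂ)) / (N * (c₁ * N : ℕ)))) := by ring
  have e2 : Real.pi * I * (((i : ℕ) + (c₁ * N : ℕ) * (h : ℕ) : ℤ) : ℂ) ^ 2 *
        (((-d : ℤ) : ℂ) / (N * (c₁ * N : ℕ))) +
      2 * Real.pi * I * k * ((((i : ℕ) : ℂ) + (c₁ * N : ℕ) * ((h : ℕ) : ℂ)) / (N * (c₁ * N : ℕ))) =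
    Real.pi * I * ((((i : ℕ) + (c₁ * N : ℕ) * (h : ℕ) : ℤ) : ℂ) ^ 2 *
        (((-d : ℤ) : ℂ) / (N * (c₁ * N : ℕ))) +
      2 * k * ((((i : ℕ) : ℂ) + (c₁ * N : ℕ) * ((h : ℕ) : ℂ)) / (N * (c₁ * N : ℕ)))) := by ring
  rw [e1, e2]
  apply exp_pi_I_eq_of_sub_even (-(d * M * (h : ℕ) ^ 2))
  push_cast
  field_simp
  linear_combination (-(d * (h : ℕ) ^ 2 * c₁ * N ^ 2 : ℂ)) * hM'

/-- Since `d ≡ η = ±1`, only the indices `i ≡ ηk` modulo `N` contribute, and there oddness gives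
`ψ(i) = ηψ(k)`. Writing `i = ak + N(j+s)` and using `ad - bc = 1`, the exponent splits into
`-d(j+s)²/c₁`, which sums to a Gauss sum, and `ak²/(Nc)`, which is the new twist. -/
theorem dft_twist [NeZero N] (hc₁ : 0 < c₁) (hc₁e : Even c₁)
    (hψ : Function.Periodic ψ (N : ℤ)) (ho : ∀ n, ψ (-n) = -ψ n)
    (hdet : a * d - b * (c₁ * N) = 1) (hb : (2 * N : ℤ) ∣ b) (hη : η = 1 ∨ η = -1)
    (hd : (N : ℤ) ∣ d - η) (ha : (N : ℤ) ∣ a - η) (k : ℤ) :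
    dft (N * (c₁ * N)) (twist ψ (((-d : ℤ) : ℂ) / (N * (c₁ * N : ℕ)))) k =
      (N * quadSum (-d) c₁ * η) * twist ψ ((a : ℂ) / (N * (c₁ * N : ℕ))) k := by
  have hN : (N : ℤ) ≠ 0 := by exact_mod_cast NeZero.ne N
  have hNpos : (0 : ℤ) < N := by have := Nat.pos_of_ne_zero (NeZero.ne N); exact_mod_cast this
  have hN' : (N : ℂ) ≠ 0 := by exact_mod_cast NeZero.ne N
  have hc' : (c₁ : ℂ) ≠ 0 := by exact_mod_cast hc₁.ne'
  have hηη : η * η = 1 := by rcases hη with rfl | rfl <;> norm_num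
  have hval : ∀ (j : Fin c₁) (r : Fin N),
      ((finProdFinEquiv (j, r) : Fin (c₁ * N)) : ℕ) = r + N * (j : ℕ) := fun _ _ => rfl
  rw [dft_twist_eq_sum hc₁ hc₁e hψ d k, ← finProdFinEquiv.sum_comp, Fintype.sum_prod_type,
    Finset.sum_comm]
  simp only [hval]
  -- the residue class which contributes
  set r : Fin N := ⟨((η * k) % N).toNat, by
    have := Int.emod_lt_of_pos (η * k) hNpos
    have := Int.emod_nonneg (η * k) hN
    omega⟩ with hr
  have hrv : ((r : ℕ) : ℤ) = (η * k) % N := by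
    rw [hr]; exact Int.toNat_of_nonneg (Int.emod_nonneg _ hN)
  have hrdvd : (N : ℤ) ∣ (r : ℕ) - η * k := by
    rw [hrv, ← dvd_neg, neg_sub]; exact Int.dvd_self_sub_emod
  have hdvd : ∀ (i : ℤ), (N : ℤ) ∣ k - d * i ↔ (N : ℤ) ∣ i - η * k := by
    intro i
    have e : k - d * i = -η * (i - η * k) - (d - η) * i := by linear_combination (-k) * hηη
    rw [e]
    constructor
    · intro h
      have h1 := (dvd_sub_left (hd.mul_right i)).mp h
      have h2 := h1.mul_left (-η)
      have e2 : -η * (-η * (i - η * k)) = i - η * k := by linear_combination (i - η * k) * hηη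
      rwa [e2] at h2
    · intro h
      exact dvd_sub (h.mul_left _) (hd.mul_right i)
  rw [Finset.sum_eq_single r]
  rotate_left
  · intro r' _ hne
    refine Finset.sum_eq_zero fun j _ => ?_
    rw [if_neg, zero_mul]
    rw [hdvd]
    intro h
    apply hne
    have h3 : (N : ℤ) ∣ (r' : ℕ) - (r : ℕ) := by
      have := dvd_sub h hrdvd
      have e : ((((r' : ℕ) + N * (j : ℕ) : ℕ) : ℤ) - η * k) - ((r : ℕ) - η * k) =
        ((r' : ℕ) - (r : ℕ)) + N * (j : ℕ) := by push_cast; ring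
      rw [e] at this
      exact (dvd_add_left (dvd_mul_right _ _)).mp this
    have h4 := r'.isLt
    have h5 := r.isLt
    obtain ⟨q, hq⟩ := h3
    have hq0 : q = 0 := by
      by_contra hq0
      have : (N : ℤ) ≤ |(N : ℤ) * q| := by
        rw [abs_mul, abs_of_pos hNpos]
        nlinarith [Int.one_le_abs hq0]
      rw [← hq] at this
      have h6 : |((r' : ℕ) : ℤ) - (r : ℕ)| < N := by rw [abs_lt]; omega
      omega
    ext
    rw [hq0, mul_zero] at hq
    omega
  · simp
  -- the shift
  obtain ⟨s, hs⟩ : (N : ℤ) ∣ (r : ℕ) - a * k := by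
    have e : ((r : ℕ) : ℤ) - a * k = ((r : ℕ) - η * k) - (a - η) * k := by ring
    rw [e]
    exact dvd_sub hrdvd (ha.mul_right k)
  have hψr : ∀ j : ℕ, ψ (((r : ℕ) + N * j : ℕ) : ℤ) = η * ψ k := by
    intro j
    obtain ⟨q, hq⟩ := hrdvd
    have e : (((r : ℕ) + N * j : ℕ) : ℤ) = η * k + (q + j) * N := by
      push_cast; linear_combination hq
    have := hψ.int_mul (q + j) (η * k)
    rw [e]
    rw [Int.cast_id] at this
    rw [this]
    rcases hη with rfl | rfl
    · simp
    · rw [neg_one_mul, ho]; simp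
  have hq : quadSum (-d) c₁ =
      ∑ j : Fin c₁, (fun n : ℤ => cexp (Real.pi * I * (n : ℂ) ^ 2 * (((-d : ℤ) : ℂ) / c₁)))
        ((j : ℕ) + s) := by
    rw [sum_fin_periodic_add
      (periodic_quad hc₁ (by have : Even (c₁ : ℤ) := by exact_mod_cast hc₁e
                             exact this.mul_left _)) s]
    simp [quadSum]
  rw [hq, Finset.mul_sum, Finset.sum_mul, Finset.sum_mul]
  refine Finset.sum_congr rfl fun j _ => ?_
  rw [if_pos, hψr, twist]
  swap
  · rw [hdvd]
    have e : (((r : ℕ) + N * (j : ℕ) : ℕ) : ℤ) - η * k = ((r : ℕ) - η * k) + N * (j : ℕ) := by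
      push_cast; ring
    rw [e]
    exact dvd_add hrdvd (dvd_mul_right _ _)
  obtain ⟨β, hβ⟩ := hb
  have hdetC : (a : ℂ) * d - b * (c₁ * N) = 1 := by exact_mod_cast hdet
  have hβC : (b : ℂ) = 2 * N * β := by exact_mod_cast hβ
  have hsC : ((r : ℕ) : ℂ) = a * k + N * s := by
    have : ((r : ℕ) : ℤ) = a * k + N * s := by linarith
    exact_mod_cast this
  have key : cexp (Real.pi * I * ((-d * ((((r : ℕ) + N * (j : ℕ) : ℕ)) : ℂ) ^ 2 +
        2 * k * ((((r : ℕ) + N * (j : ℕ) : ℕ)) : ℂ)) / (N * (c₁ * N : ℕ)))) =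
      cexp (Real.pi * I * ((((j : ℕ) + s : ℤ) : ℂ) ^ 2 * (((-d : ℤ) : ℂ) / c₁) +
        (k : ℂ) ^ 2 * ((a : ℂ) / (N * (c₁ * N : ℕ))))) := by
    -- All cross terms carry the factor `ad - 1 = bc`. After division by `Nc` this is `b/N = 2β`, an
    -- even integer.
    apply exp_pi_I_eq_of_sub_even (a * β * k ^ 2 - 2 * β * ((r : ℕ) + N * (j : ℕ)) * k)
    push_cast
    rw [hsC]
    field_simp
    rw [hβC] at hdetC
    linear_combination (-(2 * k * (a * k + N * s + N * (j : ℕ)) : ℂ) + a * k ^ 2) * hdetC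
  rw [key, mul_add, Complex.exp_add]
  simp only [mul_assoc (Real.pi * I : ℂ)]
  ring

end Twist

end

/-! ### Transformation of the odd part under `Γ(8N)` -/

noncomputable section

open Complex
open scoped NumberTheorySymbols

theorem eichler_add (c : ℤ → ℂ) (x₀ x : ℝ) :
    eichler c (x₀ + x) ((x₀ + x : ℝ) : ℂ) = eichler (twist c x₀) x x := by
  refine MeasureTheory.integral_congr_ae (Eventually.of_forall fun y => ?_)
  simp only [eichlerIntegrand]
  rw [← oddTheta_add]
  push_cast
  congr 2 <;> ring

theorem eichler_const_mul (g : ℂ) (c : ℤ → ℂ) (x : ℝ) (w : ℂ) :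
    eichler (fun n => g * c n) x w = g * eichler c x w := by
  rw [eichler, eichler, ← MeasureTheory.integral_const_mul]
  refine MeasureTheory.integral_congr_ae (Eventually.of_forall fun y => ?_)
  simp only [eichlerIntegrand, oddTheta]
  rw [← mul_assoc, ← tsum_mul_left]
  congr 1
  exact tsum_congr fun n => by ring

/-- The radial limit at `x` of `∑_{n ≥ 0} ψ(n) e^{πi n² τ/N}` for odd periodic `ψ`. -/
def oddQuantum (ψ : ℤ → ℂ) (N : ℕ) (x : ℚ) : ℂ :=
  eichler ψ ((x : ℝ) / N) (((x : ℝ) / N : ℝ) : ℂ)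

section Transform

variable {N c₁ : ℕ} {a b d η : ℤ} {ψ : ℤ → ℂ}

/-- With `c = c₁N` and `u = (cx+d)/(cN)` one has `x/N = -d/(Nc) + u` and `γx/N = a/(Nc) -
1/((Nc)²u)`. So `eichler_inversion` at level `Nc` applies to the twist by `-d/(Nc)`, and `dft_twist`
brings back the same `ψ`. -/
theorem oddQuantum_transform [NeZero N] (hN2 : Even N) (hc₁ : 0 < c₁) (hc₁e : Even c₁)
    (hψ : Function.Periodic ψ (N : ℤ)) (ho : ∀ n, ψ (-n) = -ψ n)
    (hdet : a * d - b * (c₁ * N) = 1) (hb : (2 * N : ℤ) ∣ b) (hη : η = 1 ∨ η = -1)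
    (hd : (N : ℤ) ∣ d - η) (ha : (N : ℤ) ∣ a - η) (x : ℚ)
    (hx : ((c₁ * N : ℕ) : ℚ) * x + d ≠ 0) :
    oddQuantum ψ N x + -I * inversionPhase (((c₁ * N : ℕ) * x + d) / ((c₁ * N : ℕ) * N)) /
        ((N * (c₁ * N) : ℕ) * (√|((c₁ * N : ℕ) * x + d) / ((c₁ * N : ℕ) * N)| : ℝ)) *
      ((N * quadSum (-d) c₁ * η) * oddQuantum ψ N ((a * x + b) / ((c₁ * N : ℕ) * x + d))) =
    eichler (twist ψ (((-d : ℤ) : ℂ) / (N * (c₁ * N : ℕ))))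
      (((c₁ * N : ℕ) * x + d) / ((c₁ * N : ℕ) * N)) 0 := by
  have hNpos : 0 < N := Nat.pos_of_ne_zero (NeZero.ne N)
  set c : ℕ := c₁ * N with hc
  have hcpos : 0 < c := Nat.mul_pos hc₁ hNpos
  have : NeZero (N * c) := ⟨(Nat.mul_pos hNpos hcpos).ne'⟩
  have hNR : (N : ℝ) ≠ 0 := by exact_mod_cast hNpos.ne'
  have hcR : (c : ℝ) ≠ 0 := by exact_mod_cast hcpos.ne'
  have hxR : (c : ℝ) * x + d ≠ 0 := by exact_mod_cast hx
  set u : ℝ := (c * x + d) / (c * N) with hu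
  have hu0 : u ≠ 0 := div_ne_zero hxR (mul_ne_zero hcR hNR)
  set φ := twist ψ (((-d : ℤ) : ℂ) / (N * c)) with hφ
  have hφp : Function.Periodic φ ((N * c : ℕ) : ℤ) := twist_quad_periodic hNpos hN2 hψ (-d) hcpos
  have hφo : ∀ n, φ (-n) = -φ n := twist_odd ho _
  have hPpos : 0 < N * c := Nat.mul_pos hNpos hcpos
  have h1 : oddQuantum ψ N x = eichler φ u u := by
    have e : (x : ℝ) / N = (-d : ℝ) / (N * c) + u := by rw [hu]; field_simp; ring
    rw [oddQuantum, e, eichler_add, hφ]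
    push_cast
    rfl
  have e2 : (((a * x + b) / (c * x + d) : ℚ) : ℝ) / N =
      (a : ℝ) / (N * c) + -1 / (((N * c : ℕ) : ℝ) ^ 2 * u) := by
    have hdetR : (a : ℝ) * d - b * c = 1 := by
      rw [hc]; push_cast; exact_mod_cast hdet
    have e3 : (a : ℝ) * x + b = (a * (c * x + d) - 1) / c := by
      field_simp; linear_combination -hdetR
    push_cast
    rw [hu, e3]
    generalize (c : ℝ) * x + d = w at hxR ⊢
    field_simp
    ring
  have h2 : dft (N * c) φ = fun k => (N * quadSum (-d) c₁ * η) * twist ψ ((a : ℂ) / (N * c)) k :=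
    funext fun k => dft_twist hc₁ hc₁e hψ ho hdet hb hη hd ha k
  have h3 : eichler (dft (N * c) φ) (-1 / (((N * c : ℕ) : ℝ) ^ 2 * u))
      ((-1 / (((N * c : ℕ) : ℝ) ^ 2 * u) : ℝ) : ℂ) =
      (N * quadSum (-d) c₁ * η) * oddQuantum ψ N ((a * x + b) / (c * x + d)) := by
    rw [h2, eichler_const_mul, oddQuantum, e2, eichler_add]
    push_cast
    rfl
  rw [h1, ← h3]
  refine eichler_inversion (N * c) hφp hφo hu0 ?_ ?_ ?_
  · have := decaysAt_rat hPpos hφp hφo ((c * x + d) / (c * N))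
    rw [hu]
    exact_mod_cast this
  · have := decaysAt_rat hPpos (dft_periodic _ φ) (dft_odd _ hφp hφo)
      (-1 / (((N * c : ℕ) : ℚ) ^ 2 * ((c * x + d) / (c * N))))
    rw [hu]
    exact_mod_cast this
  · exact_mod_cast decaysAt_rat hPpos hφp hφo 0

theorem gaussPhase_neg_mul (hη : η = 1 ∨ η = -1) (hd : (4 : ℤ) ∣ d - η) :
    gaussPhase (-d) = if η = 1 then cexp (-(Real.pi * I / 4)) else cexp (Real.pi * I / 4) := by
  unfold gaussPhase
  rcases hη with rfl | rfl
  · rw [if_neg (by omega), if_pos rfl]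
  · rw [if_pos (by omega), if_neg (by norm_num)]

/-- The condition `d ≡ η` modulo `8N` makes the symbol of `2N` trivial, so `2c₁` may be replaced by
`2c₁ · 2N = 4c`, that is, by `c = c₁N`. It also fixes `d` modulo `4`, hence the eighth root of
unity. -/
theorem quadSum_neg_eq (hN : 0 < N) (hc₁ : 0 < c₁) (hc₁e : Even c₁) (hη : η = 1 ∨ η = -1)
    (hd : (8 * N : ℤ) ∣ d - η) (hdc : IsCoprime d c₁) :
    quadSum (-d) c₁ = (J((c₁ * N : ℕ) | d.natAbs) : ℂ) * (√(c₁ : ℝ) : ℝ) *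
      if η = 1 then cexp (-(Real.pi * I / 4)) else cexp (Real.pi * I / 4) := by
  have h4 : (4 : ℤ) ∣ d - η := (Dvd.intro (2 * N : ℤ) (by ring)).trans hd
  have hodd : Odd d := by
    rw [Int.odd_iff]; rcases hη with rfl | rfl <;> omega
  rw [quadSum_even hc₁ hc₁e hodd.neg hdc.neg_left, Int.natAbs_neg, gaussPhase_neg_mul hη h4]
  congr 3
  have hηodd : Odd η := by rcases hη with rfl | rfl <;> decide
  have h1 : J((2 * N : ℕ) | d.natAbs) = 1 := by
    rw [jacobiSym_natAbs_congr (d' := η) (by omega) hodd ?_]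
    · rcases hη with rfl | rfl <;> simp
    · exact (Int.modEq_iff_dvd.mpr (by push_cast; convert hd using 1; ring)).symm
  have h2 : J(2 * c₁ | d.natAbs) * J((2 * N : ℕ) | d.natAbs) =
      J((c₁ * N : ℕ) | d.natAbs) := by
    rw [← jacobiSym.mul_left]
    have : (2 * (c₁ : ℤ)) * (2 * N : ℕ) = 4 * (c₁ * N : ℕ) := by push_cast; ring
    rw [this, jacobiSym.mul_left, jacobiSym.at_four (Int.natAbs_odd.mpr hodd), one_mul]
  rw [← h2, h1, mul_one]

theorem sqrt_factor (hN : 0 < N) (hc₁ : 0 < c₁) {w : ℝ} (hw : w ≠ 0) :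
    (N * √(c₁ : ℝ)) / ((N * (c₁ * N) : ℕ) * √|w / ((c₁ * N : ℕ) * N)|) = 1 / √|w| := by
  have hNR : (0 : ℝ) < N := by exact_mod_cast hN
  have hcR : (0 : ℝ) < c₁ := by exact_mod_cast hc₁
  have hs := Real.sqrt_pos.mpr hcR
  have hw' := Real.sqrt_pos.mpr (abs_pos.mpr hw)
  have e : |w / ((c₁ * N : ℕ) * N)| = |w| / ((N : ℝ) ^ 2 * c₁) := by
    push_cast
    rw [abs_div, abs_of_pos (show (0 : ℝ) < c₁ * N * N by positivity)]
    congr 1; ring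
  rw [e, Real.sqrt_div (abs_nonneg _), Real.sqrt_mul (by positivity), Real.sqrt_sq hNR.le]
  push_cast
  field_simp
  rw [Real.sq_sqrt hcR.le]

/-- The transformation of `oddQuantum` with an explicit automorphy factor. -/
theorem oddQuantum_transform_explicit [NeZero N] (hN2 : Even N) (hc₁ : 0 < c₁) (hc₁e : Even c₁)
    (hψ : Function.Periodic ψ (N : ℤ)) (ho : ∀ n, ψ (-n) = -ψ n)
    (hdet : a * d - b * (c₁ * N) = 1) (hb : (2 * N : ℤ) ∣ b) (hη : η = 1 ∨ η = -1)
    (hd : (8 * N : ℤ) ∣ d - η) (ha : (N : ℤ) ∣ a - η) (x : ℚ)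
    (hx : ((c₁ * N : ℕ) : ℚ) * x + d ≠ 0) :
    oddQuantum ψ N x - η * I * (inversionPhase (((c₁ * N : ℕ) * x + d) / ((c₁ * N : ℕ) * N)) *
        (if η = 1 then cexp (-(Real.pi * I / 4)) else cexp (Real.pi * I / 4))) *
      ((J((c₁ * N : ℕ) | d.natAbs) : ℂ) / (√|((c₁ * N : ℕ) : ℝ) * x + d| : ℝ)) *
        oddQuantum ψ N ((a * x + b) / ((c₁ * N : ℕ) * x + d)) =
    eichler (twist ψ (((-d : ℤ) : ℂ) / (N * (c₁ * N : ℕ))))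
      (((c₁ * N : ℕ) * x + d) / ((c₁ * N : ℕ) * N)) 0 := by
  have hNpos : 0 < N := Nat.pos_of_ne_zero (NeZero.ne N)
  have hxR : ((c₁ * N : ℕ) : ℝ) * x + d ≠ 0 := by exact_mod_cast hx
  have hdN : (N : ℤ) ∣ d - η := (Dvd.intro_left (8 : ℤ) rfl).trans hd
  have hdc : IsCoprime d (c₁ : ℤ) := ⟨a, -(b * N), by linear_combination hdet⟩
  rw [← oddQuantum_transform hN2 hc₁ hc₁e hψ ho hdet hb hη hdN ha x hx,
    quadSum_neg_eq hNpos hc₁ hc₁e hη hd hdc, sub_eq_add_neg]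
  congr 1
  have hs : ((N : ℂ) * (√(c₁ : ℝ) : ℝ)) / ((N * (c₁ * N) : ℕ) *
      (√|(((c₁ * N : ℕ) : ℝ) * x + d) / ((c₁ * N : ℕ) * N)| : ℝ)) =
      1 / (√|((c₁ * N : ℕ) : ℝ) * x + d| : ℝ) := by
    exact_mod_cast sqrt_factor hNpos hc₁ hxR
  generalize inversionPhase _ = σ
  generalize oddQuantum ψ N _ = Q
  generalize (if η = 1 then cexp (-(Real.pi * I / 4)) else cexp (Real.pi * I / 4)) = ρ
  rw [div_eq_mul_one_div ((J((c₁ * N : ℕ) | d.natAbs) : ℂ)), ← hs]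
  ring

end Transform

theorem exp_quarter_mul_inv : cexp (Real.pi * I / 4) * cexp (-(Real.pi * I / 4)) = 1 := by
  rw [← Complex.exp_add]; simp

theorem exp_neg_quarter_mul_self :
    cexp (-(Real.pi * I / 4)) * cexp (-(Real.pi * I / 4)) = -I := by
  have h := congrArg (starRingEnd ℂ) exp_quarter_mul_self
  rwa [map_mul, conj_exp_quarter, Complex.conj_I] at h

/-- The cocycle of `oddQuantum` for `γ` with lower left entry not equal to `0`. -/
theorem oddQuantum_cocycle {N : ℕ} (hN : 0 < N) (hN2 : Even N) {ψ : ℤ → ℂ}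
    (hψ : Function.Periodic ψ (N : ℤ)) (ho : ∀ n, ψ (-n) = -ψ n)
    {γ : Matrix.SpecialLinearGroup (Fin 2) ℤ} (hγ : γ ∈ CongruenceSubgroup.Gamma (8 * N))
    (hc : γ 1 0 ≠ 0) (x : ℚ) (hx : (γ 1 0 : ℚ) * x + γ 1 1 ≠ 0) :
    oddQuantum ψ N x - slashHalf (oddQuantum ψ N) γ x =
      eichler (twist ψ (((-γ 1 1 : ℤ) : ℂ) / (N * γ 1 0)))
        ((γ 1 0 * x + γ 1 1) / (γ 1 0 * N)) 0 := by
  have : NeZero N := ⟨hN.ne'⟩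
  have hNR : (0 : ℝ) < N := by exact_mod_cast hN
  rw [CongruenceSubgroup.Gamma_mem] at hγ
  obtain ⟨ha, hb, hc', hd⟩ := hγ
  have hdet : γ 0 0 * γ 1 1 - γ 0 1 * γ 1 0 = 1 := by
    have := γ.det_coe; rwa [Matrix.det_fin_two] at this
  rw [slashHalf, moebiusRat, boundarySqrt, thetaSymbol]
  generalize γ 0 0 = a at *
  generalize γ 0 1 = b at *
  generalize γ 1 0 = c at *
  generalize γ 1 1 = d at *
  have ha8 : ((8 * N : ℕ) : ℤ) ∣ a - 1 := by
    rw [← ZMod.intCast_zmod_eq_zero_iff_dvd]; push_cast; rw [ha]; simp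
  have hd8 : ((8 * N : ℕ) : ℤ) ∣ d - 1 := by
    rw [← ZMod.intCast_zmod_eq_zero_iff_dvd]; push_cast; rw [hd]; simp
  have hb8 : ((8 * N : ℕ) : ℤ) ∣ b := (ZMod.intCast_zmod_eq_zero_iff_dvd _ _).mp hb
  have hc8 : ((8 * N : ℕ) : ℤ) ∣ c := (ZMod.intCast_zmod_eq_zero_iff_dvd _ _).mp hc'
  push_cast at ha8 hd8 hb8 hc8
  have h2N : (2 * N : ℤ) ∣ 8 * N := ⟨4, by ring⟩
  have hN8 : (N : ℤ) ∣ 8 * N := ⟨8, by ring⟩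
  have hd4 : (4 : ℤ) ∣ d - 1 := (Dvd.intro (2 * N : ℤ) (by ring)).trans hd8
  have hdodd : Odd d.natAbs := by rw [Int.natAbs_odd, Int.odd_iff]; omega
  have hxR : (c : ℝ) * x + d ≠ 0 := by exact_mod_cast hx
  obtain ⟨q, hq⟩ := hc8
  rcases lt_or_gt_of_ne hc with hneg | hpos
  · -- negative lower left entry: pass to `-γ`
    obtain ⟨c₁, hc₁⟩ : ∃ c₁ : ℕ, -8 * q = c₁ :=
      Int.eq_ofNat_of_zero_le (by by_contra h; push Not at h; nlinarith)
    have hcc : c = -((c₁ * N : ℕ) : ℤ) := by push_cast; rw [hq, ← hc₁]; ring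
    have hc₁pos : 0 < c₁ := by
      rcases Nat.eq_zero_or_pos c₁ with h | h
      · rw [h] at hcc; simp at hcc; exact absurd hcc hc
      · exact h
    have hc₁e : Even c₁ := by
      have : Even (c₁ : ℤ) := ⟨-4 * q, by rw [← hc₁]; ring⟩
      exact_mod_cast this
    have hcQ : (c : ℚ) = -((c₁ * N : ℕ) : ℚ) := by rw [hcc]; push_cast; ring
    have hcR : (c : ℝ) = -((c₁ * N : ℕ) : ℝ) := by rw [hcc]; push_cast; ring
    have hcC : (c : ℂ) = -((c₁ * N : ℕ) : ℂ) := by rw [hcc]; push_cast; ring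
    -- `-γ` has the same Möbius action and a positive lower left entry; its diagonal is `-1` modulo
    -- `8N`, whence `η = -1`.
    have key := oddQuantum_transform_explicit (a := -a) (b := -b) (d := -d) (η := -1) hN2 hc₁pos
      hc₁e hψ ho (by rw [hcc] at hdet; push_cast at hdet; linear_combination hdet)
      ((h2N.trans hb8).neg_right) (Or.inr rfl)
      (by obtain ⟨t, ht⟩ := hd8; exact ⟨-t, by linear_combination -ht⟩)
      (by obtain ⟨t, ht⟩ := hN8.trans ha8; exact ⟨-t, by linear_combination -ht⟩) x
      (by rw [hcQ] at hx; push_cast at hx ⊢; intro h; apply hx; linarith)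
    set w : ℝ := c * x + d with hw
    have hwneg : ((c₁ * N : ℕ) : ℝ) * x + ((-d : ℤ) : ℝ) = -w := by
      rw [hw, hcR]; push_cast; ring
    have hwnegQ : ((c₁ * N : ℕ) : ℚ) * x + ((-d : ℤ) : ℚ) = -(c * x + d) := by
      rw [hcQ]; push_cast; ring
    have hmoeb : (((-a : ℤ) : ℚ) * x + ((-b : ℤ) : ℚ)) / -(c * x + d) =
        (a * x + b) / (c * x + d) := by
      rw [div_neg, ← neg_div]; congr 1; push_cast; ring
    have hu : -w / (((c₁ * N : ℕ) : ℝ) * N) = w / (c * N) := by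
      rw [hcR, neg_mul, div_neg, neg_div]
    have htw : (((- -d : ℤ) : ℂ) / (N * (c₁ * N : ℕ))) = ((-d : ℤ) : ℂ) / (N * c) := by
      rw [hcC]; push_cast; rw [mul_neg, div_neg, neg_div]
    rw [hwneg, hwnegQ, hmoeb, hu, htw, abs_neg, Int.natAbs_neg, if_neg (by norm_num)] at key
    rw [← key]
    congr 2
    -- Passing from `c` to `-c` costs `χ₄(|d|)`. As `d ≡ 1` modulo `4`, this is `-1` exactly for `d
    -- < 0`, which is the extra sign in the convention for the symbol.
    have hJ : (if c < 0 ∧ d < 0 then -J(c | d.natAbs) else J(c | d.natAbs)) =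
        J((c₁ * N : ℕ) | d.natAbs) := by
      rw [hcc, jacobiSym.neg _ hdodd]
      split_ifs with h
      · rw [ZMod.χ₄_nat_three_mod_four (by omega)]; ring
      · rw [ZMod.χ₄_nat_one_mod_four (by rw [← hcc] at h; omega)]; ring
    rw [hJ]
    generalize J((c₁ * N : ℕ) | d.natAbs) = j
    have hcN : (c : ℝ) * N < 0 := by
      have : (c : ℝ) < 0 := by exact_mod_cast hneg
      nlinarith
    unfold inversionPhase
    by_cases hw0 : 0 ≤ w
    · have hw1 : 0 < w := lt_of_le_of_ne hw0 hxR.symm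
      rw [if_pos hw0, if_neg (not_lt.mpr (div_neg_of_pos_of_neg hw1 hcN).le),
        exp_quarter_mul_self, abs_of_pos hw1]
      push_cast
      linear_combination ((j : ℂ) / (√w : ℝ)) * Complex.I_mul_I
    · have hw1 : w < 0 := not_le.mp hw0
      rw [if_neg hw0, if_neg (by omega), if_pos (div_pos_of_neg_of_neg hw1 hcN), mul_comm (cexp _),
        exp_quarter_mul_inv, abs_of_neg hw1, mul_inv, Complex.inv_I]
      push_cast
      ring
  · obtain ⟨c₁, hc₁⟩ : ∃ c₁ : ℕ, 8 * q = c₁ :=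
      Int.eq_ofNat_of_zero_le (by by_contra h; push Not at h; nlinarith)
    have hcc : c = ((c₁ * N : ℕ) : ℤ) := by push_cast; rw [hq, ← hc₁]; ring
    have hc₁pos : 0 < c₁ := by
      rcases Nat.eq_zero_or_pos c₁ with h | h
      · rw [h] at hcc; simp at hcc; exact absurd hcc hc
      · exact h
    have hc₁e : Even c₁ := by
      have : Even (c₁ : ℤ) := ⟨4 * q, by rw [← hc₁]; ring⟩
      exact_mod_cast this
    have hcQ : ((c₁ * N : ℕ) : ℚ) = c := by rw [hcc]; push_cast; ring
    have hcR : ((c₁ * N : ℕ) : ℝ) = c := by rw [hcc]; push_cast; ring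
    have hcC : ((c₁ * N : ℕ) : ℂ) = c := by rw [hcc]; push_cast; ring
    have key := oddQuantum_transform_explicit (a := a) (b := b) (d := d) (η := 1) hN2 hc₁pos
      hc₁e hψ ho (by rw [hcc] at hdet; push_cast at hdet; linear_combination hdet)
      (h2N.trans hb8) (Or.inl rfl) hd8 (hN8.trans ha8) x (by rw [hcQ]; exact hx)
    rw [hcR, hcQ, hcC, if_pos rfl, ← hcc] at key
    rw [← key]
    congr 2
    rw [if_neg (by omega)]
    have hcN : 0 < (c : ℝ) * N := by
      have : (0 : ℝ) < c := by exact_mod_cast hpos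
      positivity
    set w : ℝ := c * x + d with hw
    unfold inversionPhase
    by_cases hw0 : 0 ≤ w
    · have hw1 : 0 < w := lt_of_le_of_ne hw0 hxR.symm
      rw [if_pos hw0, if_pos (div_pos hw1 hcN), exp_neg_quarter_mul_self, abs_of_pos hw1]
      push_cast
      linear_combination ((J(c | d.natAbs) : ℂ) / (√w : ℝ)) * Complex.I_mul_I
    · have hw1 : w < 0 := not_le.mp hw0
      rw [if_neg hw0, if_pos hpos, if_neg (not_lt.mpr (div_neg_of_neg_of_pos hw1 hcN).le),
        exp_quarter_mul_inv, abs_of_neg hw1, mul_inv, inv_neg, Complex.inv_I]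
      push_cast
      ring

end

/-! ### Analytic cocycles and the quantum modular form -/

noncomputable section

open Complex

theorem analyticAt_sqrt {y : ℝ} (hy : 0 < y) : AnalyticAt ℝ Real.sqrt y := by
  have h : AnalyticAt ℝ (fun z : ℝ => Real.exp (Real.log z * (1 / 2))) y :=
    ((analyticAt_log hy).mul analyticAt_const).rexp'
  refine h.congr ?_
  filter_upwards [lt_mem_nhds hy] with z hz
  rw [Real.sqrt_eq_rpow, Real.rpow_def_of_pos hz]

theorem analyticAt_boundarySqrt (c d : ℤ) {x : ℝ} (hx : (c : ℝ) * x + d ≠ 0) :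
    AnalyticAt ℝ (boundarySqrt c d) x := by
  have hlin : AnalyticAt ℝ (fun y : ℝ => (c : ℝ) * y + d) x :=
    (analyticAt_const.mul analyticAt_id).add analyticAt_const
  have hcont : ContinuousAt (fun y : ℝ => (c : ℝ) * y + d) x := hlin.continuousAt
  rcases lt_or_gt_of_ne hx with h | h
  · have h' : 0 < -((c : ℝ) * x + d) := by linarith
    have hs : AnalyticAt ℝ (fun y : ℝ => ((√(-((c : ℝ) * y + d)) : ℝ) : ℂ)) x :=
      (Complex.ofRealCLM.analyticAt _).comp (AnalyticAt.comp (g := Real.sqrt)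
        (f := fun y : ℝ => -((c : ℝ) * y + d)) (analyticAt_sqrt h') hlin.neg)
    refine ((analyticAt_const (v := if 0 < c then -I else I)).mul hs).congr ?_
    filter_upwards [hcont.eventually (gt_mem_nhds h)] with y hy
    simp only [boundarySqrt]
    rw [if_neg (not_le.mpr hy)]
    split_ifs <;> rfl
  · have hs : AnalyticAt ℝ (fun y : ℝ => ((√((c : ℝ) * y + d) : ℝ) : ℂ)) x :=
      (Complex.ofRealCLM.analyticAt _).comp (AnalyticAt.comp (g := Real.sqrt)
        (f := fun y : ℝ => (c : ℝ) * y + d) (analyticAt_sqrt h) hlin)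
    refine hs.congr ?_
    filter_upwards [hcont.eventually (lt_mem_nhds h)] with y hy
    simp only [boundarySqrt]
    rw [if_pos hy.le]

theorem boundarySqrt_ne_zero (c d : ℤ) {x : ℝ} (hx : (c : ℝ) * x + d ≠ 0) :
    boundarySqrt c d x ≠ 0 := by
  unfold boundarySqrt
  split_ifs with h1 h2
  · have := Real.sqrt_pos.mpr (lt_of_le_of_ne h1 hx.symm)
    exact_mod_cast this.ne'
  all_goals
    have := Real.sqrt_pos.mpr (show 0 < -((c : ℝ) * x + d) by linarith [not_le.mp h1])
    refine mul_ne_zero (by simp) (by exact_mod_cast this.ne')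

/-- The cocycle of the restriction to `ℝ` of an entire function is real-analytic. -/
theorem analyticOnNhd_cocycle_of_differentiable {g : ℂ → ℂ} (hg : Differentiable ℂ g)
    (s : ℂ) (a b c d : ℤ) :
    AnalyticOnNhd ℝ (fun x : ℝ => g x - s * (boundarySqrt c d x)⁻¹ *
      g (((a * x + b) / (c * x + d) : ℝ) : ℂ)) {x : ℝ | (c : ℝ) * x + d ≠ 0} := by
  have hgR : ∀ y : ℝ, AnalyticAt ℝ (fun y : ℝ => g y) y := fun y =>
    ((hg.analyticAt (y : ℂ)).restrictScalars (𝕜 := ℝ)).comp (Complex.ofRealCLM.analyticAt y)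
  intro x hx
  have hlin : ∀ p q : ℤ, AnalyticAt ℝ (fun y : ℝ => (p : ℝ) * y + q) x := fun p q =>
    (analyticAt_const.mul analyticAt_id).add analyticAt_const
  refine (hgR x).sub ((analyticAt_const.mul
    ((analyticAt_boundarySqrt c d hx).inv (boundarySqrt_ne_zero c d hx))).mul ?_)
  exact AnalyticAt.comp (g := fun y : ℝ => g y)
    (f := fun x : ℝ => ((a : ℝ) * x + b) / ((c : ℝ) * x + d)) (hgR _)
    ((hlin a b).div (hlin c d) hx)

theorem twist_eq_self {c : ℤ → ℂ} {N : ℕ} (hN : 0 < N) {b : ℤ} (hb : (2 * N : ℤ) ∣ b) :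
    twist c ((b : ℂ) / N) = c := by
  obtain ⟨k, rfl⟩ := hb
  have hN' : (N : ℂ) ≠ 0 := by exact_mod_cast hN.ne'
  ext n
  rw [twist]
  have h := exp_pi_I_eq_of_sub_even (x := (n : ℂ) ^ 2 * (((2 * N * k : ℤ) : ℂ) / N)) (y := 0)
    (n ^ 2 * k) (by push_cast; field_simp; ring)
  rw [mul_assoc, h, mul_zero, Complex.exp_zero, mul_one]

theorem oddQuantum_add {N : ℕ} (hN : 0 < N) (ψ : ℤ → ℂ) {b : ℤ} (hb : (2 * N : ℤ) ∣ b)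
    (x : ℚ) : oddQuantum ψ N (x + b) = oddQuantum ψ N x := by
  have e : ((x + b : ℚ) : ℝ) / N = (b : ℝ) / N + (x : ℝ) / N := by push_cast; ring
  have h := twist_eq_self (c := ψ) hN hb
  rw [oddQuantum, e, eichler_add]
  push_cast
  rw [h, oddQuantum]
  push_cast
  rfl

/-- The alternative `a = d = -1` is excluded because `-1 ≢ 1` modulo `8`; only translations remain.
-/
theorem gamma_diagonal_of_zero {N : ℕ} {γ : Matrix.SpecialLinearGroup (Fin 2) ℤ}
    (hγ : γ ∈ CongruenceSubgroup.Gamma (8 * N)) (hc : γ 1 0 = 0) : γ 0 0 = 1 ∧ γ 1 1 = 1 := by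
  rw [CongruenceSubgroup.Gamma_mem] at hγ
  obtain ⟨-, -, -, hd⟩ := hγ
  have hdet : γ 0 0 * γ 1 1 - γ 0 1 * γ 1 0 = 1 := by
    have := γ.det_coe; rwa [Matrix.det_fin_two] at this
  rw [hc, mul_zero, sub_zero] at hdet
  have hd8 : ((8 * N : ℕ) : ℤ) ∣ γ 1 1 - 1 := by
    rw [← ZMod.intCast_zmod_eq_zero_iff_dvd]; push_cast at hd ⊢; rw [hd]; simp
  have h8 : (8 : ℤ) ∣ γ 1 1 - 1 := (Dvd.intro (N : ℤ) (by push_cast; ring)).trans hd8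
  rcases Int.eq_one_or_neg_one_of_mul_eq_one' hdet with h | h
  · exact h
  · omega

/-- The cocycles of `oddQuantum` are real-analytic except at one point. -/
theorem oddQuantum_cocycle_analytic {N : ℕ} (hN : 0 < N) (hN2 : Even N) {ψ : ℤ → ℂ}
    (hψ : Function.Periodic ψ (N : ℤ)) (ho : ∀ n, ψ (-n) = -ψ n)
    {γ : Matrix.SpecialLinearGroup (Fin 2) ℤ} (hγ : γ ∈ CongruenceSubgroup.Gamma (8 * N)) :
    ∃ R : ℝ → ℂ, AnalyticOnNhd ℝ R {x : ℝ | (γ 1 0 : ℝ) * x + γ 1 1 ≠ 0} ∧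
      ∀ x : ℚ, (γ 1 0 : ℚ) * x + γ 1 1 ≠ 0 →
        oddQuantum ψ N x - slashHalf (oddQuantum ψ N) γ x = R x := by
  by_cases hc : γ 1 0 = 0
  -- Here `γ` is a translation by a multiple of `2N`, under which the function is invariant, so the
  -- cocycle is zero.
  · refine ⟨fun _ => 0, fun _ _ => analyticAt_const, fun x _ => ?_⟩
    obtain ⟨ha, hd⟩ := gamma_diagonal_of_zero hγ hc
    rw [CongruenceSubgroup.Gamma_mem] at hγ
    have hb : (2 * N : ℤ) ∣ γ 0 1 := by
      have := (ZMod.intCast_zmod_eq_zero_iff_dvd _ _).mp hγ.2.1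
      exact (Dvd.intro (4 : ℤ) (by push_cast; ring)).trans this
    have h1 : slashHalf (oddQuantum ψ N) γ x = oddQuantum ψ N (x + γ 0 1) := by
      rw [slashHalf, moebiusRat, hc, hd, ha, thetaSymbol, boundarySqrt]
      simp
    rw [h1, oddQuantum_add hN ψ hb, sub_self]
  · refine ⟨fun x => eichler (twist ψ (((-γ 1 1 : ℤ) : ℂ) / (N * γ 1 0)))
        ((γ 1 0 * x + γ 1 1) / (γ 1 0 * N)) 0, fun x hx => ?_,
      fun x hx => oddQuantum_cocycle hN hN2 hψ ho hγ hc x hx⟩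
    have hcR : (γ 1 0 : ℝ) ≠ 0 := by exact_mod_cast hc
    have hNR : (N : ℝ) ≠ 0 := by exact_mod_cast hN.ne'
    have hden : 0 < 2 * N * (((-γ 1 1 : ℤ) : ℚ) / (N * γ 1 0)).den := by
      have := (((-γ 1 1 : ℤ) : ℚ) / (N * γ 1 0)).den_pos
      positivity
    have hper := twist_periodic hψ (((-γ 1 1 : ℤ) : ℚ) / (N * γ 1 0))
    have hodd := twist_odd ho ((((-γ 1 1 : ℤ) : ℚ) / (N * γ 1 0) : ℚ) : ℂ)
    have hdec := decaysAt_rat hden hper hodd 0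
    obtain ⟨C, -, hC⟩ := exists_bound_of_periodic hden hper
    push_cast at hC hdec ⊢
    have hlin : AnalyticAt ℝ
        (fun y : ℝ => ((γ 1 0 : ℝ) * y + γ 1 1) / ((γ 1 0 : ℝ) * N)) x :=
      ((analyticAt_const.mul analyticAt_id).add analyticAt_const).div analyticAt_const
        (mul_ne_zero hcR hNR)
    exact AnalyticAt.comp (g := fun u : ℝ => eichler
        (twist ψ ((-(γ 1 1 : ℂ)) / (N * (γ 1 0 : ℂ)))) u 0)
      (f := fun y : ℝ => ((γ 1 0 : ℝ) * y + γ 1 1) / ((γ 1 0 : ℝ) * N))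
      (analyticOnNhd_eichler_zero hC (by simpa using hdec) _
        (div_ne_zero hx (mul_ne_zero hcR hNR))) hlin

theorem slashHalf_add (f g : ℚ → ℂ) (γ : Matrix.SpecialLinearGroup (Fin 2) ℤ) (x : ℚ) :
    slashHalf (fun y => f y + g y) γ x = slashHalf f γ x + slashHalf g γ x := by
  simp only [slashHalf]; ring

/-- The sum of `oddQuantum` and the restriction of an entire function is a quantum modular form. -/
theorem isQuantumModularFormHalf_oddQuantum_add {N : ℕ} (hN : 0 < N) (hN2 : Even N) {ψ : ℤ → ℂ}
    (hψ : Function.Periodic ψ (N : ℤ)) (ho : ∀ n, ψ (-n) = -ψ n) {g : ℂ → ℂ}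
    (hg : Differentiable ℂ g) :
    IsQuantumModularFormHalf (CongruenceSubgroup.Gamma (8 * N)) Set.univ
      (fun x : ℚ => oddQuantum ψ N x + g (x : ℂ)) where
  isCongruenceSubgroup := ⟨8 * N, by omega, le_rfl⟩
  le_gamma1 γ hγ := by
    rw [CongruenceSubgroup.Gamma_mem] at hγ
    rw [CongruenceSubgroup.Gamma1_mem]
    obtain ⟨ha, -, hc, hd⟩ := hγ
    have h4 : 4 ∣ 8 * N := ⟨2 * N, by ring⟩
    have ha' := congrArg (ZMod.castHom h4 (ZMod 4)) ha
    have hd' := congrArg (ZMod.castHom h4 (ZMod 4)) hd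
    have hc' := congrArg (ZMod.castHom h4 (ZMod 4)) hc
    rw [map_intCast, map_one] at ha' hd'
    rw [map_intCast, map_zero] at hc'
    exact ⟨ha', hd', hc'⟩
  cofinite := by simp
  cocycle γ hγ := by
    obtain ⟨R, hR, hRx⟩ := oddQuantum_cocycle_analytic hN hN2 hψ ho hγ
    refine ⟨fun x => R x + (g x - thetaSymbol (γ 1 0) (γ 1 1) * (boundarySqrt (γ 1 0) (γ 1 1) x)⁻¹ *
      g (((γ 0 0 * x + γ 0 1) / (γ 1 0 * x + γ 1 1) : ℝ) : ℂ)),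
      hR.add (analyticOnNhd_cocycle_of_differentiable hg _ _ _ _ _), fun x _ hx _ => ?_⟩
    beta_reduce
    rw [← hRx x hx, slashHalf_add]
    have : slashHalf (fun y : ℚ => g (y : ℂ)) γ x = thetaSymbol (γ 1 0) (γ 1 1) *
        (boundarySqrt (γ 1 0) (γ 1 1) x)⁻¹ *
          g ((((γ 0 0 : ℝ) * x + γ 0 1) / ((γ 1 0 : ℝ) * x + γ 1 1) : ℝ) : ℂ) := by
      simp only [slashHalf, moebiusRat]
      push_cast
      rfl
    rw [this]
    push_cast
    ring

/-! ### Radial values of one-sided theta series -/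

/-- A theta series with periodic coefficients has radial value `0` at `0`. -/
theorem tendsto_fullTheta_radial {c : ℤ → ℂ} {P : ℕ} [NeZero P]
    (hc : Function.Periodic c (P : ℤ)) :
    Tendsto (fun t : ℝ => fullTheta c (t * I) - dft P c 0 / P * ((√t : ℝ) : ℂ)⁻¹) (𝓝[>] 0)
      (𝓝 0) := by
  have hP0 : 0 < P := Nat.pos_of_ne_zero (NeZero.ne P)
  have hPR : (0 : ℝ) < P := by exact_mod_cast hP0
  have hP : (P : ℂ) ≠ 0 := by exact_mod_cast NeZero.ne P
  obtain ⟨C, -, hC⟩ := exists_bound_of_periodic hP0 (dft_periodic P c)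
  obtain ⟨K, hK⟩ := exists_fullTheta_sub_le hC
  set k : ℝ := Real.pi * ((P : ℝ) ^ 2)⁻¹ with hk
  have hk0 : 0 < k := by have := Real.pi_pos; positivity
  have hKnn : 0 ≤ K := by
    have := (norm_nonneg _).trans (hK I (by simp))
    exact nonneg_of_mul_nonneg_left this (Real.exp_pos _)
  have hlim : Tendsto (fun t : ℝ => K / (P * k) * √t) (𝓝[>] 0) (𝓝 (K / (P * k) * √0)) :=
    ((Real.continuous_sqrt.tendsto 0).mono_left nhdsWithin_le_nhds).const_mul _
  rw [Real.sqrt_zero, mul_zero] at hlim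
  have hv : Tendsto (fun t : ℝ => ((P : ℝ) ^ 2)⁻¹ * t⁻¹) (𝓝[>] 0) atTop :=
    tendsto_inv_nhdsGT_zero.const_mul_atTop (by positivity)
  rw [tendsto_zero_iff_norm_tendsto_zero]
  refine squeeze_zero' (Eventually.of_forall fun _ => norm_nonneg _) ?_ hlim
  filter_upwards [self_mem_nhdsWithin, hv.eventually_ge_atTop 1] with t (ht : 0 < t) ht1
  have him : 0 < ((t : ℂ) * I).im := by simpa using ht
  have hIt : -I * ((t : ℂ) * I) = t := by linear_combination (-(t : ℂ)) * Complex.I_mul_I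
  have hs : 0 < √t := Real.sqrt_pos.mpr ht
  have hsC : ((√t : ℝ) : ℂ) ≠ 0 := by exact_mod_cast hs.ne'
  have h1 := fullTheta_inversion P hc him
  rw [hIt, ofReal_cpow_half ht.le] at h1
  have hvim : (-1 / ((P : ℂ) ^ 2 * (t * I))).im = ((P : ℝ) ^ 2)⁻¹ * t⁻¹ := by
    rw [im_inversion]; simp [Complex.normSq_apply]
  have h2 := hK (-1 / ((P : ℂ) ^ 2 * (t * I))) (by rw [hvim]; exact ht1)
  rw [hvim] at h2
  have h3 : fullTheta c (t * I) - dft P c 0 / P * ((√t : ℝ) : ℂ)⁻¹ =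
      (1 / (P * ((√t : ℝ) : ℂ))) *
        (fullTheta (dft P c) (-1 / ((P : ℂ) ^ 2 * (t * I))) - dft P c 0) := by
    have : fullTheta c (t * I) = 1 / P * fullTheta (dft P c) (-1 / ((P : ℂ) ^ 2 * (t * I))) /
        ((√t : ℝ) : ℂ) := by rw [← h1]; field_simp
    rw [this]
    field_simp
  -- After division by `√t` a linear bound on the exponential still leaves `√t → 0`.
  have h4 : Real.exp (-Real.pi * (((P : ℝ) ^ 2)⁻¹ * t⁻¹)) ≤ t / k := by
    have e : -Real.pi * (((P : ℝ) ^ 2)⁻¹ * t⁻¹) = -(k / t) := by rw [hk]; field_simp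
    have h5 : k / t ≤ Real.exp (k / t) := by linarith [Real.add_one_le_exp (k / t)]
    rw [e, Real.exp_neg]
    refine (inv_anti₀ (by positivity) h5).trans (le_of_eq ?_)
    rw [inv_div]
  rw [h3, norm_mul, norm_div, norm_one, norm_mul, Complex.norm_natCast, Complex.norm_real,
    Real.norm_of_nonneg hs.le]
  calc 1 / (P * √t) * _ ≤ 1 / (P * √t) * (K * (t / k)) := by
        gcongr
        exact h2.trans (by gcongr)
    _ = K / (P * k) * √t := by
        field_simp
        rw [Real.sq_sqrt ht.le]
        ring

/-- The radial value of a one-sided theta series with periodic coefficients. -/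
theorem hasRadialValue_halfTheta {N : ℕ} (hN : 0 < N) {ψ : ℤ → ℂ}
    (hψ : Function.Periodic ψ (N : ℤ)) (x : ℚ) :
    HasRadialValue (fun τ => halfTheta ψ (τ / N)) x
      (oddQuantum (fun n => (ψ n - ψ (-n)) / 2) N x + ψ 0 / 2) := by
  have hNR : (0 : ℝ) < N := by exact_mod_cast hN
  have hNC : (N : ℂ) ≠ 0 := by exact_mod_cast hN.ne'
  set ψo : ℤ → ℂ := fun n => (ψ n - ψ (-n)) / 2 with hψo
  set ψe : ℤ → ℂ := fun n => (ψ n + ψ (-n)) / 2 with hψe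
  have hneg : ∀ n, ψ (-(n + N)) = ψ (-n) := fun n => by
    have := hψ (-(n + N)); rw [← this]; congr 1; ring
  have hop : Function.Periodic ψo (N : ℤ) := fun n => by simp only [hψo]; rw [hψ n, hneg n]
  have hep : Function.Periodic ψe (N : ℤ) := fun n => by simp only [hψe]; rw [hψ n, hneg n]
  have hoo : ∀ n, ψo (-n) = -ψo n := fun n => by simp only [hψo, neg_neg]; ring
  have hee : ∀ n, ψe (-n) = ψe n := fun n => by simp only [hψe, neg_neg]; ring
  obtain ⟨Co, -, hCo⟩ := exists_bound_of_periodic hN hop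
  obtain ⟨Ce, -, hCe⟩ := exists_bound_of_periodic hN hep
  set y : ℚ := x / N with hy
  set φ := twist ψe (y : ℂ) with hφ
  have hden : 0 < 2 * N * y.den := by have := y.den_pos; positivity
  have : NeZero (2 * N * y.den) := ⟨hden.ne'⟩
  have hφp : Function.Periodic φ ((2 * N * y.den : ℕ) : ℤ) := twist_periodic hep y
  have hφe : ∀ n, φ (-n) = φ n := fun n => by
    rw [hφ, twist, twist, hee]; push_cast; rw [neg_sq]
  obtain ⟨C', -, hC'⟩ := exists_bound_of_periodic hden hφp
  have hφ0 : φ 0 = ψ 0 := by simp [hφ, twist, hψe]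
  have hsplit : ∀ τ : ℂ, 0 < τ.im → halfTheta ψ τ = halfTheta ψo τ + halfTheta ψe τ := by
    intro τ hτ
    rw [halfTheta, halfTheta, halfTheta,
      ← (summable_halfTheta hCo hτ).tsum_add (summable_halfTheta hCe hτ)]
    refine tsum_congr fun n => ?_
    simp only [hψo, hψe]; ring
  have hscale : Tendsto (fun t : ℝ => t / N) (𝓝[>] 0) (𝓝[>] 0) := by
    rw [tendsto_nhdsWithin_iff]
    refine ⟨?_, ?_⟩
    · have hcont : Continuous fun t : ℝ => t / N := by fun_prop
      have := (hcont.tendsto 0).mono_left (nhdsWithin_le_nhds (s := Set.Ioi (0 : ℝ)))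
      simpa using this
    · filter_upwards [self_mem_nhdsWithin] with t (ht : 0 < t)
      exact div_pos ht hNR
  set S : ℂ := dft (2 * N * y.den) φ 0 / (2 * N * y.den : ℕ) with hS
  -- The even part is half a full theta series, and `(t/N)^{-1/2} = √N t^{-1/2}`.
  refine ⟨S / 2 * (√(N : ℝ) : ℝ), ?_⟩
  have L1 : Tendsto (fun t : ℝ => halfTheta ψo (((y : ℝ) : ℂ) + (t / N : ℝ) * I)) (𝓝[>] 0)
      (𝓝 (oddQuantum ψo N x)) := by
    have h := (tendsto_halfTheta_radial (x := (y : ℝ)) hCo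
      (by have := hoo 0; simp only [neg_zero] at this; exact self_eq_neg.mp this)
      (decaysAt_rat hN hop hoo y)).comp hscale
    have e : ((y : ℚ) : ℝ) = (x : ℝ) / N := by rw [hy]; push_cast; rfl
    rw [oddQuantum, ← e]
    exact h
  have L2 : Tendsto (fun t : ℝ => (fullTheta φ ((t / N : ℝ) * I) - S * ((√(t / N) : ℝ) : ℂ)⁻¹) / 2
      + ψ 0 / 2) (𝓝[>] 0) (𝓝 (0 / 2 + ψ 0 / 2)) :=
    (((tendsto_fullTheta_radial hφp).comp hscale).div_const 2).add_const _
  rw [zero_div, zero_add] at L2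
  refine (L1.add L2).congr' ?_
  filter_upwards [self_mem_nhdsWithin] with t (ht : 0 < t)
  have htN : 0 < t / N := div_pos ht hNR
  have harg : ((x : ℂ) + t * I) / N = ((y : ℝ) : ℂ) + (t / N : ℝ) * I := by
    rw [hy]; push_cast; field_simp
  have him : 0 < (((y : ℝ) : ℂ) + (t / N : ℝ) * I).im := by
    rw [Complex.add_im, Complex.ofReal_im, Complex.im_ofReal_mul]
    simpa using htN
  have him2 : 0 < (((t / N : ℝ) : ℂ) * I).im := by
    rw [Complex.im_ofReal_mul]; simpa using htN
  have h2 : halfTheta ψe (((y : ℝ) : ℂ) + (t / N : ℝ) * I) =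
      (fullTheta φ ((t / N : ℝ) * I) + ψ 0) / 2 := by
    rw [halfTheta_add, ← hφ0, ← two_mul_halfTheta hC' hφe him2, hφ]
    push_cast
    ring
  have h3 : ((√(t / N) : ℝ) : ℂ)⁻¹ = (√(N : ℝ) : ℝ) * ((√t : ℝ) : ℂ)⁻¹ := by
    rw [Real.sqrt_div ht.le]
    push_cast
    rw [inv_div, div_eq_mul_inv]
  rw [harg, hsplit _ him, h2, h3]
  ring

end

/-! ### Reduction of the partial theta function to periodic coefficients -/

noncomputable section

open Complex

/-- The function supported on `β + hℤ` whose value at `β + hn` is `χ n`. -/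
def dilate (h : ℕ) (β : ℤ) (χ : ℤ → ℂ) (k : ℤ) : ℂ :=
  if (h : ℤ) ∣ k - β then χ ((k - β) / h) else 0

theorem dilate_apply {h : ℕ} (hh : 0 < h) (β : ℤ) (χ : ℤ → ℂ) (n : ℤ) :
    dilate h β χ (β + h * n) = χ n := by
  have hh' : (h : ℤ) ≠ 0 := by exact_mod_cast hh.ne'
  rw [dilate, if_pos (by simp), add_sub_cancel_left, Int.mul_ediv_cancel_left _ hh']

theorem dilate_periodic {h : ℕ} (hh : 0 < h) (β : ℤ) {χ : ℤ → ℂ} {K : ℕ}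
    (hχ : Function.Periodic χ (K : ℤ)) :
    Function.Periodic (dilate h β χ) ((h * K : ℕ) : ℤ) := by
  have hh' : (h : ℤ) ≠ 0 := by exact_mod_cast hh.ne'
  intro k
  have e : k + ((h * K : ℕ) : ℤ) - β = (k - β) + h * K := by push_cast; ring
  simp only [dilate, e, dvd_add_left (Dvd.intro _ rfl), Int.add_mul_ediv_left _ _ hh', hχ _]

/-- Zero coefficients fill the gaps of the progression `β + hn`, so that the sum runs over all
integers from `β` on. -/
theorem tsum_dilate {h : ℕ} (hh : 0 < h) (β : ℤ) (χ : ℤ → ℂ) (τ : ℂ) :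
    ∑' n : ℕ, χ n * cexp (Real.pi * I * ((h : ℂ) * n + β) ^ 2 * τ) =
      ∑' j : ℕ, dilate h β χ (β + j) * cexp (Real.pi * I * ((β : ℂ) + j) ^ 2 * τ) := by
  have hinj : Function.Injective fun n : ℕ => h * n := fun a b hab =>
    Nat.eq_of_mul_eq_mul_left hh hab
  rw [← hinj.tsum_eq (f := fun j : ℕ =>
    dilate h β χ (β + j) * cexp (Real.pi * I * ((β : ℂ) + j) ^ 2 * τ))]
  · refine tsum_congr fun n => ?_
    have := dilate_apply hh β χ n
    push_cast
    rw [this, add_comm (β : ℂ)]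
  · intro j hj
    have h1 : dilate h β χ (β + j) ≠ 0 := left_ne_zero_of_mul hj
    rw [dilate, add_sub_cancel_left] at h1
    obtain ⟨n, hn⟩ : (h : ℤ) ∣ j := by
      by_contra hd
      exact h1 (if_neg hd)
    have hdvd : h ∣ j := by exact_mod_cast Dvd.intro n hn.symm
    obtain ⟨n, rfl⟩ := hdvd
    exact ⟨n, rfl⟩

/-- Shifting the start of a one-sided theta series changes it by an entire function. -/
theorem exists_tsum_eq_halfTheta_add {ψ : ℤ → ℂ} {C : ℝ} (hψ : ∀ n, ‖ψ n‖ ≤ C) (β : ℤ) :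
    ∃ E : ℂ → ℂ, Differentiable ℂ E ∧ ∀ τ : ℂ, 0 < τ.im →
      ∑' j : ℕ, ψ (β + j) * cexp (Real.pi * I * ((β : ℂ) + j) ^ 2 * τ) =
        halfTheta ψ τ + E τ := by
  obtain ⟨M, rfl | rfl⟩ := β.eq_nat_or_neg
  · refine ⟨fun τ => -∑ i ∈ Finset.range M, ψ i * cexp (Real.pi * I * (i : ℂ) ^ 2 * τ),
      by fun_prop, fun τ hτ => ?_⟩
    have hs := summable_halfTheta hψ hτ
    rw [halfTheta, ← hs.sum_add_tsum_nat_add M, add_neg_cancel_comm]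
    refine tsum_congr fun j => ?_
    push_cast
    rw [add_comm (M : ℤ), add_comm (M : ℂ)]
  · refine ⟨fun τ => ∑ i ∈ Finset.range M,
      ψ (-(M : ℤ) + i) * cexp (Real.pi * I * (-(M : ℂ) + i) ^ 2 * τ), by fun_prop,
      fun τ hτ => ?_⟩
    have hs := summable_halfTheta hψ hτ
    have e : ∀ j : ℕ, ψ (-(M : ℤ) + (j + M : ℕ)) *
        cexp (Real.pi * I * ((-(M : ℤ) : ℤ) + (j + M : ℕ) : ℂ) ^ 2 * τ) =
        ψ j * cexp (Real.pi * I * (j : ℂ) ^ 2 * τ) := fun j => by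
      push_cast
      rw [neg_add_eq_sub, neg_add_eq_sub, add_sub_cancel_right, add_sub_cancel_right]
    have hs' : Summable fun j : ℕ => ψ (-(M : ℤ) + j) *
        cexp (Real.pi * I * ((-(M : ℤ) : ℤ) + j : ℂ) ^ 2 * τ) := by
      rw [← summable_nat_add_iff M]
      simp_rw [e]
      exact hs
    rw [← hs'.sum_add_tsum_nat_add M, halfTheta]
    simp_rw [e]
    push_cast
    rw [add_comm]

theorem HasRadialValue.congr_add {F G E : ℂ → ℂ} {x : ℚ} {v : ℂ} (hF : HasRadialValue F x v)
    (hE : Continuous E) (h : ∀ τ : ℂ, 0 < τ.im → G τ = F τ + E τ) :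
    HasRadialValue G x (v + E x) := by
  obtain ⟨s, hs⟩ := hF
  refine ⟨s, ?_⟩
  have hcont : Continuous fun t : ℝ => E ((x : ℂ) + t * I) := by fun_prop
  have h1 := (hcont.tendsto 0).mono_left (nhdsWithin_le_nhds (s := Set.Ioi (0 : ℝ)))
  simp only [ofReal_zero, zero_mul, add_zero] at h1
  refine (hs.add h1).congr' ?_
  filter_upwards [self_mem_nhdsWithin] with t (ht : 0 < t)
  rw [h ((x : ℂ) + t * I) (by simpa using ht)]
  ring

/-- The sign and the elliptic character occurring in `partialTheta` for `M = p / 2`. -/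
def ellipticCharacter (p ε : ℕ) (l mu : ℚ) (n : ℤ) : ℂ :=
  cexp (Real.pi * I * (n * ε + 2 * mu * (p * n - l)))

/-- The factor `2 * mu.den` makes both the sign and the character of `mu` periodic; `D` is left free
so that the final period can equal the denominator of the exponents. -/
theorem ellipticCharacter_periodic (p ε : ℕ) (l mu : ℚ) (D : ℕ) :
    Function.Periodic (ellipticCharacter p ε l mu) ((2 * mu.den * D : ℕ) : ℤ) := by
  intro n
  refine exp_pi_I_eq_of_sub_even (mu.den * D * ε + 2 * mu.num * p * D) ?_
  have hmu : (mu : ℂ) * mu.den = mu.num := by exact_mod_cast Rat.mul_den_eq_num mu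
  push_cast
  linear_combination (4 * p * D : ℂ) * hmu

/-- Completing the square with `M = p/2`: `(pn-l)²/(2p) + λ(pn-l) + pλ²/2 = (pn+pλ-l)²/(2p)`.
Multiplying by the denominator of `pλ-l` makes the base integral; the extra factor `Q` cancels and
only adjusts the level. -/
theorem exp_mul_partialTheta {p : ℕ} (hp : 0 < p) (ε : ℕ) (l lam mu : ℚ) {Q : ℕ} (hQ : 0 < Q)
    (τ : ℂ) :
    cexp (2 * Real.pi * I * ((p * lam ^ 2 / 2 : ℚ) : ℂ) * τ) *
        partialTheta l ε (p / 2) (lam * τ + mu) τ =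
      ∑' n : ℕ, ellipticCharacter p ε l mu n *
        cexp (Real.pi * I * (((Q * p * (p * lam - l).den : ℕ) : ℂ) * n +
          ((Q * (p * lam - l).num : ℤ) : ℂ)) ^ 2 *
            (τ / ((Q * p * (p * lam - l).den) * (Q * (p * lam - l).den) : ℕ))) := by
  have hpC : (p : ℂ) ≠ 0 := by exact_mod_cast hp.ne'
  have hQC : (Q : ℂ) ≠ 0 := by exact_mod_cast hQ.ne'
  set α : ℚ := p * lam - l with hα
  have hDC : (α.den : ℂ) ≠ 0 := by exact_mod_cast α.den_pos.ne'
  have hnum : (α.num : ℂ) = (p * lam - l) * α.den := by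
    have : (α : ℂ) * α.den = α.num := by exact_mod_cast Rat.mul_den_eq_num α
    rw [← this, hα]; push_cast; ring
  rw [partialTheta, ← tsum_mul_left]
  refine tsum_congr fun n => ?_
  have hsign : (-1 : ℂ) ^ (n * ε) = cexp (Real.pi * I * (n * ε)) := by
    rw [← exp_pi_mul_I, ← Complex.exp_nat_mul]
    push_cast
    congr 1
    ring
  rw [hsign, ellipticCharacter, ← Complex.exp_add, ← Complex.exp_add, ← Complex.exp_add,
    ← Complex.exp_add]
  congr 1
  push_cast
  rw [hnum]
  field_simp
  ring

end

theorem theorem2p2 (m l : ℚ) (ε : ℕ) (lam mu : ℚ)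
    (hm : ∃ p : ℕ, 0 < p ∧ m = -((p : ℚ) / 2))
    (hl : ∃ j : ℤ, l = m + j)
    (hε : ε = 0 ∨ ε = 1) :
    ∃ (r : ℚ) (f : ℚ → ℂ) (Γ : Subgroup (Matrix.SpecialLinearGroup (Fin 2) ℤ)),
      (∀ x : ℚ, HasRadialValue
        (fun τ : ℂ => Complex.exp (2 * Real.pi * Complex.I * (r : ℂ) * τ)
          * partialTheta l ε (-m) ((lam : ℂ) * τ + (mu : ℂ)) τ) x (f x)) ∧
      IsQuantumModularFormHalf Γ Set.univ f := by
  obtain ⟨p, hp, rfl⟩ := hm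
  set Q : ℕ := 2 * mu.den with hQ
  set D : ℕ := ((p : ℚ) * lam - l).den with hD
  set β : ℤ := Q * ((p : ℚ) * lam - l).num with hβ
  set h : ℕ := Q * p * D with hh
  -- One number serves both as the period `h · QD` of the dilated character and as the denominator
  -- of `τ` in the exponents, as `oddQuantum` requires.
  set N : ℕ := h * (Q * D) with hN
  have hQ0 : 0 < Q := by have := mu.den_pos; positivity
  have hD0 : 0 < D := ((p : ℚ) * lam - l).den_pos
  have hh0 : 0 < h := by positivity
  have hN0 : 0 < N := by positivity
  have hN2 : Even N := ⟨h * (mu.den * D), by rw [hN, hQ]; ring⟩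
  set ψ := dilate h β (ellipticCharacter p ε l mu) with hψ
  have hper : Function.Periodic ψ (N : ℤ) :=
    dilate_periodic hh0 β (ellipticCharacter_periodic p ε l mu D)
  have hneg : ∀ n, ψ (-(n + N)) = ψ (-n) := fun n => by
    rw [← hper (-(n + N))]; congr 1; ring
  obtain ⟨C, -, hC⟩ := exists_bound_of_periodic hN0 hper
  obtain ⟨E, hE, hEτ⟩ := exists_tsum_eq_halfTheta_add hC β
  have hEN : Differentiable ℂ fun z : ℂ => E (z / N) := hE.comp (by fun_prop)
  refine ⟨p * lam ^ 2 / 2, fun x => oddQuantum (fun n => (ψ n - ψ (-n)) / 2) N x +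
    (ψ 0 / 2 + E ((x : ℂ) / N)), CongruenceSubgroup.Gamma (8 * N), fun x => ?_,
    isQuantumModularFormHalf_oddQuantum_add hN0 hN2 (fun n => ?_) (fun n => ?_)
      (g := fun z => ψ 0 / 2 + E (z / N)) (hEN.const_add _)⟩
  · beta_reduce
    rw [neg_neg, ← add_assoc]
    refine (hasRadialValue_halfTheta hN0 hper x).congr_add hEN.continuous fun τ hτ => ?_
    rw [exp_mul_partialTheta hp ε l lam mu hQ0, tsum_dilate hh0]
    refine hEτ _ ?_
    have hNR : (0 : ℝ) < N := by exact_mod_cast hN0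
    rw [← Complex.ofReal_natCast, Complex.div_ofReal_im]
    exact div_pos hτ hNR
  · simp only [hper n, hneg n]
  · simp only [neg_neg]
    ring
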